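/- Consider the Camassa–Holm equation $$u_t-u_{txx}+3uu_x=2u_xu_{xx}+uu_{xxx}.\tag{CH}$$ Put $V(\phi;a,c)=-\tfrac12\phi^2+\frac{a}{c-\phi}$ and let $\mathcal M\subset\mathbb R^3$ be the set of all $(a,E,c)$ with $c>0$, $0<a<4c^3/27$ and $V(\phi_2;a,c)<E<V(\phi_1;a,c)$, where $\phi_1\in(0,c/3)$ and $\phi_2\in(c/3,c)$ are the local maximum and the local minimum point of $V(\cdot;a,c)$ in $(0,c)$. A *wave train* with frequency $k>0$ and constants $(a,E,c)\in\mathcal M$ is a smooth function $\phi<c$ of $\theta=k(x-ct)$ with fundamental period $1$ such that $u(x,t)=\phi(k(x-ct))$ solves (CH) and $$\phi-k^2\phi''=\frac{a}{(c-\phi)^2},\qquad \tfrac12k^2(\phi')^2=E-V(\phi;a,c).$$ Its mass and momentum are $M=\int_0^1\phi\,d\theta$ and $P=\tfrac12\int_0^1(\phi^2+k^2(\phi')^2)\,d\theta$. Its period in $x$ is $$T(a,E,c)=\frac1k=\sqrt2\int_{\phi_{\min}}^{\phi_{\max}}\frac{d\phi}{\sqrt{E-V(\phi;a,c)}},$$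 where $(\phi_{\min},\phi_{\max})$ is the bounded component of $\{\phi<c: V(\phi;a,c)<E\}$; likewise $k$, $M$, $P$ are functions of $(a,E,c)\in\mathcal M$. Let $\phi_0$ be a wave train with frequency $k_0$, mass $M_0$, momentum $P_0$ and constants $(a_0,E_0,c_0)\in\mathcal M$ (so $c_0>0$). Suppose that the nearby wave trains form a smooth 3-manifold parameterized by $(k,M,P)$: there are an open neighborhood $U$ of $(k_0,M_0,P_0)$, smooth functions $(a,E,c):U\to\mathcal M$ and a function $\phi(\theta;k,M,P)$, smooth on $\mathbb R\times U$, such that for each $(k,M,P)\in U$ the function $\phi(\cdot;k,M,P)$ is a wave train with frequency $k$, mass $M$, momentum $P$ and constants $(a,E,c)(k,M,P)$, and $\phi(\cdot;k_0,M_0,P_0)=\phi_0$. Assume further that at $\phi_0$ $$\det\frac{\partial(k,M,P)}{\partial(a,E,c)}\neq0,\qquad \frac{\partial T}{\partial a}(a_0,E_0,c_0)\neq0,\qquad (c_M)^2+(c_P)^2\neq0,$$ where $c_M,c_P$ are partial derivatives of $c=c(k,M,P)$. Let $\mathcal W(\phi_0)$ be the $3\times3$ matrix of the Whitham modulation system $$k_T=(-kc)_X,\quad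 M_T=\Big(\int_0^1\!\big(-\tfrac32\phi^2-\tfrac12k^2\phi_\theta^2\big)d\theta\Big)_X,\quad P_T=\Big(\int_0^1\!\big(ck^2\phi_\theta^2-\phi^3+k^2\phi^2\phi_{\theta\theta}\big)d\theta\Big)_X$$ written as $(k,M,P)^{\mathsf T}_T=\mathcal W(\phi)\,(k,M,P)^{\mathsf T}_X$ and evaluated at $(k_0,M_0,P_0)$; that is, the Jacobian matrix in $(k,M,P)$ of the three quantities under $(\cdot)_X$ on the right. Let $$\mathcal A=k_0(1-k_0^2\partial_\theta^2)^{-1}\partial_\theta\mathcal L,\qquad \mathcal L=-k_0^2\partial_\theta(c_0-\phi_0)\partial_\theta+(c_0-3\phi_0+k_0^2\phi_0''),$$ be the linearization of (CH) about $\phi_0$ in the frame $\theta=k_0(x-c_0t)$, a closed, densely defined operator on $L^2(\mathbb R)$ with domain $H^1(\mathbb R)$. (i) If the Whitham system is strictly hyperbolic at $\phi_0$, i.e. the eigenvalues of $\mathcal W(\phi_0)$ are real and distinct, then $\phi_0$ is spectrally modulationally stable: there is $\varepsilon>0$ such that every $\lambda$ in the $L^2(\mathbb R)$-spectrum of $\mathcal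 A$ with $|\lambda|<\varepsilon$ is purely imaginary. (ii) If the Whitham system is elliptic at $\phi_0$, i.e. $\mathcal W(\phi_0)$ has an eigenvalue with non-zero imaginary part, then $\phi_0$ is spectrally unstable: the $L^2(\mathbb R)$-spectrum of $\mathcal A$ contains a $\lambda$ with $\operatorname{Re}\lambda>0$. -/

import Mathlib

open scoped ContDiff
open MeasureTheory Set

noncomputable section

namespace CamassaHolm

/-- Parameter space `ℝ³`. It carries both the coordinates `(a, E, c)` (the integration constants and
the speed of a wave) and the coordinates `(k, M, P)` (frequency, mass, momentum), in these orders. -/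
abbrev Par : Type := Fin 3 → ℝ

/-! ### The equation and its periodic traveling waves -/

/-- `u t x` solves the Camassa-Holm equation
`u_t - u_{txx} + 3 u u_x = 2 u_x u_{xx} + u u_{xxx}` pointwise. -/
def SolvesCH (u : ℝ → ℝ → ℝ) : Prop :=
  ∀ t x : ℝ,
    deriv (fun s => u s x) t - deriv (fun s => iteratedDeriv 2 (u s) x) t
        + 3 * u t x * deriv (u t) x
      = 2 * deriv (u t) x * iteratedDeriv 2 (u t) x + u t x * iteratedDeriv 3 (u t) x

/-- The effective potential `V(φ; a, c) = -φ²/2 + a / (c - φ)`. -/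
def potential (a c x : ℝ) : ℝ := -(1 / 2) * x ^ 2 + a / (c - x)

/-- The set of admissible `(a, E, c)`: `c > 0`, `0 < a < 4c³/27`, and `E` strictly between the values
of the potential at its local minimum `φ₂ ∈ (c/3, c)` and at its local maximum `φ₁ ∈ (0, c/3)`. -/
def admissible : Set Par :=
  {p | 0 < p 2 ∧ p 0 ∈ Ioo 0 (4 * p 2 ^ 3 / 27) ∧
    ∃ φ₁ ∈ Ioo 0 (p 2 / 3), ∃ φ₂ ∈ Ioo (p 2 / 3) (p 2),
      deriv (potential (p 0) (p 2)) φ₁ = 0 ∧ deriv (potential (p 0) (p 2)) φ₂ = 0 ∧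
      p 1 ∈ Ioo (potential (p 0) (p 2) φ₂) (potential (p 0) (p 2) φ₁)}

/-- `φ` is the profile, as a function of `θ = k (x - c t)`, of a smooth periodic traveling wave of the
Camassa-Holm equation with speed `c`, frequency `k` (so with fundamental period `1/k` in `x`) and
integration constants `a`, `E`, lying below its speed. -/
structure IsWaveTrain (k a E c : ℝ) (φ : ℝ → ℝ) : Prop where
  freq_pos : 0 < k
  smooth : ContDiff ℝ ∞ φ
  periodic : Function.Periodic φ 1
  fundamental : ∀ τ : ℝ, 0 < τ → τ < 1 → ¬ Function.Periodic φ τ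
  lt_speed : ∀ θ, φ θ < c
  solves : SolvesCH (fun t x => φ (k * (x - c * t)))
  profile : ∀ θ, φ θ - k ^ 2 * iteratedDeriv 2 φ θ = a / (c - φ θ) ^ 2
  quadrature : ∀ θ, (1 / 2) * (k * deriv φ θ) ^ 2 = E - potential a c (φ θ)

/-- Mass (over one period, in the variable `θ`). -/
def mass (φ : ℝ → ℝ) : ℝ := ∫ θ in (0 : ℝ)..1, φ θ

/-- Momentum (over one period, in the variable `θ`), where `∂_x = k ∂_θ`. -/
def momentum (k : ℝ) (φ : ℝ → ℝ) : ℝ :=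
  (1 / 2) * ∫ θ in (0 : ℝ)..1, (φ θ ^ 2 + k ^ 2 * deriv φ θ ^ 2)

/-! ### Period, mass and momentum as functions of `(a, E, c)` -/

/-- The open interval `(φ_min, φ_max)` swept by the wave: the bounded component of `{V < E}` below `c`,
to the left of which the potential exceeds `E`. -/
def well (p : Par) : Set ℝ :=
  {x | x < p 2 ∧ potential (p 0) (p 2) x < p 1 ∧ ∃ y < x, p 1 < potential (p 0) (p 2) y}

/-- `√2 ∫_{φ_min}^{φ_max} g(φ) / √(E - V(φ)) dφ`, the integral of `g(φ)` over one period in `x`. -/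
def wellIntegral (g : ℝ → ℝ) (p : Par) : ℝ :=
  √2 * ∫ x in well p, g x / √(p 1 - potential (p 0) (p 2) x)

/-- The period `T(a, E, c)` in the variable `x`. -/
def period (p : Par) : ℝ := wellIntegral (fun _ => 1) p

/-- The map `(a, E, c) ↦ (k, M, P)`, with `k = 1/T` and with `M`, `P` the mass and the momentum of the
wave rescaled to period one; here `φ_x² = 2 (E - V(φ))`. -/
def freqMassMomentum (p : Par) : Par :=
  ![1 / period p,
    (1 / period p) * wellIntegral (fun x => x) p,
    (1 / period p) *
      ((1 / 2) * wellIntegral (fun x => x ^ 2 + 2 * (p 1 - potential (p 0) (p 2) x)) p)]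

/-- The derivative `T_a` of the period in `a`, for fixed `E` and `c`. -/
def periodDerivA (p : Par) : ℝ := deriv (fun a => period ![a, p 1, p 2]) (p 0)

/-! ### The manifold of waves and the Whitham system -/

/-- The waves `Φ q`, `q = (k, M, P) ∈ U`, form a smooth manifold of periodic traveling waves
parameterized by frequency, mass and momentum; `γ q = (a, E, c)` are the constants of the wave. -/
structure IsWaveManifold (U : Set Par) (γ : Par → Par) (Φ : Par → ℝ → ℝ) : Prop where
  isOpen : IsOpen U
  smooth_params : ContDiffOn ℝ ∞ γ U
  smooth_profile : ContDiffOn ℝ ∞ (fun z : Par × ℝ => Φ z.1 z.2) (U ×ˢ univ)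
  params_mem : ∀ q ∈ U, γ q ∈ admissible
  wave : ∀ q ∈ U, IsWaveTrain (q 0) (γ q 0) (γ q 1) (γ q 2) (Φ q)
  mass_eq : ∀ q ∈ U, mass (Φ q) = q 1
  momentum_eq : ∀ q ∈ U, momentum (q 0) (Φ q) = q 2

/-- The right-hand sides of the Whitham modulation equations
`k_T = (-k c)_X`,
`M_T = ⟨-(3/2) φ² - (1/2) k² φ_θ²⟩_X`,
`P_T = ⟨c k² φ_θ² - φ³ + k² φ² φ_θθ⟩_X`
before the differentiation in `X`, as functions of `q = (k, M, P)`. -/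
def whithamFlux (γ : Par → Par) (Φ : Par → ℝ → ℝ) (q : Par) : Par :=
  ![-(q 0 * γ q 2),
    ∫ θ in (0 : ℝ)..1, (-(3 / 2) * Φ q θ ^ 2 - (1 / 2) * q 0 ^ 2 * deriv (Φ q) θ ^ 2),
    ∫ θ in (0 : ℝ)..1, (γ q 2 * q 0 ^ 2 * deriv (Φ q) θ ^ 2 - Φ q θ ^ 3
      + q 0 ^ 2 * Φ q θ ^ 2 * iteratedDeriv 2 (Φ q) θ)]

/-- The matrix `𝓦` of the quasilinear form `(k, M, P)_T = 𝓦 (k, M, P)_X` of the Whitham system: the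
matrix of partial derivatives of the fluxes in `(k, M, P)`. -/
def whithamMatrix (γ : Par → Par) (Φ : Par → ℝ → ℝ) (q : Par) : Matrix (Fin 3) (Fin 3) ℝ :=
  Matrix.of fun i j => fderiv ℝ (fun r => whithamFlux γ Φ r i) q (Pi.single j 1)

/-- The three eigenvalues of the real `3 × 3` matrix are real and distinct. -/
def StrictlyHyperbolic (W : Matrix (Fin 3) (Fin 3) ℝ) : Prop :=
  ∃ μ : Fin 3 → ℝ, Function.Injective μ ∧
    ∀ i, Module.End.HasEigenvalue (Matrix.toLin' W) (μ i)

/-- The matrix has a complex eigenvalue with nonzero imaginary part. -/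
def Elliptic (W : Matrix (Fin 3) (Fin 3) ℝ) : Prop :=
  ∃ μ : ℂ, μ.im ≠ 0 ∧
    Module.End.HasEigenvalue (Matrix.toLin' (W.map (fun x : ℝ => (x : ℂ)))) μ

/-! ### The linearization on `L²(ℝ)` and its spectrum -/

/-- `L²(ℝ; ℂ)`. -/
abbrev L2 : Type := Lp ℂ 2 (volume : Measure ℝ)

/-- The differential expression
`𝓛[φ] f = -k² ∂_θ ((c - φ) ∂_θ f) + (c - 3 φ + k² φ'') f`. -/
def hessian (k c : ℝ) (φ f : ℝ → ℝ) (θ : ℝ) : ℝ :=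
  -k ^ 2 * deriv (fun y => (c - φ y) * deriv f y) θ
    + (c - 3 * φ θ + k ^ 2 * iteratedDeriv 2 φ θ) * f θ

/-- `v` is in the domain of `𝓐[φ] = k (1 - k² ∂_θ²)⁻¹ ∂_θ 𝓛[φ]`, the linearization of the Camassa-Holm
equation about the wave `φ` in the frame `θ = k (x - c t)`, and `𝓐[φ] v = w`. That is, `v, w ∈ L²(ℝ)`
and `(1 - k² ∂_θ²) w = k ∂_θ 𝓛[φ] v` in the sense of distributions, where the derivatives and the
formally symmetric expression `𝓛[φ]` are moved to the test function. Since `1 - k² ∂_θ²` is injective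
on `L²(ℝ)`, there is at most one `w` for each `v`; when `φ` is smooth and periodic with `φ < c` the
domain is `H¹(ℝ)`. -/
def LinearizationApplies (k c : ℝ) (φ : ℝ → ℝ) (v w : L2) : Prop :=
  ∀ ψ : ℝ → ℝ, ContDiff ℝ ∞ ψ → HasCompactSupport ψ →
    ∫ θ, ((ψ θ - k ^ 2 * iteratedDeriv 2 ψ θ : ℝ) : ℂ) * w θ
      = -∫ θ, ((k * hessian k c φ (deriv ψ) θ : ℝ) : ℂ) * v θ

/-- The resolvent set of `𝓐[φ]` on `L²(ℝ)`: those `z` for which `z - 𝓐[φ]`, from the domain of `𝓐[φ]`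
to `L²(ℝ)`, is a bijection with a bounded inverse `R`. -/
def linearizationResolventSet (k c : ℝ) (φ : ℝ → ℝ) : Set ℂ :=
  {z | ∃ R : L2 →L[ℂ] L2, ∀ v f : L2,
    (∃ w, LinearizationApplies k c φ v w ∧ z • v - w = f) ↔ v = R f}

/-- The `L²(ℝ)`-spectrum of the linearization. -/
def linearizationSpectrum (k c : ℝ) (φ : ℝ → ℝ) : Set ℂ :=
  (linearizationResolventSet k c φ)ᶜ

/-- Near the origin the `L²(ℝ)`-spectrum of the linearization is purely imaginary. -/
def SpectrallyModulationallyStable (k c : ℝ) (φ : ℝ → ℝ) : Prop :=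
  ∃ ε > 0, ∀ z ∈ linearizationSpectrum k c φ, ‖z‖ < ε → z.re = 0

/-- The `L²(ℝ)`-spectrum of the linearization meets the open right half-plane. -/
def SpectrallyUnstable (k c : ℝ) (φ : ℝ → ℝ) : Prop :=
  ∃ z ∈ linearizationSpectrum k c φ, 0 < z.re

end CamassaHolm

end

/-!
# Whitham modulation equations and the spectrum of periodic Camassa-Holm waves

The spectrum of the linearization `𝓐` is studied through the formal adjoint of
`(1 - k² ∂²) (z - 𝓐)`, which acts on test functions as `ψ ↦ z (ψ - k² ψ'') + k 𝓛 ψ'`. As a first-order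
system (`AdjointSystem`) it depends affinely on `z` and has periodic coefficients, so that it has a
`3 × 3` monodromy matrix `M(z)`. Floquet theory on `L²(ℝ)` identifies the spectrum: `z` belongs to it if
and only if `M(z)` has an eigenvalue of modulus one (`AdjointSystem.mem_linearizationSpectrum_iff`). In
one direction (`exists_resolvent`) the Cayley-Hamilton theorem turns a product of three difference
operators `S - μ`, with `S` the shift by one period, into a local operator on the solutions; each factor
is bounded below when `|μ| ≠ 1`, which gives an a priori estimate and, by duality, a bounded inverse. In
the other direction (`not_exists_resolvent`) a bounded Floquet solution with a slowly varying cutoff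
contradicts the boundedness of an inverse. The Hamiltonian structure gives a pairing between solutions
at `z` and at `-z`; with complex conjugation it follows that a multiplier of modulus one at `z` is also a
multiplier at `-z̄` (`hasEigenvalue_monodromy_neg_conj`).

Near `z = 0` all three multipliers are close to `1`. Differentiating the family of waves along a direction
`(dk, dM, dP)` gives functions `X` with `𝓛 X` explicit (`exists_variation`), and from these, solutions of
the system up to `O(z²)`. On the corresponding initial data `M(z) - 1` is `O(z)`, and a second-order
computation in the remaining direction brings in the mass and the momentum of `X`
(`IsVariation.exists_monodromy_expansion`). The multipliers are therefore `1 + z x`, where `x` is a root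
of a cubic `p(z, ·)` that depends smoothly on `z`, and at `z = 0` the cubic is
`p(0, x) = C det(1 + x k (𝓦 + c))` (`IsWaveManifold.exists_dispersion_relation`). Here the Whitham fluxes
enter in the form `(-k c, E - c M, c E - a - c P)`, valid on the manifold of waves
(`IsWaveManifold.whithamFlux_eq`). The matrix `𝓦 + c` is invertible because `(k, M, P)` are coordinates on
the manifold (`IsWaveManifold.det_whithamMatrix_add_speed_ne_zero`), so the roots at `z = 0` are the
`-1 / (k (μ + c))` with `μ` an eigenvalue of `𝓦`.

In the hyperbolic case these roots are real, simple and nonzero, hence Lipschitz functions of `z`. If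
`1 + z x` has modulus one, it is a multiplier at `z` and at `-z̄`, with roots `x` and `y` such that
`z x = -z̄ y`. So `2 (Re z) x = z̄ (x - y) = O(|z| |Re z|)`, and `Re z = 0` for small `z`
(`re_eq_zero_of_root`). In the elliptic case there is a simple root `x₀` in the open upper half-plane, and
the equations `z x = exp (i ξ) - 1`, `p(z, x) = 0` can be solved near `(0, x₀)` for small real `ξ`, with
`z ≈ i ξ / x₀` of positive real part for `ξ > 0` (`exists_unit_multiplier`).
-/

noncomputable section

namespace CamassaHolm

/-! ### Linear differential equations on the line -/

section LinearODE

open scoped BoundedContinuousFunction Interval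

variable {F : Type*} [NormedAddCommGroup F] [NormedSpace ℂ F]

lemma abs_integral_exp_mul_abs_le {κ : ℝ} (hκ : 0 < κ) (θ : ℝ) :
    |∫ t in (0 : ℝ)..θ, Real.exp (κ * |t|)| ≤ Real.exp (κ * |θ|) / κ := by
  have key : ∀ s : ℝ, 0 ≤ s → ∫ t in (0 : ℝ)..s, Real.exp (κ * |t|) = (Real.exp (κ * s) - 1) / κ := by
    intro s hs
    have h1 : ∫ t in (0 : ℝ)..s, Real.exp (κ * |t|) = ∫ t in (0 : ℝ)..s, Real.exp (κ * t) := by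
      apply intervalIntegral.integral_congr
      intro t ht
      rw [uIcc_of_le hs] at ht
      simp [abs_of_nonneg ht.1]
    rw [h1, intervalIntegral.integral_comp_mul_left _ hκ.ne', integral_exp]
    simp [div_eq_inv_mul]
  have key2 : ∀ s : ℝ, 0 ≤ s → |∫ t in (0 : ℝ)..s, Real.exp (κ * |t|)| ≤ Real.exp (κ * s) / κ := by
    intro s hs
    have h1 : 1 ≤ Real.exp (κ * s) := Real.one_le_exp (by positivity)
    rw [key s hs, abs_of_nonneg (div_nonneg (by linarith) hκ.le)]
    gcongr
    linarith
  rcases le_total 0 θ with h | h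
  · rw [abs_of_nonneg h]; exact key2 θ h
  · have h2 : ∫ t in (0 : ℝ)..θ, Real.exp (κ * |t|) = -∫ t in (0 : ℝ)..(-θ), Real.exp (κ * |t|) := by
      have := intervalIntegral.integral_comp_neg (fun t => Real.exp (κ * |t|)) (a := 0) (b := -θ)
      simp only [abs_neg, neg_neg, neg_zero] at this
      rw [this, intervalIntegral.integral_symm]
    rw [h2, abs_neg, abs_of_nonpos h]
    exact key2 _ (by linarith)

/-- The weighted primitive `e^{-κ|θ|} ∫₀^θ e^{κ|t|} f(t) dt`. -/
def weightedPrimitive (κ : ℝ) (f : ℝ → F) (θ : ℝ) : F :=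
  Real.exp (-(κ * |θ|)) • ∫ t in (0 : ℝ)..θ, Real.exp (κ * |t|) • f t

lemma continuous_weightedPrimitive [CompleteSpace F] (κ : ℝ) {f : ℝ → F} (hf : Continuous f) :
    Continuous (weightedPrimitive κ f) := by
  unfold weightedPrimitive
  refine Continuous.smul (f := fun θ : ℝ => Real.exp (-(κ * |θ|))) (by fun_prop) ?_
  exact intervalIntegral.continuous_primitive
    (fun a b => (Continuous.intervalIntegrable (by fun_prop) a b)) 0

lemma norm_weightedPrimitive_le {κ : ℝ} (hκ : 0 < κ) {f : ℝ → F} {C : ℝ}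
    (hC : ∀ t, ‖f t‖ ≤ C) (θ : ℝ) : ‖weightedPrimitive κ f θ‖ ≤ C / κ := by
  have hC0 : 0 ≤ C := (norm_nonneg _).trans (hC 0)
  unfold weightedPrimitive
  rw [norm_smul, Real.norm_eq_abs, abs_of_pos (Real.exp_pos _)]
  have h1 : ‖∫ t in (0 : ℝ)..θ, Real.exp (κ * |t|) • f t‖
      ≤ |∫ t in (0 : ℝ)..θ, C * Real.exp (κ * |t|)| := by
    apply intervalIntegral.norm_integral_le_abs_of_norm_le
    · refine Filter.Eventually.of_forall fun t => ?_
      rw [norm_smul, Real.norm_eq_abs, abs_of_pos (Real.exp_pos _), mul_comm]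
      gcongr
      exact hC t
    · exact Continuous.intervalIntegrable (by fun_prop) _ _
  rw [intervalIntegral.integral_const_mul, abs_mul, abs_of_nonneg hC0] at h1
  have h2 := abs_integral_exp_mul_abs_le hκ θ
  calc _ ≤ Real.exp (-(κ * |θ|)) * (C * (Real.exp (κ * |θ|) / κ)) := by
        gcongr
        exact h1.trans (by gcongr)
    _ = C / κ := by
        rw [Real.exp_neg]
        field_simp

/-- The Volterra operator `u ↦ e^{-κ|θ|} ∫₀^θ e^{κ|t|} B(t) u(t) dt` on bounded continuous functions;
its norm is at most `β / κ`. -/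
def volterra [CompleteSpace F] {κ : ℝ} (hκ : 0 < κ) {B : ℝ → F →L[ℂ] F} (hB : Continuous B) {β : ℝ}
    (hβ : ∀ t, ‖B t‖ ≤ β) : (ℝ →ᵇ F) →L[ℂ] (ℝ →ᵇ F) :=
  LinearMap.mkContinuous
    { toFun := fun u => BoundedContinuousFunction.ofNormedAddCommGroup
        (weightedPrimitive κ fun t => B t (u t))
        (continuous_weightedPrimitive κ (hB.clm_apply u.continuous)) (β * ‖u‖ / κ)
        (norm_weightedPrimitive_le hκ fun t => (B t).le_of_opNorm_le_of_le (hβ t) (u.norm_coe_le_norm t))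
      map_add' := by
        intro u v
        ext θ
        simp only [weightedPrimitive, BoundedContinuousFunction.coe_ofNormedAddCommGroup,
          BoundedContinuousFunction.coe_add, Pi.add_apply, map_add, smul_add]
        rw [intervalIntegral.integral_add, smul_add]
        · exact Continuous.intervalIntegrable (by have := u.continuous; fun_prop) _ _
        · exact Continuous.intervalIntegrable (by have := v.continuous; fun_prop) _ _
      map_smul' := by
        intro a u
        ext θ
        simp only [weightedPrimitive, BoundedContinuousFunction.coe_ofNormedAddCommGroup,
          BoundedContinuousFunction.coe_smul, map_smul, RingHom.id_apply]
        simp_rw [smul_comm _ a]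
        rw [intervalIntegral.integral_smul, smul_comm _ a] }
    (β / κ) (by
      intro u
      have hβ0 : 0 ≤ β := (norm_nonneg _).trans (hβ 0)
      refine (BoundedContinuousFunction.norm_ofNormedAddCommGroup_le (C := β * ‖u‖ / κ) _
        (by positivity) (norm_weightedPrimitive_le hκ fun t =>
          (B t).le_of_opNorm_le_of_le (hβ t) (u.norm_coe_le_norm t))).trans ?_
      rw [mul_div_right_comm])

lemma volterra_apply [CompleteSpace F] {κ : ℝ} (hκ : 0 < κ) {B : ℝ → F →L[ℂ] F} (hB : Continuous B)
    {β : ℝ} (hβ : ∀ t, ‖B t‖ ≤ β) (u : ℝ →ᵇ F) (θ : ℝ) :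
    volterra hκ hB hβ u θ = weightedPrimitive κ (fun t => B t (u t)) θ := rfl

lemma norm_volterra_le [CompleteSpace F] {κ : ℝ} (hκ : 0 < κ) {B : ℝ → F →L[ℂ] F} (hB : Continuous B)
    {β : ℝ} (hβ : ∀ t, ‖B t‖ ≤ β) : ‖volterra hκ hB hβ‖ ≤ β / κ := by
  have hβ0 : 0 ≤ β := (norm_nonneg _).trans (hβ 0)
  exact LinearMap.mkContinuous_norm_le _ (by positivity) _

/-- A linear equation `y' = (B₀ + z B₁) y + h` with bounded coefficients has a solution on the whole
line with prescribed value at `0`, which depends continuously differentiably on the parameter `z`.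
In the norm with weight `e^{-κ|θ|}`, `κ` large, the integral equation is a contraction, so its solution
is given by the inverse of a small perturbation of the identity. -/
theorem exists_linear_ode_solution [CompleteSpace F] {B₀ B₁ : ℝ → F →L[ℂ] F} (hB₀ : Continuous B₀)
    (hB₁ : Continuous B₁) {β : ℝ} (hβ₀ : ∀ t, ‖B₀ t‖ ≤ β) (hβ₁ : ∀ t, ‖B₁ t‖ ≤ β)
    {h : ℝ → F} (hh : Continuous h) {η : ℝ} (hη : ∀ t, ‖h t‖ ≤ η) (y₀ : F) (r : ℝ) :
    ∃ Y : ℂ → ℝ → F, (∀ z, ‖z‖ < r → Y z 0 = y₀ ∧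
      ∀ θ, HasDerivAt (Y z) (B₀ θ (Y z θ) + z • B₁ θ (Y z θ) + h θ) θ) ∧
      ∀ θ z, ‖z‖ < r → ContDiffAt ℂ 1 (fun z => Y z θ) z := by
  have hβ0 : 0 ≤ β := (norm_nonneg _).trans (hβ₀ 0)
  set κ : ℝ := β + |r| * β + 1 with hκdef
  have hκ : 0 < κ := by positivity
  set K₀ := volterra hκ hB₀ hβ₀
  set K₁ := volterra hκ hB₁ hβ₁
  have hη0 : 0 ≤ η := (norm_nonneg _).trans (hη 0)
  have hexp1 : ∀ t : ℝ, Real.exp (-(κ * |t|)) ≤ 1 := fun t => by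
    rw [Real.exp_le_one_iff]; simp; positivity
  set h' : ℝ → F := fun t => Real.exp (-(κ * |t|)) • h t with hh'
  have hh'c : Continuous h' := by fun_prop
  have hh'b : ∀ t, ‖h' t‖ ≤ η := fun t => by
    rw [hh', norm_smul, Real.norm_eq_abs, abs_of_pos (Real.exp_pos _)]
    calc _ ≤ 1 * η := by gcongr; exacts [hexp1 t, hη t]
      _ = η := one_mul _
  set b : ℝ →ᵇ F := BoundedContinuousFunction.ofNormedAddCommGroup
    (fun θ => Real.exp (-(κ * |θ|)) • y₀ + weightedPrimitive κ h' θ)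
    (by have := continuous_weightedPrimitive κ hh'c; fun_prop) (‖y₀‖ + η / κ) (by
      intro θ
      refine (norm_add_le _ _).trans (add_le_add ?_ (norm_weightedPrimitive_le hκ hh'b θ))
      rw [norm_smul, Real.norm_eq_abs, abs_of_pos (Real.exp_pos _)]
      calc _ ≤ 1 * ‖y₀‖ := by gcongr; exact hexp1 θ
        _ = _ := one_mul _) with hb
  have hb_apply : ∀ θ, b θ = Real.exp (-(κ * |θ|)) • y₀ + weightedPrimitive κ h' θ := fun θ => rfl
  have hunit : ∀ z : ℂ, ‖z‖ < r → ‖K₀ + z • K₁‖ < 1 := by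
    intro z hz
    have h1 : ‖K₀‖ ≤ β / κ := norm_volterra_le hκ hB₀ hβ₀
    have h2 : ‖K₁‖ ≤ β / κ := norm_volterra_le hκ hB₁ hβ₁
    calc _ ≤ ‖K₀‖ + ‖z‖ * ‖K₁‖ := (norm_add_le _ _).trans (by rw [norm_smul])
      _ ≤ β / κ + |r| * (β / κ) := by
          gcongr
          exact hz.le.trans (le_abs_self r)
      _ = (β + |r| * β) / κ := by ring
      _ < 1 := by rw [div_lt_one hκ]; linarith
  set u : ℂ → ℝ →ᵇ F := fun z => Ring.inverse (1 - (K₀ + z • K₁)) b with hu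
  have hueq : ∀ z : ℂ, ‖z‖ < r → ∀ θ, u z θ = Real.exp (-(κ * |θ|)) • y₀ +
      weightedPrimitive κ (fun t => B₀ t (u z t) + z • B₁ t (u z t) + h' t) θ := by
    intro z hz θ
    have h1 : IsUnit (1 - (K₀ + z • K₁)) := isUnit_one_sub_of_norm_lt_one (hunit z hz)
    have h2 : (1 - (K₀ + z • K₁)) (u z) = b := by
      rw [hu]
      simp only
      rw [← mul_apply_eq_comp, Ring.mul_inverse_cancel _ h1]
      rfl
    have h3 : u z = b + (K₀ (u z) + z • K₁ (u z)) := by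
      rw [← h2]
      simp
    have h4 := congrArg (fun w : ℝ →ᵇ F => w θ) h3
    simp only [BoundedContinuousFunction.coe_add, Pi.add_apply, BoundedContinuousFunction.coe_smul] at h4
    rw [hb_apply, volterra_apply, volterra_apply] at h4
    rw [h4]
    have hc := (u z).continuous
    simp only [weightedPrimitive, smul_add]
    rw [intervalIntegral.integral_add, intervalIntegral.integral_add]
    · simp_rw [smul_comm _ z]
      rw [intervalIntegral.integral_smul]
      simp only [smul_add, smul_comm _ z]
      abel
    all_goals exact Continuous.intervalIntegrable (by fun_prop) _ _
  refine ⟨fun z θ => Real.exp (κ * |θ|) • u z θ, ?_, ?_⟩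
  · intro z hz
    have hc := (u z).continuous
    have hY : ∀ θ, Real.exp (κ * |θ|) • u z θ = y₀ + ∫ t in (0 : ℝ)..θ,
        (B₀ t (Real.exp (κ * |t|) • u z t) + z • B₁ t (Real.exp (κ * |t|) • u z t) + h t) := by
      intro θ
      rw [hueq z hz θ, smul_add, smul_smul, weightedPrimitive, smul_smul, ← Real.exp_add,
        add_neg_cancel, Real.exp_zero, one_smul, one_smul]
      congr 1
      apply intervalIntegral.integral_congr
      intro t _
      simp only [hh', smul_add, smul_smul, ← Real.exp_add, add_neg_cancel, Real.exp_zero, one_smul]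
      congr 2
      · rw [← Complex.coe_smul, ← Complex.coe_smul, map_smul]
      · rw [← Complex.coe_smul, ← Complex.coe_smul, map_smul, smul_comm]
    refine ⟨(hY 0).trans (by simp), fun θ => ?_⟩
    have h5 : HasDerivAt (fun θ => y₀ + ∫ t in (0 : ℝ)..θ,
        (B₀ t (Real.exp (κ * |t|) • u z t) + z • B₁ t (Real.exp (κ * |t|) • u z t) + h t))
        (B₀ θ (Real.exp (κ * |θ|) • u z θ) + z • B₁ θ (Real.exp (κ * |θ|) • u z θ) + h θ) θ := by
      apply HasDerivAt.const_add
      have hcont : Continuous fun t => (B₀ t (Real.exp (κ * |t|) • u z t) +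
        z • B₁ t (Real.exp (κ * |t|) • u z t) + h t) := by fun_prop
      exact intervalIntegral.integral_hasDerivAt_right (hcont.intervalIntegrable _ _)
        (hcont.stronglyMeasurableAtFilter _ _) hcont.continuousAt
    refine h5.congr_of_eventuallyEq (Filter.Eventually.of_forall fun θ => hY θ)
  · intro θ z hz
    have h1 : IsUnit (1 - (K₀ + z • K₁)) := isUnit_one_sub_of_norm_lt_one (hunit z hz)
    have h2 : ContDiffAt ℂ 1 (fun z : ℂ => Ring.inverse (1 - (K₀ + z • K₁))) z := by
      have h3 := contDiffAt_ringInverse ℂ (n := 1) h1.unit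
      rw [IsUnit.unit_spec] at h3
      exact ContDiffAt.comp (g := Ring.inverse) (f := fun z : ℂ => 1 - (K₀ + z • K₁)) z h3
        (by fun_prop)
    have h4 : ContDiffAt ℂ 1 u z := h2.clm_apply contDiffAt_const
    have h5 : ContDiffAt ℂ 1 (fun z => BoundedContinuousFunction.evalCLM ℂ θ (u z)) z :=
      contDiffAt_const.clm_apply h4
    exact h5.const_smul (Real.exp (κ * |θ|))

/-- A solution of a linear equation with bounded coefficients is determined by its value at a point. -/
theorem linear_ode_unique {B : ℝ → F →L[ℂ] F} {β : ℝ} (hβ : ∀ t, ‖B t‖ ≤ β) {h : ℝ → F}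
    {f g : ℝ → F} (hf : ∀ θ, HasDerivAt f (B θ (f θ) + h θ) θ)
    (hg : ∀ θ, HasDerivAt g (B θ (g θ) + h θ) θ) {t₀ : ℝ} (h0 : f t₀ = g t₀) : f = g := by
  have hβ0 : 0 ≤ β := (norm_nonneg _).trans (hβ 0)
  refine ODE_solution_unique_univ (v := fun t y => B t y + h t) (s := fun _ => univ) (K := ⟨β, hβ0⟩)
    (t₀ := t₀) (fun t => ?_) (fun t => ⟨hf t, mem_univ _⟩) (fun t => ⟨hg t, mem_univ _⟩) h0
  refine (LipschitzWith.of_dist_le_mul fun x y => ?_).lipschitzOnWith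
  rw [dist_eq_norm, dist_eq_norm, add_sub_add_right_eq_sub, ← map_sub]
  exact (B t).le_of_opNorm_le (hβ t) _

end LinearODE

/-! ### The adjoint eigenvalue equation as a periodic first-order system -/

/-- A continuous periodic function is bounded. -/
lemma exists_norm_le_of_periodic {E : Type*} [NormedAddCommGroup E] {f : ℝ → E}
    (hf : Continuous f) (hp : Function.Periodic f 1) : ∃ C, ∀ t, ‖f t‖ ≤ C := by
  obtain ⟨C, hC⟩ := (hp.compact_of_continuous one_ne_zero hf).isBounded.exists_norm_le
  exact ⟨C, fun t => hC _ (mem_range_self t)⟩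

/-- Coefficients of the first-order system
`y₀' = y₁`, `y₁' = ρ (y₂ / k² - z y₁)`, `y₂' = q y₁ + z y₀ - g`
with spectral parameter `z`. For a wave `φ` with speed `c` one takes `ρ = 1 / (k (c - φ))` and
`q = k (c - 3 φ + k² φ'')`; then `y₀ = ψ` solves `z (ψ - k² ψ'') + k 𝓛[φ] ψ' = g`. -/
structure AdjointSystem where
  k : ℝ
  ρ : ℝ → ℝ
  q : ℝ → ℝ
  k_pos : 0 < k
  ρ_pos : ∀ θ, 0 < ρ θ
  ρ_smooth : ContDiff ℝ ∞ ρ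
  q_smooth : ContDiff ℝ ∞ q
  ρ_periodic : Function.Periodic ρ 1
  q_periodic : Function.Periodic q 1

namespace AdjointSystem

variable (S : AdjointSystem)

/-- `y` solves the system with parameter `z` and forcing `g`. -/
def IsSolution (z : ℂ) (g : ℝ → ℂ) (y : ℝ → Fin 3 → ℂ) : Prop :=
  ∀ θ, HasDerivAt y ![y θ 1, S.ρ θ * (y θ 2 / S.k ^ 2 - z * y θ 1),
    S.q θ * y θ 1 + z * y θ 0 - g θ] θ

/-- The part of the system that does not depend on the spectral parameter. -/
def coeff₀ (θ : ℝ) : (Fin 3 → ℂ) →L[ℂ] (Fin 3 → ℂ) :=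
  (ContinuousLinearMap.proj (φ := fun _ : Fin 3 => ℂ) 1).smulRight (Pi.single 0 1)
    + ((S.ρ θ / S.k ^ 2 : ℝ) : ℂ) •
      (ContinuousLinearMap.proj (φ := fun _ : Fin 3 => ℂ) 2).smulRight (Pi.single 1 1)
    + (S.q θ : ℂ) • (ContinuousLinearMap.proj (φ := fun _ : Fin 3 => ℂ) 1).smulRight (Pi.single 2 1)

/-- The part of the system that multiplies the spectral parameter. -/
def coeff₁ (θ : ℝ) : (Fin 3 → ℂ) →L[ℂ] (Fin 3 → ℂ) :=
  (-(S.ρ θ : ℂ)) • (ContinuousLinearMap.proj (φ := fun _ : Fin 3 => ℂ) 1).smulRight (Pi.single 1 1)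
    + (ContinuousLinearMap.proj (φ := fun _ : Fin 3 => ℂ) 0).smulRight (Pi.single 2 1)

lemma coeff₀_apply (θ : ℝ) (y : Fin 3 → ℂ) :
    S.coeff₀ θ y = ![y 1, S.ρ θ / S.k ^ 2 * y 2, S.q θ * y 1] := by
  ext i
  fin_cases i <;> simp [coeff₀]

lemma coeff₁_apply (θ : ℝ) (y : Fin 3 → ℂ) : S.coeff₁ θ y = ![0, -(S.ρ θ * y 1), y 0] := by
  ext i
  fin_cases i <;> simp [coeff₁]

lemma continuous_coeff₀ : Continuous S.coeff₀ := by
  have := S.ρ_smooth.continuous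
  have := S.q_smooth.continuous
  unfold coeff₀
  fun_prop

lemma continuous_coeff₁ : Continuous S.coeff₁ := by
  have := S.ρ_smooth.continuous
  unfold coeff₁
  fun_prop

lemma exists_norm_coeff_le : ∃ β, (∀ t, ‖S.coeff₀ t‖ ≤ β) ∧ ∀ t, ‖S.coeff₁ t‖ ≤ β := by
  obtain ⟨a, ha⟩ := exists_norm_le_of_periodic S.continuous_coeff₀
    (fun t => by simp [coeff₀, S.ρ_periodic t, S.q_periodic t])
  obtain ⟨b, hb⟩ := exists_norm_le_of_periodic S.continuous_coeff₁
    (fun t => by simp [coeff₁, S.ρ_periodic t])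
  exact ⟨max a b, fun t => (ha t).trans (le_max_left _ _), fun t => (hb t).trans (le_max_right _ _)⟩

lemma coeff_add_forcing (z : ℂ) (θ : ℝ) (y : Fin 3 → ℂ) (g : ℂ) :
    S.coeff₀ θ y + z • S.coeff₁ θ y + Pi.single 2 (-g) =
      ![y 1, S.ρ θ * (y 2 / S.k ^ 2 - z * y 1), S.q θ * y 1 + z * y 0 - g] := by
  rw [coeff₀_apply, coeff₁_apply]
  ext i
  fin_cases i <;> simp <;> ring

variable {S}

lemma isSolution_iff {z : ℂ} {g : ℝ → ℂ} {y : ℝ → Fin 3 → ℂ} : S.IsSolution z g y ↔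
    ∀ θ, HasDerivAt y ((S.coeff₀ θ + z • S.coeff₁ θ) (y θ) + Pi.single 2 (-g θ)) θ := by
  refine forall_congr' fun θ => ?_
  rw [← S.coeff_add_forcing]
  rfl

lemma isSolution_iff_components {z : ℂ} {g : ℝ → ℂ} {y : ℝ → Fin 3 → ℂ} : S.IsSolution z g y ↔
    ∀ θ, HasDerivAt (fun t => y t 0) (y θ 1) θ ∧
      HasDerivAt (fun t => y t 1) (S.ρ θ * (y θ 2 / S.k ^ 2 - z * y θ 1)) θ ∧
      HasDerivAt (fun t => y t 2) (S.q θ * y θ 1 + z * y θ 0 - g θ) θ := by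
  refine forall_congr' fun θ => ?_
  rw [hasDerivAt_pi, Fin.forall_fin_succ, Fin.forall_fin_succ, Fin.forall_fin_succ]
  simp

lemma IsSolution.unique {z : ℂ} {g : ℝ → ℂ} {y w : ℝ → Fin 3 → ℂ} (hy : S.IsSolution z g y)
    (hw : S.IsSolution z g w) {t₀ : ℝ} (h0 : y t₀ = w t₀) : y = w := by
  obtain ⟨β, h₀, h₁⟩ := S.exists_norm_coeff_le
  refine linear_ode_unique (β := β + ‖z‖ * β) (fun t => ?_) (isSolution_iff.1 hy)
    (isSolution_iff.1 hw) h0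
  refine (norm_add_le _ _).trans (add_le_add (h₀ t) ?_)
  rw [norm_smul]
  gcongr
  exact h₁ t

variable (S) in
lemma exists_isSolution (z : ℂ) {g : ℝ → ℂ} (hg : Continuous g) {η : ℝ} (hη : ∀ t, ‖g t‖ ≤ η)
    (t₀ : ℝ) (y₀ : Fin 3 → ℂ) : ∃ y, S.IsSolution z g y ∧ y t₀ = y₀ := by
  obtain ⟨β, h₀, h₁⟩ := S.exists_norm_coeff_le
  have hc₀ := S.continuous_coeff₀
  have hc₁ := S.continuous_coeff₁
  obtain ⟨Y, hY, -⟩ := exists_linear_ode_solution (B₀ := fun t => S.coeff₀ (t + t₀))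
    (B₁ := fun t => S.coeff₁ (t + t₀)) (by fun_prop) (by fun_prop) (fun t => h₀ (t + t₀))
    (fun t => h₁ (t + t₀)) (h := fun t => Pi.single 2 (-g (t + t₀)))
    (by
      refine continuous_pi fun i => ?_
      by_cases hi : i = 2
      · subst hi; simp; fun_prop
      · simp [Pi.single_eq_of_ne hi]; fun_prop) (η := η)
    (fun t => by rw [Pi.norm_single, norm_neg]; exact hη _) y₀ (‖z‖ + 1)
  obtain ⟨hY0, hYd⟩ := hY z (by linarith)
  refine ⟨fun θ => Y z (θ - t₀), isSolution_iff.2 fun θ => ?_, by simpa using hY0⟩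
  have h := (hYd (θ - t₀)).comp_sub_const θ t₀
  simpa using! h

lemma IsSolution.continuous {z : ℂ} {g : ℝ → ℂ} {y : ℝ → Fin 3 → ℂ} (hy : S.IsSolution z g y) :
    Continuous y :=
  continuous_iff_continuousAt.2 fun θ => (hy θ).continuousAt

lemma contDiff_ofReal_comp {n : WithTop ℕ∞} {f : ℝ → ℝ} (hf : ContDiff ℝ n f) :
    ContDiff ℝ n (fun θ => (f θ : ℂ)) :=
  Complex.ofRealCLM.contDiff.comp hf

lemma IsSolution.contDiff {z : ℂ} {g : ℝ → ℂ} {y : ℝ → Fin 3 → ℂ} (hy : S.IsSolution z g y)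
    (hg : ContDiff ℝ ∞ g) : ContDiff ℝ ∞ y := by
  rw [contDiff_infty]
  intro n
  induction n with
  | zero => exact contDiff_zero.2 hy.continuous
  | succ n ih =>
    push_cast
    rw [contDiff_succ_iff_deriv]
    refine ⟨fun θ => (hy θ).differentiableAt, by simp, ?_⟩
    have hd : deriv y = fun θ => ![y θ 1, S.ρ θ * (y θ 2 / S.k ^ 2 - z * y θ 1),
        S.q θ * y θ 1 + z * y θ 0 - g θ] := funext fun θ => (hy θ).deriv
    have hρ : ContDiff ℝ n (fun θ => (S.ρ θ : ℂ)) :=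
      contDiff_ofReal_comp (contDiff_infty.1 S.ρ_smooth n)
    have hq : ContDiff ℝ n (fun θ => (S.q θ : ℂ)) :=
      contDiff_ofReal_comp (contDiff_infty.1 S.q_smooth n)
    have hg' : ContDiff ℝ n g := contDiff_infty.1 hg n
    have hc : ∀ i, ContDiff ℝ n (fun θ => y θ i) := contDiff_pi.1 ih
    have h0 := hc 0
    have h1 := hc 1
    have h2 := hc 2
    rw [hd, contDiff_pi]
    intro i
    fin_cases i
    · simpa using h1
    · simp only [div_eq_mul_inv]
      exact hρ.mul ((h2.mul contDiff_const).sub (contDiff_const.mul h1))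
    · exact ((hq.mul h1).add (contDiff_const.mul h0)).sub hg'

lemma IsSolution.add {z : ℂ} {g h : ℝ → ℂ} {y w : ℝ → Fin 3 → ℂ} (hy : S.IsSolution z g y)
    (hw : S.IsSolution z h w) : S.IsSolution z (g + h) (y + w) := by
  rw [isSolution_iff] at *
  intro θ
  refine ((hy θ).add (hw θ)).congr_deriv ?_
  simp only [Pi.add_apply, map_add, neg_add, Pi.single_add]
  abel

lemma IsSolution.const_smul {z : ℂ} {g : ℝ → ℂ} {y : ℝ → Fin 3 → ℂ} (hy : S.IsSolution z g y)
    (a : ℂ) : S.IsSolution z (a • g) (a • y) := by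
  rw [isSolution_iff] at *
  intro θ
  refine ((hy θ).const_smul a).congr_deriv ?_
  simp only [Pi.smul_apply, map_smul, smul_add, ← Pi.single_smul, smul_neg]

lemma IsSolution.shift {z : ℂ} {g : ℝ → ℂ} {y : ℝ → Fin 3 → ℂ} (hy : S.IsSolution z g y) :
    S.IsSolution z (fun θ => g (θ + 1)) (fun θ => y (θ + 1)) := by
  intro θ
  have := (hy (θ + 1)).comp_add_const θ 1
  rwa [S.ρ_periodic, S.q_periodic] at this

variable (S) in
/-- The solution of the homogeneous system with given value at `0`. -/
def flow (z : ℂ) (y₀ : Fin 3 → ℂ) : ℝ → Fin 3 → ℂ :=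
  (S.exists_isSolution z (g := 0) continuous_const (η := 0) (by simp) 0 y₀).choose

variable (S) in
lemma isSolution_flow (z : ℂ) (y₀ : Fin 3 → ℂ) : S.IsSolution z 0 (S.flow z y₀) :=
  (S.exists_isSolution z (g := 0) continuous_const (η := 0) (by simp) 0 y₀).choose_spec.1

variable (S) in
@[simp] lemma flow_zero (z : ℂ) (y₀ : Fin 3 → ℂ) : S.flow z y₀ 0 = y₀ :=
  (S.exists_isSolution z (g := 0) continuous_const (η := 0) (by simp) 0 y₀).choose_spec.2

lemma IsSolution.eq_flow {z : ℂ} {y : ℝ → Fin 3 → ℂ} (hy : S.IsSolution z 0 y) :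
    y = S.flow z (y 0) :=
  hy.unique (S.isSolution_flow z _) (t₀ := 0) (by simp)

variable (S) in
/-- The monodromy map over one period. Its eigenvalues are the Floquet multipliers. -/
def monodromy (z : ℂ) : Module.End ℂ (Fin 3 → ℂ) where
  toFun y₀ := S.flow z y₀ 1
  map_add' u v := by
    have h := (S.isSolution_flow z u).add (S.isSolution_flow z v)
    rw [add_zero] at h
    have h2 := h.eq_flow
    simp only [Pi.add_apply, flow_zero] at h2
    rw [← h2]
    rfl
  map_smul' a u := by
    have h := (S.isSolution_flow z u).const_smul a
    rw [smul_zero] at h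
    have h2 := h.eq_flow
    simp only [Pi.smul_apply, flow_zero] at h2
    rw [← h2]
    rfl

lemma IsSolution.apply_one {z : ℂ} {y : ℝ → Fin 3 → ℂ} (hy : S.IsSolution z 0 y) :
    y 1 = S.monodromy z (y 0) := by
  conv_lhs => rw [hy.eq_flow]
  rfl

/-- The difference `y(θ + 1) - μ y(θ)`. -/
def floquetDiff {E : Type*} [AddCommGroup E] [Module ℂ E] (μ : ℂ) (y : ℝ → E) (θ : ℝ) : E :=
  y (θ + 1) - μ • y θ

lemma IsSolution.floquetDiff {z : ℂ} {g : ℝ → ℂ} {y : ℝ → Fin 3 → ℂ} (hy : S.IsSolution z g y)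
    (μ : ℂ) : S.IsSolution z (floquetDiff μ g) (floquetDiff μ y) := by
  have h := hy.shift.add (hy.const_smul (-μ))
  have e1 : AdjointSystem.floquetDiff μ y = (fun θ => y (θ + 1)) + (-μ) • y := by
    ext θ; simp [AdjointSystem.floquetDiff, sub_eq_add_neg]
  have e2 : AdjointSystem.floquetDiff μ g = (fun θ => g (θ + 1)) + (-μ) • g := by
    ext θ; simp [AdjointSystem.floquetDiff, sub_eq_add_neg]
  rw [e1, e2]
  exact h

lemma floquetDiff_zero (μ : ℂ) : floquetDiff μ (0 : ℝ → ℂ) = 0 := by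
  ext; simp [floquetDiff]

variable (S) in
/-- An eigenvector of the monodromy map extends to a Floquet solution. -/
lemma exists_floquet_solution {z μ : ℂ} (h : (S.monodromy z).HasEigenvalue μ) :
    ∃ y, S.IsSolution z 0 y ∧ y 0 ≠ 0 ∧ ∀ θ, y (θ + 1) = μ • y θ := by
  obtain ⟨v, hv⟩ := h.exists_hasEigenvector
  have hs := S.isSolution_flow z v
  have hd := hs.floquetDiff μ
  rw [floquetDiff_zero] at hd
  refine ⟨S.flow z v, hs, by simpa using hv.2, fun θ => ?_⟩
  have h0 : AdjointSystem.floquetDiff μ (S.flow z v) 0 = (0 : ℝ → Fin 3 → ℂ) 0 := by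
    have := hv.apply_eq_smul
    simp only [AdjointSystem.floquetDiff, zero_add, flow_zero, Pi.zero_apply, sub_eq_zero]
    exact this
  have hz : S.IsSolution z 0 (0 : ℝ → Fin 3 → ℂ) := by
    have := hs.const_smul 0
    rwa [zero_smul, zero_smul] at this
  have := congrFun (hd.unique hz h0) θ
  simpa [AdjointSystem.floquetDiff, sub_eq_zero] using! this

variable (S) in
/-- By the Cayley-Hamilton theorem a product of three difference operators `y(· + 1) - μ y`, with `μ` the
Floquet multipliers, annihilates every solution of the homogeneous system. -/
lemma exists_multipliers (z : ℂ) : ∃ μ : Fin 3 → ℂ, (∀ i, (S.monodromy z).HasEigenvalue (μ i)) ∧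
    ∀ y, S.IsSolution z 0 y → floquetDiff (μ 0) (floquetDiff (μ 1) (floquetDiff (μ 2) y)) = 0 := by
  set M := S.monodromy z
  have hdeg : M.charpoly.natDegree = 3 := by rw [LinearMap.charpoly_natDegree]; simp
  have hsplit : M.charpoly.Splits := IsAlgClosed.splits _
  have hcard : M.charpoly.roots.card = 3 := by
    exact hsplit.natDegree_eq_card_roots.symm.trans hdeg
  obtain ⟨a, b, c, habc⟩ := Multiset.card_eq_three.1 hcard
  have hprod := hsplit.eq_prod_roots_of_monic M.charpoly_monic
  rw [habc] at hprod
  have hCH := M.aeval_self_charpoly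
  rw [hprod] at hCH
  have hroot : ∀ x ∈ M.charpoly.roots, M.HasEigenvalue x := fun x hx => by
    rw [Module.End.hasEigenvalue_iff_isRoot_charpoly]
    exact Polynomial.isRoot_of_mem_roots hx
  rw [habc] at hroot
  refine ⟨![a, b, c], ?_, ?_⟩
  · intro i
    fin_cases i <;> exact hroot _ (by simp)
  · intro y hy
    have h1 := hy.floquetDiff c
    have h2 := h1.floquetDiff b
    have h3 := h2.floquetDiff a
    rw [floquetDiff_zero] at h1
    rw [floquetDiff_zero, floquetDiff_zero] at h2
    rw [floquetDiff_zero, floquetDiff_zero, floquetDiff_zero] at h3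
    have hz : S.IsSolution z 0 (0 : ℝ → Fin 3 → ℂ) := by
      have := hy.const_smul 0
      rwa [zero_smul, zero_smul] at this
    refine h3.unique hz (t₀ := 0) ?_
    have e : ∀ (μ : ℂ) (w : ℝ → Fin 3 → ℂ), S.IsSolution z 0 w →
        AdjointSystem.floquetDiff μ w 0 = (M - algebraMap ℂ _ μ) (w 0) := by
      intro μ w hw
      simp [AdjointSystem.floquetDiff, hw.apply_one, M, Module.algebraMap_end_apply]
    change AdjointSystem.floquetDiff a _ 0 = 0
    rw [e a _ h2, e b _ h1, e c _ hy]
    have := congrArg (fun T : Module.End ℂ (Fin 3 → ℂ) => T (y 0)) hCH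
    simpa using! this

/-- The solutions for the parameters `z` and `-conj z` are in duality: a sesquilinear form that is
nondegenerate for `z ≠ 0` is constant along pairs of solutions. Hence the multipliers on the unit
circle are the same for `z` and `-conj z`. -/
lemma hasEigenvalue_monodromy_neg_conj {z μ : ℂ} (hz : z ≠ 0) (hμ : ‖μ‖ = 1)
    (h : (S.monodromy z).HasEigenvalue μ) : (S.monodromy (-(starRingEnd ℂ) z)).HasEigenvalue μ := by
  have hk : (S.k : ℂ) ≠ 0 := by exact_mod_cast S.k_pos.ne'
  obtain ⟨y, hy, hy0, hyF⟩ := S.exists_floquet_solution h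
  have hμ0 : μ ≠ 0 := by rintro rfl; simp at hμ
  have hμμ : (starRingEnd ℂ) μ * μ = 1 := by
    rw [mul_comm, Complex.mul_conj, Complex.normSq_eq_norm_sq, hμ]; simp
  set z' := -(starRingEnd ℂ) z
  -- The form evaluated on `y` and on the conjugate of a solution `w` for the parameter `-conj z`.
  let J : (Fin 3 → ℂ) → (Fin 3 → ℂ) → ℂ := fun u v =>
    u 1 * (starRingEnd ℂ) (v 2) - u 2 * (starRingEnd ℂ) (v 1) + z * (u 0 * (starRingEnd ℂ) (v 0))
      + z * S.k ^ 2 * (u 1 * (starRingEnd ℂ) (v 1))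
  have hconst : ∀ w, S.IsSolution z' 0 w → ∀ a b, J (y a) (w a) = J (y b) (w b) := by
    intro w hw a b
    rw [isSolution_iff_components] at hy hw
    have hd : ∀ θ, HasDerivAt (fun t => J (y t) (w t)) 0 θ := by
      intro θ
      obtain ⟨y0, y1, y2⟩ := hy θ
      obtain ⟨w0, w1, w2⟩ := hw θ
      have w0' := w0.star
      have w1' := w1.star
      have w2' := w2.star
      have := (((y1.mul w2').sub (y2.mul w1')).add ((y0.mul w0').const_mul z)).add
        ((y1.mul w1').const_mul (z * S.k ^ 2))
      refine this.congr_deriv ?_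
      simp only [Pi.zero_apply, star_sub, star_add, star_mul', star_div₀, z', sub_zero,
        Complex.star_def, map_pow, Complex.conj_ofReal, map_neg, Complex.conj_conj]
      field_simp
      ring
    exact is_const_of_deriv_eq_zero (fun θ => (hd θ).differentiableAt) (fun θ => (hd θ).deriv) a b
  -- The functional `J (y 0) ·` annihilates the range of `M(-conj z) - μ`.
  by_contra hne
  have hsurj : Function.Surjective
      (S.monodromy z' - algebraMap ℂ (Module.End ℂ (Fin 3 → ℂ)) μ) := by
    rw [← LinearMap.injective_iff_surjective, ← LinearMap.ker_eq_bot]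
    by_contra hker
    exact hne (by rwa [Module.End.hasEigenvalue_iff, Module.End.eigenspace_def])
  have hann : ∀ v, J (y 0) v = 0 := by
    intro v
    obtain ⟨w₀, rfl⟩ := hsurj v
    have hw := S.isSolution_flow z' w₀
    have h1 := hconst _ hw 1 0
    have hy1 : y 1 = μ • y 0 := by simpa using hyF 0
    rw [hy1, hw.apply_one, flow_zero] at h1
    simp only [J, LinearMap.sub_apply, Module.algebraMap_end_apply, Pi.sub_apply, Pi.smul_apply,
      smul_eq_mul, map_sub, map_mul] at h1 ⊢
    linear_combination (starRingEnd ℂ μ) * h1 - J (y 0) (S.monodromy z' w₀) * hμμ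
  apply hy0
  have e0 := hann (Pi.single 0 1)
  have e1 := hann (Pi.single 1 1)
  have e2 := hann (Pi.single 2 1)
  simp [J] at e0 e1 e2
  have f0 : y 0 0 = 0 := e0.resolve_left hz
  rw [e2] at e1
  simp at e1
  ext i
  fin_cases i
  · simpa using f0
  · simpa using e2
  · simpa using e1

end AdjointSystem

namespace AdjointSystem

variable {S : AdjointSystem}

/-! ### Scalar form of the adjoint equation and local estimates -/

variable (S) in
/-- `ψ - k² ψ''`. -/
def helmholtz (ψ : ℝ → ℂ) (θ : ℝ) : ℂ := ψ θ - S.k ^ 2 * deriv (deriv ψ) θ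

variable (S) in
/-- The scalar operator `z (ψ - k² ψ'') + q ψ' - (k² ψ'' / ρ)'`, formally adjoint to `z - 𝓐` after
multiplication by `1 - k² ∂²`. -/
def adjointOp (z : ℂ) (ψ : ℝ → ℂ) (θ : ℝ) : ℂ :=
  z * S.helmholtz ψ θ + S.q θ * deriv ψ θ
    - deriv (fun t => (S.k ^ 2 / S.ρ t : ℝ) * deriv (deriv ψ) t) θ

variable (S) in
/-- The state vector of a scalar function. -/
def state (z : ℂ) (ψ : ℝ → ℂ) (θ : ℝ) : Fin 3 → ℂ :=
  ![ψ θ, deriv ψ θ, (S.k ^ 2 / S.ρ θ : ℝ) * deriv (deriv ψ) θ + z * S.k ^ 2 * deriv ψ θ]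

lemma contDiff_deriv {E : Type*} [NormedAddCommGroup E] [NormedSpace ℝ E] {ψ : ℝ → E}
    (hψ : ContDiff ℝ ∞ ψ) : ContDiff ℝ ∞ (deriv ψ) :=
  (contDiff_infty_iff_deriv.1 hψ).2

lemma contDiff_quotient : ContDiff ℝ ∞ (fun t => ((S.k ^ 2 / S.ρ t : ℝ) : ℂ)) :=
  contDiff_ofReal_comp (contDiff_const.div S.ρ_smooth fun t => (S.ρ_pos t).ne')

lemma contDiff_helmholtz {ψ : ℝ → ℂ} (hψ : ContDiff ℝ ∞ ψ) : ContDiff ℝ ∞ (S.helmholtz ψ) :=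
  hψ.sub (contDiff_const.mul (contDiff_deriv (contDiff_deriv hψ)))

lemma contDiff_adjointOp (z : ℂ) {ψ : ℝ → ℂ} (hψ : ContDiff ℝ ∞ ψ) :
    ContDiff ℝ ∞ (S.adjointOp z ψ) := by
  have h1 := contDiff_deriv hψ
  have h2 := contDiff_deriv h1
  exact ((contDiff_const.mul (contDiff_helmholtz hψ)).add
    ((contDiff_ofReal_comp S.q_smooth).mul h1)).sub (contDiff_deriv (contDiff_quotient.mul h2))

lemma hasDerivAt_of_contDiff {E : Type*} [NormedAddCommGroup E] [NormedSpace ℝ E] {ψ : ℝ → E}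
    (hψ : ContDiff ℝ ∞ ψ) (θ : ℝ) : HasDerivAt ψ (deriv ψ θ) θ :=
  ((contDiff_infty_iff_deriv.1 hψ).1 θ).hasDerivAt

variable (S) in
lemma isSolution_state (z : ℂ) {ψ : ℝ → ℂ} (hψ : ContDiff ℝ ∞ ψ) :
    S.IsSolution z (S.adjointOp z ψ) (S.state z ψ) := by
  have h1 := contDiff_deriv hψ
  have h2 := contDiff_deriv h1
  have hk : (S.k : ℂ) ≠ 0 := by exact_mod_cast S.k_pos.ne'
  rw [isSolution_iff_components]
  intro θ
  have hρ : (S.ρ θ : ℂ) ≠ 0 := by exact_mod_cast (S.ρ_pos θ).ne'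
  refine ⟨hasDerivAt_of_contDiff hψ θ, (hasDerivAt_of_contDiff h1 θ).congr_deriv ?_,
    ((hasDerivAt_of_contDiff (contDiff_quotient.mul h2) θ).add
      ((hasDerivAt_of_contDiff h1 θ).const_mul (z * S.k ^ 2))).congr_deriv ?_⟩
  · simp only [state, Matrix.cons_val]
    push_cast
    field_simp
    ring
  · simp only [state, Matrix.cons_val, adjointOp, helmholtz]
    ring

lemma IsSolution.state_eq {z : ℂ} {g : ℝ → ℂ} {y : ℝ → Fin 3 → ℂ} (hy : S.IsSolution z g y) :
    S.state z (fun θ => y θ 0) = y := by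
  have hc := isSolution_iff_components.1 hy
  have hk : (S.k : ℂ) ≠ 0 := by exact_mod_cast S.k_pos.ne'
  have d1 : deriv (fun θ => y θ 0) = fun θ => y θ 1 := funext fun θ => (hc θ).1.deriv
  have d2 : deriv (fun θ => y θ 1) = fun θ => S.ρ θ * (y θ 2 / S.k ^ 2 - z * y θ 1) :=
    funext fun θ => (hc θ).2.1.deriv
  funext θ
  have hρ : (S.ρ θ : ℂ) ≠ 0 := by exact_mod_cast (S.ρ_pos θ).ne'
  ext i
  fin_cases i
  · simp [state]
  · simp [state, d1]
  · simp only [state, d1, d2, Fin.reduceFinMk, Matrix.cons_val]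
    push_cast
    field_simp
    ring

lemma IsSolution.adjointOp_eq {z : ℂ} {g : ℝ → ℂ} {y : ℝ → Fin 3 → ℂ} (hy : S.IsSolution z g y)
    (hg : ContDiff ℝ ∞ g) : S.adjointOp z (fun θ => y θ 0) = g := by
  have h0 : ContDiff ℝ ∞ fun θ => y θ 0 := contDiff_pi.1 (hy.contDiff hg) 0
  have h := isSolution_iff_components.1 (S.isSolution_state z h0)
  have hc := isSolution_iff_components.1 hy
  rw [hy.state_eq] at h
  funext θ
  have := (h θ).2.2.unique (hc θ).2.2
  linear_combination -this

lemma IsSolution.helmholtz_eq {z : ℂ} {g : ℝ → ℂ} {y : ℝ → Fin 3 → ℂ} (hy : S.IsSolution z g y)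
    (θ : ℝ) : S.helmholtz (fun θ => y θ 0) θ =
      y θ 0 - S.ρ θ * (y θ 2 - z * S.k ^ 2 * y θ 1) := by
  have hc := isSolution_iff_components.1 hy
  have hk : (S.k : ℂ) ≠ 0 := by exact_mod_cast S.k_pos.ne'
  have d1 : deriv (fun θ => y θ 0) = fun θ => y θ 1 := funext fun θ => (hc θ).1.deriv
  rw [helmholtz, d1, (hc θ).2.1.deriv]
  field_simp

/-- Energy estimate for a forced solution that starts from zero. -/
lemma exists_energy_estimate (S : AdjointSystem) (z : ℂ) : ∃ β : ℝ, 0 ≤ β ∧ ∀ (g : ℝ → ℂ)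
    (y : ℝ → Fin 3 → ℂ), Continuous g → S.IsSolution z g y → ∀ t₀ t, t₀ ≤ t → y t₀ = 0 →
      ‖y t‖ ^ 2 ≤ Real.exp (β * (t - t₀)) * ∫ s in t₀..t, ‖g s‖ ^ 2 := by
  obtain ⟨r, hr⟩ := exists_norm_le_of_periodic S.ρ_smooth.continuous S.ρ_periodic
  obtain ⟨Q, hQ⟩ := exists_norm_le_of_periodic S.q_smooth.continuous S.q_periodic
  have hr0 : 0 ≤ r := (norm_nonneg _).trans (hr 0)
  have hQ0 : 0 ≤ Q := (norm_nonneg _).trans (hQ 0)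
  have hk := S.k_pos
  set β : ℝ := 2 * (1 + r / S.k ^ 2 + r * ‖z‖ + Q + ‖z‖) + 1 with hβ
  have hβ0 : 0 ≤ β := by positivity
  refine ⟨β, hβ0, fun g y hg hy t₀ t htt h0 => ?_⟩
  have hc := isSolution_iff_components.1 hy
  set N : ℝ → ℝ := fun s => ‖y s 0‖ ^ 2 + ‖y s 1‖ ^ 2 + ‖y s 2‖ ^ 2 with hN
  have hNd : ∀ s, ∃ N', HasDerivAt N N' s ∧ N' ≤ β * N s + ‖g s‖ ^ 2 := by
    intro s
    obtain ⟨d0, d1, d2⟩ := hc s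
    refine ⟨_, (d0.norm_sq.add d1.norm_sq).add d2.norm_sq, ?_⟩
    have e0 := real_inner_le_norm (y s 0) (y s 1)
    have e1 := real_inner_le_norm (y s 1) (S.ρ s * (y s 2 / S.k ^ 2 - z * y s 1))
    have e2 := real_inner_le_norm (y s 2) (S.q s * y s 1 + z * y s 0 - g s)
    have n1 : ‖(S.ρ s : ℂ) * (y s 2 / S.k ^ 2 - z * y s 1)‖
        ≤ r * (‖y s 2‖ / S.k ^ 2 + ‖z‖ * ‖y s 1‖) := by
      rw [norm_mul, Complex.norm_real]
      gcongr
      · exact hr s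
      · refine (norm_sub_le _ _).trans ?_
        rw [norm_div, norm_pow, norm_mul, Complex.norm_real, Real.norm_eq_abs, sq_abs]
    have n2 : ‖S.q s * y s 1 + z * y s 0 - g s‖ ≤ Q * ‖y s 1‖ + ‖z‖ * ‖y s 0‖ + ‖g s‖ := by
      refine (norm_sub_le _ _).trans (add_le_add_left ((norm_add_le _ _).trans ?_) _)
      rw [norm_mul, norm_mul, Complex.norm_real]
      gcongr
      exact hQ s
    have m1 := mul_le_mul_of_nonneg_left n1 (norm_nonneg (y s 1))
    have m2 := mul_le_mul_of_nonneg_left n2 (norm_nonneg (y s 2))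
    set a := ‖y s 0‖
    set b := ‖y s 1‖
    set c := ‖y s 2‖
    set G := ‖g s‖
    have hNs : N s = a ^ 2 + b ^ 2 + c ^ 2 := rfl
    have p1 : a * b ≤ N s := by rw [hNs]; nlinarith [sq_nonneg (a - b), sq_nonneg (a + b), sq_nonneg c]
    have p2 : b * c ≤ N s := by rw [hNs]; nlinarith [sq_nonneg (b - c), sq_nonneg (b + c), sq_nonneg a]
    have p3 : b * b ≤ N s := by rw [hNs]; nlinarith [sq_nonneg a, sq_nonneg c]
    have p4 : c * a ≤ N s := by rw [hNs]; nlinarith [sq_nonneg (a - c), sq_nonneg (a + c), sq_nonneg b]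
    have p5 : 2 * (c * G) ≤ N s + G ^ 2 := by
      rw [hNs]; nlinarith [sq_nonneg (c - G), sq_nonneg a, sq_nonneg b]
    have r1 : r / S.k ^ 2 * (b * c) ≤ r / S.k ^ 2 * N s := by gcongr
    have r2 : r * ‖z‖ * (b * b) ≤ r * ‖z‖ * N s := by gcongr
    have r3 : Q * (b * c) ≤ Q * N s := by gcongr
    have r4 : ‖z‖ * (c * a) ≤ ‖z‖ * N s := by gcongr
    have m1' : b * (r * (c / S.k ^ 2 + ‖z‖ * b)) = r / S.k ^ 2 * (b * c) + r * ‖z‖ * (b * b) := by ring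
    have m2' : c * (Q * b + ‖z‖ * a + G) = Q * (b * c) + ‖z‖ * (c * a) + c * G := by ring
    rw [hβ]
    linarith
  set P : ℝ → ℝ := fun s => Real.exp (-(β * (s - t₀))) * N s - ∫ x in t₀..s, ‖g x‖ ^ 2 with hP
  have hgc : Continuous fun x => ‖g x‖ ^ 2 := by fun_prop
  have hPd : ∀ s, ∃ P', HasDerivAt P P' s ∧ (t₀ ≤ s → P' ≤ 0) := by
    intro s
    obtain ⟨N', hN', hle⟩ := hNd s
    have he : HasDerivAt (fun s => Real.exp (-(β * (s - t₀))))
        (Real.exp (-(β * (s - t₀))) * (-β)) s := by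
      have : HasDerivAt (fun s => -(β * (s - t₀))) (-β) s := by
        simpa using (((hasDerivAt_id s).sub_const t₀).const_mul β).fun_neg
      exact this.exp
    have hi : HasDerivAt (fun s => ∫ x in t₀..s, ‖g x‖ ^ 2) (‖g s‖ ^ 2) s :=
      intervalIntegral.integral_hasDerivAt_right (hgc.intervalIntegrable _ _)
        (hgc.stronglyMeasurableAtFilter _ _) hgc.continuousAt
    refine ⟨_, (he.mul hN').sub hi, fun hs => ?_⟩
    have h1 : Real.exp (-(β * (s - t₀))) ≤ 1 := by
      rw [Real.exp_le_one_iff]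
      have := mul_nonneg hβ0 (sub_nonneg.2 hs)
      linarith
    have h2 : Real.exp (-(β * (s - t₀))) * (N' - β * N s) ≤ ‖g s‖ ^ 2 := by
      calc _ ≤ Real.exp (-(β * (s - t₀))) * ‖g s‖ ^ 2 := by gcongr; linarith
        _ ≤ 1 * ‖g s‖ ^ 2 := by gcongr
        _ = _ := one_mul _
    linarith
  have hanti : AntitoneOn P (Icc t₀ t) := by
    refine antitoneOn_of_deriv_nonpos (convex_Icc _ _) ?_ ?_ ?_
    · intro s _
      obtain ⟨P', h, -⟩ := hPd s
      exact h.continuousAt.continuousWithinAt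
    · intro s _
      obtain ⟨P', h, -⟩ := hPd s
      exact h.differentiableAt.differentiableWithinAt
    · intro s hs
      rw [interior_Icc] at hs
      obtain ⟨P', h, h'⟩ := hPd s
      rw [h.deriv]
      exact h' hs.1.le
  have hPt := hanti (left_mem_Icc.2 htt) (right_mem_Icc.2 htt) htt
  have hP0 : P t₀ = 0 := by simp [hP, hN, h0]
  rw [hP0] at hPt
  have hNt : N t ≤ Real.exp (β * (t - t₀)) * ∫ s in t₀..t, ‖g s‖ ^ 2 := by
    have h1 : Real.exp (-(β * (t - t₀))) * N t ≤ ∫ s in t₀..t, ‖g s‖ ^ 2 := by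
      simp only [hP] at hPt; linarith
    calc N t = Real.exp (β * (t - t₀)) * (Real.exp (-(β * (t - t₀))) * N t) := by
          rw [← mul_assoc, ← Real.exp_add]; simp
      _ ≤ _ := by gcongr
  refine le_trans ?_ hNt
  have hNt0 : 0 ≤ N t := by positivity
  rw [← Real.sq_sqrt hNt0]
  gcongr
  rw [pi_norm_le_iff_of_nonneg (Real.sqrt_nonneg _)]
  intro i
  apply Real.le_sqrt_of_sq_le
  fin_cases i <;> simp [hN] <;> nlinarith [sq_nonneg ‖y t 0‖, sq_nonneg ‖y t 1‖, sq_nonneg ‖y t 2‖]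

lemma isSolution_zero (z : ℂ) : S.IsSolution z 0 0 := by
  have := (S.isSolution_flow z 0).const_smul 0
  rwa [zero_smul, zero_smul] at this

variable (S) in
lemma exists_homogeneous (z : ℂ) (t₀ : ℝ) (y₀ : Fin 3 → ℂ) : ∃ y, S.IsSolution z 0 y ∧ y t₀ = y₀ :=
  S.exists_isSolution z (g := 0) continuous_const (η := 0) (by simp) t₀ y₀

lemma IsSolution.sub {z : ℂ} {g h : ℝ → ℂ} {y w : ℝ → Fin 3 → ℂ} (hy : S.IsSolution z g y)
    (hw : S.IsSolution z h w) : S.IsSolution z (g - h) (y - w) := by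
  have := hy.add (hw.const_smul (-1))
  simpa [sub_eq_add_neg] using this

lemma floquetDiff_sub {E : Type*} [AddCommGroup E] [Module ℂ E] (μ : ℂ) (y w : ℝ → E) :
    floquetDiff μ (y - w) = floquetDiff μ y - floquetDiff μ w := by
  ext θ
  simp only [floquetDiff, Pi.sub_apply, smul_sub]
  abel

/-- The composition of three Floquet differences. -/
def floquetDiff₃ {E : Type*} [AddCommGroup E] [Module ℂ E] (μ : Fin 3 → ℂ) (y : ℝ → E) : ℝ → E :=
  floquetDiff (μ 0) (floquetDiff (μ 1) (floquetDiff (μ 2) y))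

lemma floquetDiff₃_apply {E : Type*} [AddCommGroup E] [Module ℂ E] (μ : Fin 3 → ℂ) (y : ℝ → E)
    (θ : ℝ) : floquetDiff₃ μ y θ = y (θ + 3) - (μ 0 + μ 1 + μ 2) • y (θ + 2)
      + (μ 0 * μ 1 + μ 0 * μ 2 + μ 1 * μ 2) • y (θ + 1) - (μ 0 * μ 1 * μ 2) • y θ := by
  simp only [floquetDiff₃, floquetDiff]
  rw [show θ + 1 + 1 + 1 = θ + 3 by ring, show θ + 1 + 1 = θ + 2 by ring]
  module

lemma IsSolution.floquetDiff₃ {z : ℂ} {g : ℝ → ℂ} {y : ℝ → Fin 3 → ℂ} (hy : S.IsSolution z g y)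
    (μ : Fin 3 → ℂ) : S.IsSolution z (floquetDiff₃ μ g) (floquetDiff₃ μ y) :=
  ((hy.floquetDiff _).floquetDiff _).floquetDiff _

/-- The multipliers annihilate homogeneous solutions, so the difference of a forced solution is
controlled by the forcing over the next three periods. -/
lemma exists_local_estimate (z : ℂ) {μ : Fin 3 → ℂ}
    (hμ : ∀ y, S.IsSolution z 0 y → floquetDiff₃ μ y = 0) :
    ∃ C : ℝ, 0 ≤ C ∧ ∀ (g : ℝ → ℂ) (y : ℝ → Fin 3 → ℂ), Continuous g → S.IsSolution z g y →
      ∀ θ, ‖floquetDiff₃ μ y θ‖ ^ 2 ≤ C * ∫ s in θ..(θ + 3), ‖g s‖ ^ 2 := by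
  obtain ⟨β, hβ0, hβ⟩ := exists_energy_estimate S z
  set A : ℝ := 1 + ‖μ 0 + μ 1 + μ 2‖ + ‖μ 0 * μ 1 + μ 0 * μ 2 + μ 1 * μ 2‖ with hA
  refine ⟨A ^ 2 * Real.exp (β * 3), by positivity, fun g y hg hy θ => ?_⟩
  obtain ⟨w, hw, hwθ⟩ := S.exists_homogeneous z θ (y θ)
  have hD := hy.sub hw
  rw [sub_zero] at hD
  have hDθ : (y - w) θ = 0 := by simp [hwθ]
  have hyD : floquetDiff₃ μ y = floquetDiff₃ μ (y - w) := by
    have h := hμ w hw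
    simp only [AdjointSystem.floquetDiff₃] at h ⊢
    rw [floquetDiff_sub, floquetDiff_sub, floquetDiff_sub, h, sub_zero]
  set G := ∫ s in θ..(θ + 3), ‖g s‖ ^ 2 with hG
  have hgc : Continuous fun x => ‖g x‖ ^ 2 := by fun_prop
  have hG0 : 0 ≤ G := intervalIntegral.integral_nonneg (by linarith) fun _ _ => by positivity
  have hb : ∀ t, 0 ≤ t → t ≤ 3 → ‖(y - w) (θ + t)‖ ≤ √(Real.exp (β * 3) * G) := by
    intro t ht0 ht3
    apply Real.le_sqrt_of_sq_le
    refine (hβ g (y - w) hg hD θ (θ + t) (by linarith) hDθ).trans ?_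
    gcongr
    · apply intervalIntegral.integral_nonneg (by linarith)
      intro _ _; positivity
    · linarith
    · refine intervalIntegral.integral_mono_interval le_rfl (by linarith) (by linarith) ?_
        (hgc.intervalIntegrable _ _)
      exact Filter.Eventually.of_forall fun _ => by positivity
  have h3 := hb 3 (by norm_num) le_rfl
  have h2 := hb 2 (by norm_num) (by norm_num)
  have h1 := hb 1 (by norm_num) (by norm_num)
  rw [hyD, floquetDiff₃_apply, hDθ, smul_zero, sub_zero]
  set R := √(Real.exp (β * 3) * G) with hR
  have hnorm : ‖(y - w) (θ + 3) - (μ 0 + μ 1 + μ 2) • (y - w) (θ + 2)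
      + (μ 0 * μ 1 + μ 0 * μ 2 + μ 1 * μ 2) • (y - w) (θ + 1)‖ ≤ A * R := by
    refine (norm_add_le _ _).trans ((add_le_add_left (norm_sub_le _ _) _).trans ?_)
    rw [norm_smul, norm_smul, hA, add_mul, add_mul, one_mul]
    gcongr
  calc _ ≤ (A * R) ^ 2 := by gcongr
    _ = A ^ 2 * (Real.exp (β * 3) * G) := by rw [mul_pow, hR, Real.sq_sqrt (by positivity)]
    _ = _ := by ring

variable (S) in
lemma exists_norm_helmholtz_le (z : ℂ) : ∃ C : ℝ, 0 ≤ C ∧ ∀ (g : ℝ → ℂ) (y : ℝ → Fin 3 → ℂ),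
    S.IsSolution z g y → ∀ θ, ‖S.helmholtz (fun θ => y θ 0) θ‖ ≤ C * ‖y θ‖ := by
  obtain ⟨r, hr⟩ := exists_norm_le_of_periodic S.ρ_smooth.continuous S.ρ_periodic
  have hr0 : 0 ≤ r := (norm_nonneg _).trans (hr 0)
  refine ⟨1 + r * (1 + ‖z‖ * S.k ^ 2), by have := S.k_pos; positivity, fun g y hy θ => ?_⟩
  have n0 := norm_le_pi_norm (y θ) 0
  have n1 := norm_le_pi_norm (y θ) 1
  have n2 := norm_le_pi_norm (y θ) 2
  rw [hy.helmholtz_eq]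
  have h1 : ‖y θ 2 - z * S.k ^ 2 * y θ 1‖ ≤ ‖y θ‖ + ‖z‖ * S.k ^ 2 * ‖y θ‖ := by
    refine (norm_sub_le _ _).trans (add_le_add n2 ?_)
    rw [norm_mul, norm_mul, norm_pow, Complex.norm_real, Real.norm_eq_abs, sq_abs]
    gcongr
  calc _ ≤ ‖y θ 0‖ + ‖(S.ρ θ : ℂ)‖ * ‖y θ 2 - z * S.k ^ 2 * y θ 1‖ := by
        rw [← norm_mul]; exact norm_sub_le _ _
    _ ≤ ‖y θ‖ + r * (‖y θ‖ + ‖z‖ * S.k ^ 2 * ‖y θ‖) := by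
        gcongr
        rw [Complex.norm_real]; exact hr θ
    _ = _ := by ring

/-- For a compactly supported forcing the solution that vanishes on the left becomes a compactly
supported solution after taking Floquet differences. -/
lemma exists_compact_solution (z : ℂ) {μ : Fin 3 → ℂ}
    (hμ : ∀ y, S.IsSolution z 0 y → floquetDiff₃ μ y = 0) {g : ℝ → ℂ} (hg : ContDiff ℝ ∞ g)
    (hgs : HasCompactSupport g) : ∃ ψ : ℝ → ℂ, ContDiff ℝ ∞ ψ ∧ HasCompactSupport ψ ∧
      S.adjointOp z ψ = floquetDiff₃ μ g := by
  obtain ⟨β, hβ0, hβ⟩ := exists_energy_estimate S z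
  obtain ⟨η, hη⟩ := hgs.exists_bound_of_continuous hg.continuous
  obtain ⟨N, hN⟩ := hgs.isCompact.isBounded.exists_norm_le
  have hgz : ∀ t, N < |t| → g t = 0 := by
    intro t ht
    by_contra hne
    exact absurd (hN t (subset_tsupport g hne)) (by simpa using ht)
  obtain ⟨y, hy, hyN⟩ := S.exists_isSolution z hg.continuous hη (-(|N| + 1)) 0
  have hNN := le_abs_self N
  have hNN0 := abs_nonneg N
  have hvan : ∀ a b, a ≤ b → (∀ s ∈ Icc a b, g s = 0) → ∫ s in a..b, ‖g s‖ ^ 2 = 0 := by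
    intro a b hab h
    rw [intervalIntegral.integral_congr (g := fun _ => (0 : ℝ))]
    · simp
    · intro s hs
      rw [uIcc_of_le hab] at hs
      simp [h s hs]
  have hleft : ∀ t, t ≤ -(|N| + 1) → y t = 0 := by
    intro t ht
    obtain ⟨w, hw, hwt⟩ := S.exists_homogeneous z t (y t)
    have hD := hy.sub hw
    rw [sub_zero] at hD
    have h1 := hβ g _ hg.continuous hD t _ ht (by simp [hwt])
    rw [hvan _ _ ht, mul_zero] at h1
    · have h2 : w (-(|N| + 1)) = 0 := by
        have h3 : ‖(y - w) (-(|N| + 1))‖ = 0 := by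
          have := norm_nonneg ((y - w) (-(|N| + 1)))
          nlinarith
        have h4 := norm_eq_zero.1 h3
        rw [Pi.sub_apply, hyN] at h4
        simpa using h4
      have h5 := hw.unique (isSolution_zero z) (t₀ := -(|N| + 1)) (by simpa using h2)
      rw [← hwt, h5]; rfl
    · intro s hs
      apply hgz
      rw [abs_of_nonpos (by linarith [hs.2])]
      linarith [hs.2]
  obtain ⟨w, hw, hwN⟩ := S.exists_homogeneous z (|N| + 1) (y (|N| + 1))
  have hright : ∀ t, |N| + 1 ≤ t → y t = w t := by
    intro t ht
    have hD := hy.sub hw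
    rw [sub_zero] at hD
    have h1 := hβ g _ hg.continuous hD _ t ht (by simp [hwN])
    rw [hvan _ _ ht, mul_zero] at h1
    · have h3 : ‖(y - w) t‖ = 0 := by
        have := norm_nonneg ((y - w) t)
        nlinarith
      exact sub_eq_zero.1 (norm_eq_zero.1 h3)
    · intro s hs
      apply hgz
      rw [abs_of_nonneg (by linarith [hs.1])]
      linarith [hs.1]
  have hZ := hy.floquetDiff₃ μ
  have hgd : ContDiff ℝ ∞ (floquetDiff₃ μ g) := by
    have e : floquetDiff₃ μ g = fun θ => g (θ + 3) - (μ 0 + μ 1 + μ 2) • g (θ + 2)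
        + (μ 0 * μ 1 + μ 0 * μ 2 + μ 1 * μ 2) • g (θ + 1) - (μ 0 * μ 1 * μ 2) • g θ :=
      funext fun θ => floquetDiff₃_apply μ g θ
    rw [e]
    fun_prop
  refine ⟨fun θ => floquetDiff₃ μ y θ 0, contDiff_pi.1 (hZ.contDiff hgd) 0, ?_, hZ.adjointOp_eq hgd⟩
  refine HasCompactSupport.intro (isCompact_Icc (a := -(|N| + 1) - 3) (b := |N| + 1)) fun t ht => ?_
  have h0 : floquetDiff₃ μ y t = 0 := by
    rcases lt_or_ge t (-(|N| + 1) - 3) with h | h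
    · rw [floquetDiff₃_apply, hleft _ (by linarith), hleft _ (by linarith), hleft _ (by linarith),
        hleft _ (by linarith)]
      simp
    · have h' : |N| + 1 < t := by
        by_contra hcon
        exact ht ⟨h, not_lt.1 hcon⟩
      have := congrFun (hμ w hw) t
      rw [floquetDiff₃_apply] at this ⊢
      rw [hright _ (by linarith), hright _ (by linarith), hright _ (by linarith),
        hright _ (by linarith), this]
      rfl
  simp [h0]

end AdjointSystem

/-! ### Test functions and translations in `L²(ℝ)` -/

open scoped InnerProductSpace

/-- Smooth compactly supported complex functions on the line. -/
def testFunctions : Submodule ℂ (ℝ → ℂ) where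
  carrier := {ψ | ContDiff ℝ ∞ ψ ∧ HasCompactSupport ψ}
  add_mem' h h' := ⟨h.1.add h'.1, h.2.add h'.2⟩
  zero_mem' := ⟨contDiff_const, HasCompactSupport.zero⟩
  smul_mem' a _ h := ⟨contDiff_const.smul h.1, h.2.smul_left (f := fun _ => a)⟩

lemma memLp_of_mem_testFunctions {ψ : ℝ → ℂ} (h : ψ ∈ testFunctions) :
    MemLp ψ 2 (volume : Measure ℝ) :=
  h.1.continuous.memLp_of_hasCompactSupport h.2

/-- The class in `L²(ℝ)` of a test function. -/
def testToL2 : testFunctions →ₗ[ℂ] L2 where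
  toFun ψ := (memLp_of_mem_testFunctions ψ.2).toLp
  map_add' ψ χ := MemLp.toLp_add (memLp_of_mem_testFunctions ψ.2) (memLp_of_mem_testFunctions χ.2)
  map_smul' a ψ := MemLp.toLp_const_smul a (memLp_of_mem_testFunctions ψ.2)

lemma coeFn_testToL2 (ψ : testFunctions) : testToL2 ψ =ᵐ[volume] (ψ : ℝ → ℂ) :=
  MemLp.coeFn_toLp (memLp_of_mem_testFunctions ψ.2)

/-- The bilinear pairing `∫ u v` is the inner product with the conjugate. -/
lemma inner_star_eq_integral (u v : L2) : ⟪star v, u⟫_ℂ = ∫ θ, u θ * v θ := by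
  rw [L2.inner_def]
  apply integral_congr_ae
  filter_upwards [Lp.coeFn_star v] with θ h
  rw [h]
  simp [RCLike.inner_apply]

lemma inner_star_testToL2 (ψ : testFunctions) (v : L2) :
    ⟪star v, testToL2 ψ⟫_ℂ = ∫ θ, (ψ : ℝ → ℂ) θ * v θ := by
  rw [inner_star_eq_integral]
  apply integral_congr_ae
  filter_upwards [coeFn_testToL2 ψ] with θ h
  rw [h]

lemma norm_star_L2 (v : L2) : ‖star v‖ = ‖v‖ := by
  have h : ‖star v‖ = ‖v‖ := by
    rw [Lp.norm_def, Lp.norm_def]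
    congr 1
    apply eLpNorm_congr_norm_ae
    filter_upwards [Lp.coeFn_star v] with θ h
    rw [h]
    simp
  exact h

lemma norm_testToL2_sq (ψ : testFunctions) :
    ‖testToL2 ψ‖ ^ 2 = ∫ θ, ‖(ψ : ℝ → ℂ) θ‖ ^ 2 := by
  have h : (⟪testToL2 ψ, testToL2 ψ⟫_ℂ).re = ∫ θ, ‖(ψ : ℝ → ℂ) θ‖ ^ 2 := by
    have h1 : ⟪testToL2 ψ, testToL2 ψ⟫_ℂ = ((∫ θ, ‖(ψ : ℝ → ℂ) θ‖ ^ 2 : ℝ) : ℂ) := by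
      rw [L2.inner_def, ← integral_complex_ofReal]
      apply integral_congr_ae
      filter_upwards [coeFn_testToL2 ψ] with θ h
      rw [h, inner_self_eq_norm_sq_to_K]
      simp
    rw [h1, Complex.ofReal_re]
  rw [← h, ← inner_self_eq_norm_sq (𝕜 := ℂ)]
  rfl

/-- Translation `u ↦ u(· + s)` on `L²(ℝ)`. -/
def translate (s : ℝ) : L2 →ₗᵢ[ℂ] L2 :=
  Lp.compMeasurePreservingₗᵢ ℂ (fun θ : ℝ => θ + s) (measurePreserving_add_right volume s)

lemma coeFn_translate (s : ℝ) (u : L2) : translate s u =ᵐ[volume] fun θ => u (θ + s) :=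
  Lp.coeFn_compMeasurePreserving u (measurePreserving_add_right volume s)

lemma inner_star_translate (s : ℝ) (u v : L2) :
    ⟪star v, translate s u⟫_ℂ = ⟪star (translate (-s) v), u⟫_ℂ := by
  rw [inner_star_eq_integral, inner_star_eq_integral]
  have h1 : ∫ θ, translate s u θ * v θ = ∫ θ, u (θ + s) * v (θ + s + -s) := by
    apply integral_congr_ae
    filter_upwards [coeFn_translate s u] with θ h
    rw [h]; simp
  rw [h1, integral_add_right_eq_self (fun θ => u θ * v (θ + -s)) s]
  apply integral_congr_ae
  filter_upwards [coeFn_translate (-s) v] with θ h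
  rw [h]

/-- The operator `u ↦ u(· + s) - μ u` on `L²(ℝ)`. -/
def translateDiff (s : ℝ) (μ : ℂ) : L2 →ₗ[ℂ] L2 :=
  (translate s).toLinearMap - μ • LinearMap.id

lemma translateDiff_apply (s : ℝ) (μ : ℂ) (u : L2) :
    translateDiff s μ u = translate s u - μ • u := rfl

lemma norm_translateDiff_ge (s : ℝ) (μ : ℂ) (u : L2) :
    |1 - ‖μ‖| * ‖u‖ ≤ ‖translateDiff s μ u‖ := by
  have h := abs_norm_sub_norm_le (translate s u) (μ • u)
  rw [(translate s).norm_map, norm_smul] at h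
  rw [translateDiff_apply]
  refine le_trans (le_of_eq ?_) h
  rw [← abs_of_nonneg (norm_nonneg u), ← abs_mul, abs_of_nonneg (norm_nonneg u)]
  congr 1
  ring

lemma inner_star_translateDiff (s : ℝ) (μ : ℂ) (u v : L2) :
    ⟪star v, translateDiff s μ u⟫_ℂ = ⟪star (translateDiff (-s) μ v), u⟫_ℂ := by
  have hs : star (translate (-s) v - μ • v) = star (translate (-s) v) - (starRingEnd ℂ μ) • star v := by
    apply Lp.ext
    filter_upwards [Lp.coeFn_star (translate (-s) v - μ • v), Lp.coeFn_star (translate (-s) v),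
      Lp.coeFn_star v, Lp.coeFn_sub (translate (-s) v) (μ • v), Lp.coeFn_smul μ v,
      Lp.coeFn_sub (star (translate (-s) v)) ((starRingEnd ℂ μ) • star v),
      Lp.coeFn_smul (starRingEnd ℂ μ) (star v)] with θ h1 h2 h3 h4 h5 h6 h7
    rw [h1, h6, Pi.sub_apply, h2, h7, Pi.smul_apply, h3, Pi.star_apply, h4, Pi.sub_apply, h5]
    simp
  rw [translateDiff_apply, translateDiff_apply, inner_sub_right, inner_smul_right, hs, inner_sub_left,
    inner_smul_left, inner_star_translate, Complex.conj_conj]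

lemma floquetDiff_mem_testFunctions (μ : ℂ) {ψ : ℝ → ℂ} (h : ψ ∈ testFunctions) :
    AdjointSystem.floquetDiff μ ψ ∈ testFunctions := by
  have h1 : (fun θ => ψ (θ + 1)) ∈ testFunctions :=
    ⟨h.1.comp (contDiff_id.add contDiff_const), h.2.comp_homeomorph (Homeomorph.addRight (1 : ℝ))⟩
  exact sub_mem h1 (testFunctions.smul_mem μ h)

lemma testToL2_floquetDiff (μ : ℂ) (ψ : testFunctions) :
    testToL2 ⟨_, floquetDiff_mem_testFunctions μ ψ.2⟩ = translateDiff 1 μ (testToL2 ψ) := by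
  apply Lp.ext
  have hq : ∀ᵐ θ ∂volume, testToL2 ψ (θ + 1) = (ψ : ℝ → ℂ) (θ + 1) :=
    (measurePreserving_add_right volume (1 : ℝ)).quasiMeasurePreserving.ae (coeFn_testToL2 ψ)
  filter_upwards [coeFn_testToL2 ⟨_, floquetDiff_mem_testFunctions μ ψ.2⟩, coeFn_testToL2 ψ, hq,
    coeFn_translate 1 (testToL2 ψ), Lp.coeFn_sub (translate 1 (testToL2 ψ)) (μ • testToL2 ψ),
    Lp.coeFn_smul μ (testToL2 ψ)] with θ h1 h2 h3 h4 h5 h6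
  rw [h1, translateDiff_apply, h5, Pi.sub_apply, h4, h3, h6, Pi.smul_apply, h2]
  rfl

/-- A pointwise bound by the mean of `‖g‖²` over an interval of length three gives an `L²` bound. -/
lemma norm_testToL2_le_of_local {u g : testFunctions} {C : ℝ} (hC : 0 ≤ C)
    (h : ∀ θ, ‖(u : ℝ → ℂ) θ‖ ^ 2 ≤ C * ∫ s in θ..(θ + 3), ‖(g : ℝ → ℂ) s‖ ^ 2) :
    ‖testToL2 u‖ ≤ √(3 * C) * ‖testToL2 g‖ := by
  set f : ℝ → ℝ := fun s => ‖(g : ℝ → ℂ) s‖ ^ 2 with hf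
  have hgc := g.2.1.continuous
  have hfc : Continuous f := by fun_prop
  have hfi : Integrable f := by
    refine hfc.integrable_of_hasCompactSupport ?_
    exact g.2.2.comp_left (g := fun x : ℂ => ‖x‖ ^ 2) (by simp)
  have hI : ∀ θ, ∫ s in θ..(θ + 3), f s = ∫ s in Ioc (0 : ℝ) 3, f (θ + s) := by
    intro θ
    rw [← intervalIntegral.integral_of_le (by norm_num),
      intervalIntegral.integral_comp_add_left f θ, add_zero]
  have hprod : Integrable (Function.uncurry fun θ s => f (θ + s))
      ((volume : Measure ℝ).prod (volume.restrict (Ioc (0 : ℝ) 3))) := by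
    rw [integrable_prod_iff']
    · refine ⟨Filter.Eventually.of_forall fun s => hfi.comp_add_right s, ?_⟩
      have : (fun s : ℝ => ∫ θ, ‖Function.uncurry (fun θ s => f (θ + s)) (θ, s)‖)
          = fun _ => ∫ θ, ‖f θ‖ := by
        funext s
        exact integral_add_right_eq_self (fun θ => ‖f θ‖) s
      rw [this]
      exact integrable_const _
    · have hc : Continuous (Function.uncurry fun θ s : ℝ => f (θ + s)) :=
        hfc.comp (continuous_fst.add continuous_snd)
      exact hc.aestronglyMeasurable
  have hswap : ∫ θ, ∫ s in Ioc (0 : ℝ) 3, f (θ + s) = 3 * ∫ θ, f θ := by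
    rw [integral_integral_swap hprod]
    simp_rw [integral_add_right_eq_self f]
    simp
  have hle : ∫ θ, ‖(u : ℝ → ℂ) θ‖ ^ 2 ≤ ∫ θ, C * ∫ s in Ioc (0 : ℝ) 3, f (θ + s) := by
    refine integral_mono_of_nonneg (Filter.Eventually.of_forall fun θ => by positivity)
      (hprod.integral_prod_left.const_mul C) (Filter.Eventually.of_forall fun θ => ?_)
    change _ ≤ C * _
    rw [← hI]
    exact h θ
  rw [integral_const_mul, hswap, ← norm_testToL2_sq, hf, ← norm_testToL2_sq] at hle
  rw [← Real.sqrt_sq (norm_nonneg (testToL2 g)), ← Real.sqrt_mul (by positivity)]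
  apply Real.le_sqrt_of_sq_le
  linarith

/-- If `‖b x‖ ≤ C ‖a x‖` then every functional `⟪f, b ·⟫` factors through `a`: the functional is
bounded on the range of `a`, and the Hahn-Banach and Riesz theorems apply. -/
lemma exists_inner_eq_inner {V H : Type*} [AddCommGroup V] [Module ℂ V] [NormedAddCommGroup H]
    [InnerProductSpace ℂ H] [CompleteSpace H] (a b : V →ₗ[ℂ] H) {C : ℝ} (hC : 0 ≤ C)
    (h : ∀ x, ‖b x‖ ≤ C * ‖a x‖) (f : H) :
    ∃ v, ‖v‖ ≤ C * ‖f‖ ∧ ∀ x, ⟪v, a x⟫_ℂ = ⟪f, b x⟫_ℂ := by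
  obtain ⟨s, hs⟩ := a.rangeRestrict.exists_rightInverse_of_surjective a.range_rangeRestrict
  have hs' : ∀ y : LinearMap.range a, a (s y) = y := fun y => by
    have := congrArg (fun T => (T y : LinearMap.range a)) hs
    simpa using congrArg Subtype.val this
  let ℓ : StrongDual ℂ (LinearMap.range a) :=
    LinearMap.mkContinuous ((innerₛₗ ℂ f).comp (b.comp s)) (C * ‖f‖) (by
      intro y
      calc ‖⟪f, b (s y)⟫_ℂ‖ ≤ ‖f‖ * ‖b (s y)‖ := norm_inner_le_norm _ _
        _ ≤ ‖f‖ * (C * ‖a (s y)‖) := by gcongr; exact h _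
        _ = C * ‖f‖ * ‖y‖ := by rw [hs']; simp; ring)
  have hℓ : ‖ℓ‖ ≤ C * ‖f‖ := LinearMap.mkContinuous_norm_le _ (by positivity) _
  obtain ⟨g, hg, hgn⟩ := exists_extension_norm_eq (LinearMap.range a) ℓ
  refine ⟨(InnerProductSpace.toDual ℂ H).symm g, ?_, fun x => ?_⟩
  · rw [LinearIsometryEquiv.norm_map, hgn]; exact hℓ
  · rw [InnerProductSpace.toDual_symm_apply]
    have h1 := hg ⟨a x, LinearMap.mem_range_self a x⟩
    rw [h1]
    change ⟪f, b (s ⟨a x, _⟩)⟫_ℂ = _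
    have h2 : b (s ⟨a x, LinearMap.mem_range_self a x⟩ - x) = 0 := by
      have := h (s ⟨a x, LinearMap.mem_range_self a x⟩ - x)
      rw [map_sub a, hs', sub_self, norm_zero, mul_zero] at this
      exact norm_le_zero_iff.1 this
    rw [map_sub, sub_eq_zero] at h2
    rw [h2]

/-! ### The resolvent set in terms of Floquet multipliers -/

namespace AdjointSystem

variable (S : AdjointSystem)

lemma helmholtz_mem {ψ : ℝ → ℂ} (h : ψ ∈ testFunctions) : S.helmholtz ψ ∈ testFunctions := by
  refine ⟨contDiff_helmholtz h.1, ?_⟩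
  exact h.2.sub (h.2.deriv.deriv.mul_left (f := fun _ => (S.k : ℂ) ^ 2))

lemma adjointOp_mem (z : ℂ) {ψ : ℝ → ℂ} (h : ψ ∈ testFunctions) :
    S.adjointOp z ψ ∈ testFunctions := by
  refine ⟨contDiff_adjointOp z h.1, ?_⟩
  refine HasCompactSupport.sub (HasCompactSupport.add ?_ ?_) ?_
  · exact (S.helmholtz_mem h).2.mul_left (f := fun _ => z)
  · exact h.2.deriv.mul_left
  · exact (h.2.deriv.deriv.mul_left).deriv

/-- `1 - k² ∂²` on test functions. -/
def helmholtzTest : testFunctions →ₗ[ℂ] testFunctions where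
  toFun ψ := ⟨S.helmholtz ψ, S.helmholtz_mem ψ.2⟩
  map_add' ψ χ := by
    ext θ
    have d : deriv ((ψ : ℝ → ℂ) + (χ : ℝ → ℂ)) = deriv (ψ : ℝ → ℂ) + deriv (χ : ℝ → ℂ) :=
      funext fun t => ((hasDerivAt_of_contDiff ψ.2.1 t).add (hasDerivAt_of_contDiff χ.2.1 t)).deriv
    have d2 : deriv (deriv (ψ : ℝ → ℂ) + deriv (χ : ℝ → ℂ)) θ = _ :=
      ((hasDerivAt_of_contDiff (contDiff_deriv ψ.2.1) θ).add
        (hasDerivAt_of_contDiff (contDiff_deriv χ.2.1) θ)).deriv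
    simp only [helmholtz, Submodule.coe_add, Pi.add_apply, d, d2]
    ring
  map_smul' a ψ := by
    ext θ
    have d : deriv (a • (ψ : ℝ → ℂ)) = a • deriv (ψ : ℝ → ℂ) :=
      funext fun t => ((hasDerivAt_of_contDiff ψ.2.1 t).const_smul a).deriv
    have d2 : deriv (a • deriv (ψ : ℝ → ℂ)) θ = _ :=
      ((hasDerivAt_of_contDiff (contDiff_deriv ψ.2.1) θ).const_smul a).deriv
    simp only [helmholtz, Submodule.coe_smul, Pi.smul_apply, d, d2, smul_eq_mul, RingHom.id_apply]
    ring

/-- The adjoint operator on test functions. -/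
def adjointTest (z : ℂ) : testFunctions →ₗ[ℂ] testFunctions where
  toFun ψ := ⟨S.adjointOp z ψ, S.adjointOp_mem z ψ.2⟩
  map_add' ψ χ := by
    have h := (S.isSolution_state z ψ.2.1).add (S.isSolution_state z χ.2.1)
    have := h.adjointOp_eq ((contDiff_adjointOp z ψ.2.1).add (contDiff_adjointOp z χ.2.1))
    exact Subtype.ext this
  map_smul' a ψ := by
    have h := (S.isSolution_state z ψ.2.1).const_smul a
    have := h.adjointOp_eq (contDiff_const.smul (contDiff_adjointOp z ψ.2.1))
    exact Subtype.ext this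

/-- `(z - 𝓐) v = f` in the sense of distributions, after multiplication by `1 - k² ∂²`. -/
def IsWeakSolution (z : ℂ) (v f : L2) : Prop :=
  ∀ ψ ∈ testFunctions, ∫ θ, S.adjointOp z ψ θ * v θ = ∫ θ, S.helmholtz ψ θ * f θ

variable {S}

lemma isWeakSolution_iff_inner {z : ℂ} {v f : L2} : S.IsWeakSolution z v f ↔
    ∀ ψ : testFunctions, ⟪star v, testToL2 (S.adjointTest z ψ)⟫_ℂ =
      ⟪star f, testToL2 (S.helmholtzTest ψ)⟫_ℂ := by
  simp only [inner_star_testToL2, IsWeakSolution, Subtype.forall]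
  rfl

lemma star_add_L2 (u v : L2) : star (u + v) = star u + star v := by
  apply Lp.ext
  filter_upwards [Lp.coeFn_star (u + v), Lp.coeFn_star u, Lp.coeFn_star v, Lp.coeFn_add u v,
    Lp.coeFn_add (star u) (star v)] with θ h1 h2 h3 h4 h5
  rw [h1, h5, Pi.add_apply, h2, h3, Pi.star_apply, h4]
  simp

lemma star_smul_L2 (a : ℂ) (u : L2) : star (a • u) = (starRingEnd ℂ a) • star u := by
  apply Lp.ext
  filter_upwards [Lp.coeFn_star (a • u), Lp.coeFn_star u, Lp.coeFn_smul a u,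
    Lp.coeFn_smul (starRingEnd ℂ a) (star u)] with θ h1 h2 h3 h4
  rw [h1, h4, Pi.smul_apply, h2, Pi.star_apply, h3]
  simp

lemma IsWeakSolution.add {z : ℂ} {v f v' f' : L2} (h : S.IsWeakSolution z v f)
    (h' : S.IsWeakSolution z v' f') : S.IsWeakSolution z (v + v') (f + f') := by
  rw [isWeakSolution_iff_inner] at *
  intro ψ
  rw [star_add_L2, star_add_L2, inner_add_left, inner_add_left, h, h']

lemma IsWeakSolution.const_smul {z : ℂ} {v f : L2} (h : S.IsWeakSolution z v f) (a : ℂ) :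
    S.IsWeakSolution z (a • v) (a • f) := by
  rw [isWeakSolution_iff_inner] at *
  intro ψ
  rw [star_smul_L2, star_smul_L2, inner_smul_left, inner_smul_left, h]

variable (S) in
/-- The three Floquet multipliers at `z` as a triple annihilating the homogeneous solutions. -/
lemma exists_multipliers₃ (z : ℂ) : ∃ μ : Fin 3 → ℂ, (∀ i, (S.monodromy z).HasEigenvalue (μ i)) ∧
    ∀ y, S.IsSolution z 0 y → floquetDiff₃ μ y = 0 :=
  S.exists_multipliers z

lemma helmholtz_floquetDiff₃ (z : ℂ) (μ : Fin 3 → ℂ) {ψ : ℝ → ℂ} (hψ : ContDiff ℝ ∞ ψ) :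
    S.helmholtz (fun θ => floquetDiff₃ μ (S.state z ψ) θ 0) = floquetDiff₃ μ (S.helmholtz ψ) := by
  have h := S.isSolution_state z hψ
  have h3 := h.floquetDiff₃ μ
  have e : S.helmholtz ψ = fun θ => S.state z ψ θ 0 -
      S.ρ θ * (S.state z ψ θ 2 - z * S.k ^ 2 * S.state z ψ θ 1) := funext fun θ => h.helmholtz_eq θ
  funext θ
  have p3 : S.ρ (θ + 3) = S.ρ θ := by simpa using S.ρ_periodic.nat_mul 3 θ
  have p2 : S.ρ (θ + 2) = S.ρ θ := by simpa using S.ρ_periodic.nat_mul 2 θ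
  rw [h3.helmholtz_eq, floquetDiff₃_apply, floquetDiff₃_apply, e]
  simp only [Pi.sub_apply, Pi.add_apply, Pi.smul_apply, smul_eq_mul, p3, p2, S.ρ_periodic θ]
  ring

/-- A priori estimate for the adjoint operator when no multiplier lies on the unit circle. -/
lemma exists_apriori_estimate {z : ℂ} (hz : ∀ μ, ‖μ‖ = 1 → ¬ (S.monodromy z).HasEigenvalue μ) :
    ∃ C : ℝ, 0 ≤ C ∧ ∀ ψ : testFunctions,
      ‖testToL2 (S.helmholtzTest ψ)‖ ≤ C * ‖testToL2 (S.adjointTest z ψ)‖ := by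
  obtain ⟨μ, hev, hμ⟩ := S.exists_multipliers₃ z
  have hpos : ∀ i, 0 < |1 - ‖μ i‖| := fun i => by
    rw [abs_pos, sub_ne_zero]
    exact fun h => hz _ h.symm (hev i)
  obtain ⟨C₁, hC₁, h₁⟩ := exists_local_estimate z hμ
  obtain ⟨C₂, hC₂, h₂⟩ := S.exists_norm_helmholtz_le z
  set d := |1 - ‖μ 0‖| * |1 - ‖μ 1‖| * |1 - ‖μ 2‖| with hd
  have hd0 : 0 < d := mul_pos (mul_pos (hpos 0) (hpos 1)) (hpos 2)
  refine ⟨√(3 * (C₂ ^ 2 * C₁)) / d, by positivity, fun ψ => ?_⟩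
  set u := S.helmholtzTest ψ
  set g := S.adjointTest z ψ
  let u₁ : testFunctions := ⟨_, floquetDiff_mem_testFunctions (μ 2) u.2⟩
  let u₂ : testFunctions := ⟨_, floquetDiff_mem_testFunctions (μ 1) u₁.2⟩
  let u₃ : testFunctions := ⟨_, floquetDiff_mem_testFunctions (μ 0) u₂.2⟩
  have e₁ : testToL2 u₁ = translateDiff 1 (μ 2) (testToL2 u) := testToL2_floquetDiff _ _
  have e₂ : testToL2 u₂ = translateDiff 1 (μ 1) (testToL2 u₁) := testToL2_floquetDiff _ _
  have e₃ : testToL2 u₃ = translateDiff 1 (μ 0) (testToL2 u₂) := testToL2_floquetDiff _ _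
  have l₁ := norm_translateDiff_ge 1 (μ 2) (testToL2 u)
  have l₂ := norm_translateDiff_ge 1 (μ 1) (testToL2 u₁)
  have l₃ := norm_translateDiff_ge 1 (μ 0) (testToL2 u₂)
  rw [← e₁] at l₁
  rw [← e₂] at l₂
  rw [← e₃] at l₃
  have hlow : d * ‖testToL2 u‖ ≤ ‖testToL2 u₃‖ := by
    calc d * ‖testToL2 u‖ = |1 - ‖μ 0‖| * (|1 - ‖μ 1‖| * (|1 - ‖μ 2‖| * ‖testToL2 u‖)) := by
          rw [hd]; ring
      _ ≤ |1 - ‖μ 0‖| * (|1 - ‖μ 1‖| * ‖testToL2 u₁‖) := by gcongr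
      _ ≤ |1 - ‖μ 0‖| * ‖testToL2 u₂‖ := by gcongr
      _ ≤ _ := l₃
  have hup : ‖testToL2 u₃‖ ≤ √(3 * (C₂ ^ 2 * C₁)) * ‖testToL2 g‖ := by
    apply norm_testToL2_le_of_local (by positivity)
    intro θ
    have hs := S.isSolution_state z ψ.2.1
    have a1 := h₁ _ _ (contDiff_adjointOp z ψ.2.1).continuous hs θ
    have a2 := h₂ _ _ (hs.floquetDiff₃ μ) θ
    rw [helmholtz_floquetDiff₃ z μ ψ.2.1] at a2
    change ‖floquetDiff₃ μ (S.helmholtz ψ) θ‖ ^ 2 ≤ _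
    calc _ ≤ (C₂ * ‖floquetDiff₃ μ (S.state z ψ) θ‖) ^ 2 := by gcongr
      _ = C₂ ^ 2 * ‖floquetDiff₃ μ (S.state z ψ) θ‖ ^ 2 := by ring
      _ ≤ C₂ ^ 2 * (C₁ * ∫ s in θ..(θ + 3), ‖S.adjointOp z ψ s‖ ^ 2) := by gcongr
      _ = _ := by rw [mul_assoc]; rfl
  rw [div_mul_eq_mul_div, le_div_iff₀ hd0]
  linarith

/-- The weak problem has at most one solution when no multiplier lies on the unit circle. -/
lemma IsWeakSolution.eq_zero {z : ℂ} (hz : ∀ μ, ‖μ‖ = 1 → ¬ (S.monodromy z).HasEigenvalue μ)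
    {v : L2} (h : S.IsWeakSolution z v 0) : v = 0 := by
  obtain ⟨μ, hev, hμ⟩ := S.exists_multipliers₃ z
  have hpos : ∀ i, 0 < |1 - ‖μ i‖| := fun i => by
    rw [abs_pos, sub_ne_zero]
    exact fun h => hz _ h.symm (hev i)
  have hinj : ∀ i (u : L2), translateDiff (-1) (μ i) u = 0 → u = 0 := by
    intro i u hu
    have := norm_translateDiff_ge (-1) (μ i) u
    rw [hu, norm_zero] at this
    exact norm_le_zero_iff.1 (nonpos_of_mul_nonpos_right this (hpos i))
  set w := translateDiff (-1) (μ 2) (translateDiff (-1) (μ 1) (translateDiff (-1) (μ 0) v)) with hw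
  suffices w = 0 from hinj 0 _ (hinj 1 _ (hinj 2 _ this))
  have key : ∀ g : testFunctions, ⟪star w, testToL2 g⟫_ℂ = 0 := by
    intro g
    obtain ⟨ψ, hψ, hψs, hψe⟩ := exists_compact_solution z hμ g.2.1 g.2.2
    have h1 := isWeakSolution_iff_inner.1 h ⟨ψ, hψ, hψs⟩
    have h0 : star (0 : L2) = 0 := by
      have := star_smul_L2 0 (0 : L2)
      simpa using this
    rw [h0, inner_zero_left] at h1
    let g₁ : testFunctions := ⟨_, floquetDiff_mem_testFunctions (μ 2) g.2⟩
    let g₂ : testFunctions := ⟨_, floquetDiff_mem_testFunctions (μ 1) g₁.2⟩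
    let g₃ : testFunctions := ⟨_, floquetDiff_mem_testFunctions (μ 0) g₂.2⟩
    have e₁ : testToL2 g₁ = translateDiff 1 (μ 2) (testToL2 g) := testToL2_floquetDiff _ _
    have e₂ : testToL2 g₂ = translateDiff 1 (μ 1) (testToL2 g₁) := testToL2_floquetDiff _ _
    have e₃ : testToL2 g₃ = translateDiff 1 (μ 0) (testToL2 g₂) := testToL2_floquetDiff _ _
    have hg₃ : S.adjointTest z ⟨ψ, hψ, hψs⟩ = g₃ := Subtype.ext hψe
    rw [hg₃, e₃, e₂, e₁, inner_star_translateDiff, inner_star_translateDiff,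
      inner_star_translateDiff] at h1
    exact h1
  have hloc : LocallyIntegrable (w : ℝ → ℂ) volume :=
    (Lp.memLp w).locallyIntegrable (by norm_num)
  have hae := ae_eq_zero_of_integral_contDiff_smul_eq_zero hloc (fun g hg hgs => by
    have h1 := key ⟨fun θ => (g θ : ℂ), contDiff_ofReal_comp hg,
      hgs.comp_left (g := fun x : ℝ => (x : ℂ)) (by simp)⟩
    rw [inner_star_testToL2] at h1
    simpa using h1)
  apply Lp.ext
  filter_upwards [hae, Lp.coeFn_zero ℂ 2 (volume : Measure ℝ)] with θ h1 h2
  rw [h1, h2]; rfl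

/-- If no Floquet multiplier at `z` lies on the unit circle, the weak problem defines a bounded
resolvent. -/
theorem exists_resolvent {z : ℂ} (hz : ∀ μ, ‖μ‖ = 1 → ¬ (S.monodromy z).HasEigenvalue μ) :
    ∃ R : L2 →L[ℂ] L2, ∀ v f, S.IsWeakSolution z v f ↔ v = R f := by
  obtain ⟨C, hC, hap⟩ := exists_apriori_estimate hz
  have hex : ∀ f : L2, ∃ v, ‖v‖ ≤ C * ‖f‖ ∧ S.IsWeakSolution z v f := by
    intro f
    obtain ⟨v, hv, hveq⟩ := exists_inner_eq_inner (testToL2.comp (S.adjointTest z))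
      (testToL2.comp S.helmholtzTest) hC hap (star f)
    refine ⟨star v, by rwa [norm_star_L2, ← norm_star_L2 f], isWeakSolution_iff_inner.2 fun ψ => ?_⟩
    rw [star_star]
    exact hveq ψ
  have huniq : ∀ v v' f, S.IsWeakSolution z v f → S.IsWeakSolution z v' f → v = v' := by
    intro v v' f h h'
    have h1 := h.add (h'.const_smul (-1))
    have h2 : f + (-1 : ℂ) • f = 0 := by simp
    rw [h2] at h1
    have := h1.eq_zero hz
    rwa [neg_one_smul, add_neg_eq_zero] at this
  choose r hrn hr using hex
  let L : L2 →ₗ[ℂ] L2 :=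
    { toFun := r
      map_add' := fun f g => huniq _ _ _ (hr _) ((hr f).add (hr g))
      map_smul' := fun a f => huniq _ _ _ (hr _) ((hr f).const_smul a) }
  refine ⟨L.mkContinuous C hrn, fun v f => ⟨fun h => huniq _ _ _ h (hr f), ?_⟩⟩
  rintro rfl
  exact hr f

end AdjointSystem

namespace AdjointSystem

variable {S : AdjointSystem}

/-! ### Floquet multipliers on the unit circle belong to spectrum -/

lemma IsSolution.shift_sub_nat {z : ℂ} {g : ℝ → ℂ} {y : ℝ → Fin 3 → ℂ} (hy : S.IsSolution z g y)
    (n : ℕ) : S.IsSolution z (fun θ => g (θ - n)) (fun θ => y (θ - n)) := by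
  intro θ
  have := (hy (θ - n)).comp_sub_const θ n
  have h1 : S.ρ (θ - n) = S.ρ θ := by simpa using S.ρ_periodic.sub_nat_mul_eq n
  have h2 : S.q (θ - n) = S.q θ := by simpa using S.q_periodic.sub_nat_mul_eq n
  rwa [h1, h2] at this

/-- A bounded Floquet solution is not annihilated by `1 - k² ∂²`: otherwise `Re (conj ψ · ψ')` would be
periodic and strictly increasing. -/
lemma helmholtz_ne_zero_of_floquet {z μ : ℂ} (hμ : ‖μ‖ = 1) {y : ℝ → Fin 3 → ℂ}
    (hy : S.IsSolution z 0 y) (hy0 : y 0 ≠ 0) (hF : ∀ θ, y (θ + 1) = μ • y θ) :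
    ∃ θ ∈ Icc (0 : ℝ) 1, S.helmholtz (fun θ => y θ 0) θ ≠ 0 := by
  by_contra! hcon
  have hk := S.k_pos
  have hkC : (S.k : ℂ) ≠ 0 := by exact_mod_cast hk.ne'
  have hc := isSolution_iff_components.1 hy
  have hd1 : ∀ θ ∈ Icc (0 : ℝ) 1, HasDerivAt (fun t => y t 1) (((1 / S.k ^ 2 : ℝ) : ℂ) * y θ 0) θ := by
    intro θ hθ
    refine (hc θ).2.1.congr_deriv ?_
    have h := hcon θ hθ
    rw [hy.helmholtz_eq] at h
    push_cast
    field_simp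
    linear_combination -h
  set h : ℝ → ℝ := fun θ => ⟪y θ 0, y θ 1⟫_ℝ with hh
  have hd : ∀ θ ∈ Icc (0 : ℝ) 1, HasDerivAt h (1 / S.k ^ 2 * ‖y θ 0‖ ^ 2 + ‖y θ 1‖ ^ 2) θ := by
    intro θ hθ
    refine ((hc θ).1.inner ℝ (hd1 θ hθ)).congr_deriv ?_
    rw [← Complex.real_smul, inner_smul_right, real_inner_self_eq_norm_sq, real_inner_self_eq_norm_sq]
  have h01 : h 0 = h 1 := by
    have e := hF 0
    rw [zero_add] at e
    simp only [hh, e, Pi.smul_apply, Complex.inner, smul_eq_mul, map_mul]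
    have e2 : (starRingEnd ℂ) μ * μ = 1 := by
      rw [mul_comm, Complex.mul_conj, Complex.normSq_eq_norm_sq, hμ]; simp
    congr 1
    linear_combination (-(y 0 1) * (starRingEnd ℂ) (y 0 0)) * e2
  obtain ⟨θ, hθ, hθ0⟩ := exists_hasDerivAt_eq_zero (f := h)
    (f' := fun θ => 1 / S.k ^ 2 * ‖y θ 0‖ ^ 2 + ‖y θ 1‖ ^ 2) zero_lt_one
    (fun θ hθ => (hd θ hθ).continuousAt.continuousWithinAt) h01
    (fun θ hθ => hd θ (Ioo_subset_Icc_self hθ))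
  have hθI := Ioo_subset_Icc_self hθ
  have p0 : 0 ≤ 1 / S.k ^ 2 * ‖y θ 0‖ ^ 2 := by positivity
  have p1 : 0 ≤ ‖y θ 1‖ ^ 2 := by positivity
  have z1 : y θ 1 = 0 := by
    have : ‖y θ 1‖ ^ 2 = 0 := by linarith
    simpa using this
  have z0 : y θ 0 = 0 := by
    have : 1 / S.k ^ 2 * ‖y θ 0‖ ^ 2 = 0 := by linarith
    have hne : (1 / S.k ^ 2 : ℝ) ≠ 0 := by positivity
    simpa [hk.ne'] using this
  have hρ : (S.ρ θ : ℂ) ≠ 0 := by exact_mod_cast (S.ρ_pos θ).ne'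
  have z2 : y θ 2 = 0 := by
    have := hcon θ hθI
    rw [hy.helmholtz_eq, z0, z1] at this
    simpa [hρ] using this
  have hzero := hy.unique (isSolution_zero z) (t₀ := θ) (by ext i; fin_cases i <;> simp [z0, z1, z2])
  exact hy0 (by rw [hzero]; rfl)

/-- A Floquet multiplier on the unit circle excludes a bounded resolvent: cutting off the Floquet
solution to `n` periods gives test functions whose images under the adjoint operator stay
bounded in `L²` while `(1 - k² ∂²)` of them grows. -/
theorem not_exists_resolvent {z μ : ℂ} (hμ : ‖μ‖ = 1) (h : (S.monodromy z).HasEigenvalue μ) :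
    ¬ ∃ R : L2 →L[ℂ] L2, ∀ v f, S.IsWeakSolution z v f ↔ v = R f := by
  rintro ⟨R, hR⟩
  obtain ⟨y, hy, hy0, hF⟩ := S.exists_floquet_solution h
  have hyc : ContDiff ℝ ∞ y := hy.contDiff contDiff_const
  set ψ : ℝ → ℂ := fun θ => y θ 0 with hψdef
  have hψ : ContDiff ℝ ∞ ψ := contDiff_pi.1 hyc 0
  have hFn : ∀ (n : ℕ) θ, μ ^ n * ψ (θ - n) = ψ θ := by
    intro n
    induction n with
    | zero => intro θ; simp
    | succ n ih =>
      intro θ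
      have e := congrFun (hF (θ - (n + 1 : ℕ))) 0
      rw [show θ - ((n + 1 : ℕ) : ℝ) + 1 = θ - n by push_cast; ring] at e
      rw [pow_succ, mul_assoc, ← ih θ]
      congr 1
      exact e.symm
  set χ : ℝ → ℂ := fun θ => (Real.smoothTransition θ : ℂ) * ψ θ with hχdef
  have hχ : ContDiff ℝ ∞ χ := (contDiff_ofReal_comp Real.smoothTransition.contDiff).mul hψ
  have hχ0 : ∀ θ, θ ≤ 0 → χ θ = 0 := fun θ hθ => by
    simp [hχdef, Real.smoothTransition.zero_of_nonpos hθ]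
  have hχ1 : ∀ θ, 1 ≤ θ → χ θ = ψ θ := fun θ hθ => by
    simp [hχdef, Real.smoothTransition.one_of_one_le hθ]
  -- Forcing of the left edge.
  set u := S.adjointOp z χ with hu
  have hloc : ∀ (f g : ℝ → ℂ) θ, f =ᶠ[nhds θ] g → S.adjointOp z f θ = S.adjointOp z g θ := by
    intro f g θ hfg
    have h1 := hfg.deriv
    have h2 := h1.deriv
    have h3 : (fun t => ((S.k ^ 2 / S.ρ t : ℝ) : ℂ) * deriv (deriv f) t) =ᶠ[nhds θ]
        fun t => ((S.k ^ 2 / S.ρ t : ℝ) : ℂ) * deriv (deriv g) t := by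
      filter_upwards [h2] with t ht
      rw [ht]
    simp only [adjointOp, helmholtz, hfg.eq_of_nhds, h1.eq_of_nhds, h2.eq_of_nhds, h3.deriv_eq]
  have hadjψ : S.adjointOp z ψ = 0 := hy.adjointOp_eq contDiff_const
  have hus : ∀ θ, θ ∉ Icc (0 : ℝ) 1 → u θ = 0 := by
    intro θ hθ
    rcases lt_or_ge θ 0 with h0 | h0
    · have : χ =ᶠ[nhds θ] (0 : ℝ → ℂ) := by
        filter_upwards [Iio_mem_nhds h0] with t ht using hχ0 t (le_of_lt ht)
      rw [hu, hloc _ _ _ this]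
      exact congrFun ((isSolution_zero (S := S) z).adjointOp_eq (g := 0) contDiff_const) θ
    · have h1 : 1 < θ := by
        by_contra hcon
        exact hθ ⟨h0, not_lt.1 hcon⟩
      have : χ =ᶠ[nhds θ] ψ := by
        filter_upwards [Ioi_mem_nhds h1] with t ht using hχ1 t (le_of_lt ht)
      rw [hu, hloc _ _ _ this, hadjψ]
      rfl
  have hut : u ∈ testFunctions :=
    ⟨contDiff_adjointOp z hχ, HasCompactSupport.intro isCompact_Icc hus⟩
  set uT : testFunctions := ⟨u, hut⟩ with huT
  -- The Floquet solution cut off to the interval `[0, n + 1]`.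
  set η : ℕ → ℝ → ℂ := fun n θ => χ θ - μ ^ n * χ (θ - n) with hη
  have hηt : ∀ n, η n ∈ testFunctions := by
    intro n
    refine ⟨hχ.sub (contDiff_const.mul (hχ.comp (contDiff_id.sub contDiff_const))),
      HasCompactSupport.intro (isCompact_Icc (a := (0 : ℝ)) (b := n + 1)) fun θ hθ => ?_⟩
    rcases lt_or_ge θ 0 with h0 | h0
    · have hn : (0 : ℝ) ≤ n := n.cast_nonneg
      simp only [hη]
      rw [hχ0 _ h0.le, hχ0 _ (by linarith)]
      simp
    · have h1 : (n : ℝ) + 1 < θ := by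
        by_contra hcon
        exact hθ ⟨h0, not_lt.1 hcon⟩
      have hn : (0 : ℝ) ≤ n := n.cast_nonneg
      simp only [hη]
      rw [hχ1 _ (by linarith), hχ1 _ (by linarith), hFn, sub_self]
  have hadjη : ∀ n, S.adjointOp z (η n) = fun θ => u θ - μ ^ n * u (θ - n) := by
    intro n
    have hs := S.isSolution_state z hχ
    have hs2 := hs.sub ((hs.shift_sub_nat n).const_smul (μ ^ n))
    refine hs2.adjointOp_eq ((contDiff_adjointOp z hχ).sub
      (contDiff_const.smul ((contDiff_adjointOp z hχ).comp (contDiff_id.sub contDiff_const))))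
  have hnorm : ∀ n, ‖testToL2 (S.adjointTest z ⟨η n, hηt n⟩)‖ ≤ 2 * ‖testToL2 uT‖ := by
    intro n
    have e : testToL2 (S.adjointTest z ⟨η n, hηt n⟩) =
        testToL2 uT - μ ^ n • translate (-n) (testToL2 uT) := by
      apply Lp.ext
      have hq : ∀ᵐ θ ∂volume, testToL2 uT (θ + -n) = u (θ + -n) :=
        (measurePreserving_add_right volume (-n : ℝ)).quasiMeasurePreserving.ae (coeFn_testToL2 uT)
      filter_upwards [coeFn_testToL2 (S.adjointTest z ⟨η n, hηt n⟩), coeFn_testToL2 uT, hq,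
        coeFn_translate (-n) (testToL2 uT),
        Lp.coeFn_sub (testToL2 uT) (μ ^ n • translate (-n) (testToL2 uT)),
        Lp.coeFn_smul (μ ^ n) (translate (-n) (testToL2 uT))] with θ h1 h2 h3 h4 h5 h6
      rw [h1, h5, Pi.sub_apply, h6, Pi.smul_apply, h4, h3, h2]
      exact congrFun (hadjη n) θ
    rw [e]
    refine (norm_sub_le _ _).trans ?_
    rw [norm_smul, norm_pow, hμ, one_pow, one_mul, LinearIsometry.norm_map, two_mul]
  set K := ‖R‖ * (2 * ‖testToL2 uT‖) with hK
  have hbound : ∀ n, ‖testToL2 (S.helmholtzTest ⟨η n, hηt n⟩)‖ ≤ K := by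
    intro n
    set G := testToL2 (S.helmholtzTest ⟨η n, hηt n⟩) with hG
    have hw := isWeakSolution_iff_inner.1 ((hR (R (star G)) (star G)).2 rfl) ⟨η n, hηt n⟩
    rw [star_star, ← hG, inner_self_eq_norm_sq_to_K] at hw
    have h1 : ‖G‖ ^ 2 ≤ ‖R‖ * ‖G‖ * (2 * ‖testToL2 uT‖) := by
      calc ‖G‖ ^ 2 = ‖((‖G‖ : ℂ)) ^ 2‖ := by simp
        _ = _ := congrArg norm hw.symm
        _ ≤ _ := norm_inner_le_norm _ _
        _ ≤ _ := by
          gcongr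
          · rw [norm_star_L2, ← norm_star_L2 G]; exact R.le_opNorm _
          · exact hnorm n
    rcases (norm_nonneg G).eq_or_lt with h0 | h0
    · rw [← h0]; positivity
    · have h2 : ‖G‖ * ‖G‖ ≤ K * ‖G‖ := by rw [hK]; linarith
      exact le_of_mul_le_mul_right h2 h0
  -- Lower bound.
  set P : ℝ → ℝ := fun θ => ‖S.helmholtz ψ θ‖ ^ 2 with hP
  have hmc : Continuous (S.helmholtz ψ) := (contDiff_helmholtz hψ).continuous
  have hPc : Continuous P := by fun_prop
  have hPp : Function.Periodic P 1 := by
    intro θ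
    have e : S.helmholtz ψ (θ + 1) = μ * S.helmholtz ψ θ := by
      rw [hy.helmholtz_eq, hy.helmholtz_eq, hF, S.ρ_periodic]
      simp only [Pi.smul_apply, smul_eq_mul]
      ring
    simp only [hP, e, norm_mul, hμ, one_mul]
  set I := ∫ θ in (0 : ℝ)..1, P θ with hI
  have hIpos : 0 < I := by
    obtain ⟨θ, hθ, hne⟩ := helmholtz_ne_zero_of_floquet hμ hy hy0 hF
    refine intervalIntegral.integral_pos zero_lt_one hPc.continuousOn
      (fun _ _ => by positivity) ⟨θ, hθ, ?_⟩
    have := norm_pos_iff.2 hne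
    positivity
  have hlow : ∀ n : ℕ, n * I ≤ ‖testToL2 (S.helmholtzTest ⟨η (n + 1), hηt (n + 1)⟩)‖ ^ 2 := by
    intro n
    have e : ∫ θ in (1 : ℝ)..(1 + n), P θ = n * I := by
      have h1 := hPp.intervalIntegral_add_zsmul_eq n 1
      have h2 := hPp.intervalIntegral_add_eq 0 1
      rw [zero_add] at h2
      rw [← h2] at h1
      simpa using h1 fun a b => hPc.intervalIntegrable a b
    rw [norm_testToL2_sq, ← e, intervalIntegral.integral_of_le (by simp),
      integral_Ioc_eq_integral_Ioo]
    set m := S.helmholtz (η (n + 1)) with hm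
    have hmt : m ∈ testFunctions := S.helmholtz_mem (hηt (n + 1))
    have hmi : Integrable (fun θ => ‖m θ‖ ^ 2) := by
      have hc := hmt.1.continuous
      exact Continuous.integrable_of_hasCompactSupport (by fun_prop)
        (hmt.2.comp_left (g := fun x : ℂ => ‖x‖ ^ 2) (by simp))
    have hEq : ∫ θ in Ioo (1 : ℝ) (1 + n), P θ = ∫ θ in Ioo (1 : ℝ) (1 + n), ‖m θ‖ ^ 2 := by
      refine setIntegral_congr_fun measurableSet_Ioo fun θ hθ => ?_
      have hev : η (n + 1) =ᶠ[nhds θ] ψ := by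
        filter_upwards [isOpen_Ioo.mem_nhds hθ] with t ht
        simp only [hη]
        rw [hχ1 t ht.1.le, hχ0 _ (by push_cast; linarith [ht.2])]
        simp
      have h2 := hev.deriv.deriv
      simp only [hP, hm, helmholtz, hev.eq_of_nhds, h2.eq_of_nhds]
    rw [hEq]
    exact setIntegral_le_integral hmi (Filter.Eventually.of_forall fun _ => by positivity)
  obtain ⟨n, hn⟩ := exists_nat_gt (K ^ 2 / I)
  rw [div_lt_iff₀ hIpos] at hn
  have h1 := hlow n
  have h2 : ‖testToL2 (S.helmholtzTest ⟨η (n + 1), hηt (n + 1)⟩)‖ ^ 2 ≤ K ^ 2 := by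
    gcongr
    exact hbound (n + 1)
  linarith

end AdjointSystem

/-! ### The spectrum of the linearization -/

/-- The adjoint system of the linearization about a periodic profile `φ` below the speed `c`. -/
def waveSystem {k c : ℝ} {φ : ℝ → ℝ} (hk : 0 < k) (hφ : ContDiff ℝ ∞ φ)
    (hper : Function.Periodic φ 1) (hlt : ∀ θ, φ θ < c) : AdjointSystem where
  k := k
  ρ θ := 1 / (k * (c - φ θ))
  q θ := k * (c - 3 * φ θ + k ^ 2 * iteratedDeriv 2 φ θ)
  k_pos := hk
  ρ_pos θ := one_div_pos.2 (mul_pos hk (sub_pos.2 (hlt θ)))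
  ρ_smooth := contDiff_const.div (contDiff_const.mul (contDiff_const.sub hφ))
    fun θ => (mul_pos hk (sub_pos.2 (hlt θ))).ne'
  q_smooth := by
    have h2 : ContDiff ℝ ∞ (iteratedDeriv 2 φ) := by
      rw [iteratedDeriv_succ, iteratedDeriv_one]
      exact AdjointSystem.contDiff_deriv (AdjointSystem.contDiff_deriv hφ)
    fun_prop
  ρ_periodic θ := by simp only [hper θ]
  q_periodic θ := by
    have h2 : iteratedDeriv 2 φ (θ + 1) = iteratedDeriv 2 φ θ := by
      have := iteratedDeriv_comp_add_const 2 φ 1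
      rw [show (fun z => φ (z + 1)) = φ from funext hper] at this
      exact (congrFun this θ).symm
    simp only [hper θ, h2]

namespace AdjointSystem

section

variable {k c : ℝ} {φ : ℝ → ℝ} (hk : 0 < k) (hφ : ContDiff ℝ ∞ φ)
  (hper : Function.Periodic φ 1) (hlt : ∀ θ, φ θ < c)

lemma deriv_ofReal {f : ℝ → ℝ} (hf : ContDiff ℝ ∞ f) :
    deriv (fun θ => (f θ : ℂ)) = fun θ => ((deriv f θ : ℝ) : ℂ) :=
  funext fun θ => (hasDerivAt_of_contDiff hf θ).ofReal_comp.deriv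

lemma helmholtz_ofReal {ψ : ℝ → ℝ} (hψ : ContDiff ℝ ∞ ψ) (θ : ℝ) :
    (waveSystem hk hφ hper hlt).helmholtz (fun θ => (ψ θ : ℂ)) θ =
      ((ψ θ - k ^ 2 * iteratedDeriv 2 ψ θ : ℝ) : ℂ) := by
  rw [helmholtz, deriv_ofReal hψ, deriv_ofReal (contDiff_deriv hψ), iteratedDeriv_succ,
    iteratedDeriv_one]
  simp [waveSystem]

lemma adjointOp_ofReal (z : ℂ) {ψ : ℝ → ℝ} (hψ : ContDiff ℝ ∞ ψ) (θ : ℝ) :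
    (waveSystem hk hφ hper hlt).adjointOp z (fun θ => (ψ θ : ℂ)) θ =
      z * ((ψ θ - k ^ 2 * iteratedDeriv 2 ψ θ : ℝ) : ℂ)
        + ((k * hessian k c φ (deriv ψ) θ : ℝ) : ℂ) := by
  have h1 := contDiff_deriv hψ
  have h2 := contDiff_deriv h1
  have hf : ContDiff ℝ ∞ fun y => (c - φ y) * deriv (deriv ψ) y := (contDiff_const.sub hφ).mul h2
  rw [adjointOp, helmholtz_ofReal hk hφ hper hlt hψ, deriv_ofReal hψ, deriv_ofReal h1]
  have e : (fun t => (((waveSystem hk hφ hper hlt).k ^ 2 / (waveSystem hk hφ hper hlt).ρ t : ℝ) : ℂ)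
      * ((deriv (deriv ψ) t : ℝ) : ℂ)) =
      fun t => ((k ^ 3 * ((c - φ t) * deriv (deriv ψ) t) : ℝ) : ℂ) := by
    funext t
    rw [← Complex.ofReal_mul]
    congr 1
    have := (sub_pos.2 (hlt t)).ne'
    have := hk.ne'
    simp only [waveSystem]
    field_simp
  rw [e, ((hasDerivAt_of_contDiff hf θ).const_mul (k ^ 3)).ofReal_comp.deriv]
  simp only [waveSystem, hessian]
  push_cast
  ring

lemma ofReal_mem_testFunctions {ψ : ℝ → ℝ} (hψ : ContDiff ℝ ∞ ψ) (hs : HasCompactSupport ψ) :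
    (fun θ => (ψ θ : ℂ)) ∈ testFunctions :=
  ⟨contDiff_ofReal_comp hψ, hs.comp_left (g := fun x : ℝ => (x : ℂ)) (by simp)⟩

/-- The weak formulation with real test functions agrees with the one with complex test functions. -/
lemma exists_linearizationApplies_iff (z : ℂ) (v f : L2) :
    (∃ w, LinearizationApplies k c φ v w ∧ z • v - w = f) ↔
      (waveSystem hk hφ hper hlt).IsWeakSolution z v f := by
  set S := waveSystem hk hφ hper hlt with hS
  have hw : ∀ w, z • v - w = f ↔ w = z • v - f := fun w => by
    constructor <;> rintro rfl <;> abel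
  simp only [hw, exists_eq_right]
  have hpair : ∀ (h : testFunctions) (u : L2), Integrable fun θ => (h : ℝ → ℂ) θ * u θ := by
    intro h u
    exact MemLp.integrable_mul (p := 2) (q := 2) (memLp_of_mem_testFunctions h.2) (Lp.memLp u)
  -- Both conditions for one real test function.
  have hone : ∀ (ψ : ℝ → ℝ) (hψ : ContDiff ℝ ∞ ψ) (hs : HasCompactSupport ψ),
      (∫ θ, ((ψ θ - k ^ 2 * iteratedDeriv 2 ψ θ : ℝ) : ℂ) * (z • v - f : L2) θ
        = -∫ θ, ((k * hessian k c φ (deriv ψ) θ : ℝ) : ℂ) * v θ) ↔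
      ⟪star v, testToL2 (S.adjointTest z ⟨_, ofReal_mem_testFunctions hψ hs⟩)⟫_ℂ =
        ⟪star f, testToL2 (S.helmholtzTest ⟨_, ofReal_mem_testFunctions hψ hs⟩)⟫_ℂ := by
    intro ψ hψ hs
    set t : testFunctions := ⟨_, ofReal_mem_testFunctions hψ hs⟩ with ht
    set H := S.helmholtzTest t
    set A := S.adjointTest z t
    have hH : ∀ θ, ((ψ θ - k ^ 2 * iteratedDeriv 2 ψ θ : ℝ) : ℂ) = (H : ℝ → ℂ) θ :=
      fun θ => (helmholtz_ofReal hk hφ hper hlt hψ θ).symm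
    have hA : ∀ θ, ((k * hessian k c φ (deriv ψ) θ : ℝ) : ℂ) = (A : ℝ → ℂ) θ - z * (H : ℝ → ℂ) θ :=
      fun θ => by
        have := adjointOp_ofReal hk hφ hper hlt z hψ θ
        rw [hH] at this
        change S.adjointOp z _ θ = _ at this
        change _ = S.adjointOp z _ θ - _
        rw [this]; ring
    rw [inner_star_testToL2, inner_star_testToL2]
    simp only [hH, hA]
    have e1 : ∫ θ, (H : ℝ → ℂ) θ * (z • v - f : L2) θ =
        z * (∫ θ, (H : ℝ → ℂ) θ * v θ) - ∫ θ, (H : ℝ → ℂ) θ * f θ := by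
      rw [← integral_const_mul, ← integral_sub ((hpair H v).const_mul z) (hpair H f)]
      apply integral_congr_ae
      filter_upwards [Lp.coeFn_sub (z • v) f, Lp.coeFn_smul z v] with θ h1 h2
      rw [h1, Pi.sub_apply, h2, Pi.smul_apply, smul_eq_mul]
      ring
    have e2 : ∫ θ, ((A : ℝ → ℂ) θ - z * (H : ℝ → ℂ) θ) * v θ =
        (∫ θ, (A : ℝ → ℂ) θ * v θ) - z * ∫ θ, (H : ℝ → ℂ) θ * v θ := by
      rw [← integral_const_mul, ← integral_sub (hpair A v) ((hpair H v).const_mul z)]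
      congr 1
      funext θ
      ring
    rw [e1, e2]
    constructor <;> intro h <;> linear_combination h
  rw [isWeakSolution_iff_inner]
  constructor
  · intro h ψ
    -- Split the test function into real and imaginary parts.
    have hr : ContDiff ℝ ∞ fun θ => ((ψ : ℝ → ℂ) θ).re := Complex.reCLM.contDiff.comp ψ.2.1
    have hi : ContDiff ℝ ∞ fun θ => ((ψ : ℝ → ℂ) θ).im := Complex.imCLM.contDiff.comp ψ.2.1
    have hrs : HasCompactSupport fun θ => ((ψ : ℝ → ℂ) θ).re := ψ.2.2.comp_left (g := Complex.re) rfl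
    have his : HasCompactSupport fun θ => ((ψ : ℝ → ℂ) θ).im := ψ.2.2.comp_left (g := Complex.im) rfl
    have h1 := (hone _ hr hrs).1 (h _ hr hrs)
    have h2 := (hone _ hi his).1 (h _ hi his)
    have hsplit : ψ = (⟨_, ofReal_mem_testFunctions hr hrs⟩ : testFunctions) +
        Complex.I • (⟨_, ofReal_mem_testFunctions hi his⟩ : testFunctions) := by
      apply Subtype.ext
      funext θ
      simp only [Submodule.coe_add, Submodule.coe_smul, Pi.add_apply, Pi.smul_apply, smul_eq_mul]
      rw [mul_comm Complex.I, Complex.re_add_im]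
    rw [hsplit]
    simp only [map_add, map_smul, inner_add_right, inner_smul_right, h1, h2]
  · intro h ψ hψ hs
    exact (hone ψ hψ hs).2 (h _)

/-- The spectrum consists of the `z` with a Floquet multiplier on the unit circle. -/
theorem mem_linearizationSpectrum_iff (z : ℂ) : z ∈ linearizationSpectrum k c φ ↔
    ∃ μ : ℂ, ‖μ‖ = 1 ∧ ((waveSystem hk hφ hper hlt).monodromy z).HasEigenvalue μ := by
  simp only [linearizationSpectrum, linearizationResolventSet, mem_compl_iff, Set.mem_ofPred_eq,
    exists_linearizationApplies_iff hk hφ hper hlt]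
  constructor
  · intro h
    by_contra! hcon
    exact h (exists_resolvent hcon)
  · rintro ⟨μ, hμ, h⟩
    exact not_exists_resolvent hμ h

end

end AdjointSystem

/-! ### Smooth one-parameter families of functions -/

section Families

lemma hasDerivAt_snd_of_contDiffAt {F : ℝ × ℝ → ℝ} {p : ℝ × ℝ} (hF : ContDiffAt ℝ ∞ F p) :
    HasDerivAt (fun t => F (p.1, t)) (fderiv ℝ F p (0, 1)) p.2 := by
  have h := (hF.differentiableAt (by simp)).hasFDerivAt
  exact h.comp_hasDerivAt (f := fun t => (p.1, t)) p.2
    ((hasDerivAt_const p.2 p.1).prodMk (hasDerivAt_id p.2))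

lemma hasDerivAt_fst_of_contDiffAt {F : ℝ × ℝ → ℝ} {p : ℝ × ℝ} (hF : ContDiffAt ℝ ∞ F p) :
    HasDerivAt (fun t => F (t, p.2)) (fderiv ℝ F p (1, 0)) p.1 := by
  have h := (hF.differentiableAt (by simp)).hasFDerivAt
  exact h.comp_hasDerivAt (f := fun t => (t, p.2)) p.1
    ((hasDerivAt_id p.1).prodMk (hasDerivAt_const p.1 p.2))

lemma contDiffAt_fderiv_apply {F : ℝ × ℝ → ℝ} {p : ℝ × ℝ} (hF : ContDiffAt ℝ ∞ F p) (v : ℝ × ℝ) :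
    ContDiffAt ℝ ∞ (fun p => fderiv ℝ F p v) p :=
  (hF.fderiv_right (m := ∞) (by simp)).clm_apply contDiffAt_const

/-- Mixed partial derivatives commute. -/
lemma hasDerivAt_snd_fderiv_fst {F : ℝ × ℝ → ℝ} {p : ℝ × ℝ} (hF : ContDiffAt ℝ ∞ F p) :
    HasDerivAt (fun t => fderiv ℝ F (p.1, t) (1, 0))
      (fderiv ℝ (fun r => fderiv ℝ F r (0, 1)) p (1, 0)) p.2 := by
  have h := hasDerivAt_snd_of_contDiffAt (contDiffAt_fderiv_apply hF (1, 0))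
  refine h.congr_deriv ?_
  have hd : DifferentiableAt ℝ (fderiv ℝ F) p :=
    (hF.fderiv_right (m := ∞) (by simp)).differentiableAt (by simp)
  have e : ∀ v w, fderiv ℝ (fun r => fderiv ℝ F r v) p w = fderiv ℝ (fderiv ℝ F) p w v := by
    intro v w
    rw [fderiv_clm_apply hd (differentiableAt_const v)]
    simp
  rw [e, e]
  exact (hF.isSymmSndFDerivAt (by
    simp only [minSmoothness_of_isRCLikeNormedField]
    exact WithTop.coe_le_coe.2 le_top)).eq _ _

/-- Differentiation under the integral sign for a smooth family. -/
lemma hasDerivAt_integral_family {F : ℝ × ℝ → ℝ} {δ : ℝ} (hδ : 0 < δ)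
    (hF : ∀ τ ∈ Ioo (-δ) δ, ∀ θ, ContDiffAt ℝ ∞ F (τ, θ)) :
    HasDerivAt (fun τ => ∫ θ in (0 : ℝ)..1, F (τ, θ))
      (∫ θ in (0 : ℝ)..1, fderiv ℝ F (0, θ) (1, 0)) 0 := by
  have hsub : ∀ τ ∈ Icc (-(δ / 2)) (δ / 2), τ ∈ Ioo (-δ) δ := fun τ hτ =>
    ⟨by linarith [hτ.1], by linarith [hτ.2]⟩
  have h0 : (0 : ℝ) ∈ Ioo (-δ) δ := ⟨by linarith, hδ⟩
  have hcont : ∀ τ ∈ Ioo (-δ) δ, Continuous fun θ => F (τ, θ) := fun τ hτ =>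
    continuous_iff_continuousAt.2 fun θ =>
      (hF τ hτ θ).continuousAt.comp (f := fun θ => (τ, θ)) (by fun_prop)
  have hcont' : ContinuousOn (fun p : ℝ × ℝ => fderiv ℝ F p (1, 0))
      (Icc (-(δ / 2)) (δ / 2) ×ˢ Icc (0 : ℝ) 1) := by
    rintro ⟨τ, θ⟩ hp
    exact (contDiffAt_fderiv_apply (hF τ (hsub τ hp.1) θ) (1, 0)).continuousAt.continuousWithinAt
  obtain ⟨C, hC⟩ := (isCompact_Icc.prod isCompact_Icc).exists_bound_of_continuousOn hcont'
  have hs : Icc (-(δ / 2)) (δ / 2) ∈ nhds (0 : ℝ) := Icc_mem_nhds (by linarith) (by linarith)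
  refine (intervalIntegral.hasDerivAt_integral_of_dominated_loc_of_deriv_le
    (F := fun τ θ => F (τ, θ)) (F' := fun τ θ => fderiv ℝ F (τ, θ) (1, 0)) (bound := fun _ => C)
    hs ?_ ?_ ?_ ?_ ?_ ?_).2
  · filter_upwards [hs] with τ hτ
    exact (hcont τ (hsub τ hτ)).aestronglyMeasurable
  · exact (hcont 0 h0).intervalIntegrable _ _
  · have : Continuous fun θ => fderiv ℝ F (0, θ) (1, 0) :=
      continuous_iff_continuousAt.2 fun θ =>
        (contDiffAt_fderiv_apply (hF 0 h0 θ) (1, 0)).continuousAt.comp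
          (f := fun θ => ((0 : ℝ), θ)) (by fun_prop)
    exact this.aestronglyMeasurable
  · refine Filter.Eventually.of_forall fun θ hθ τ hτ => ?_
    rw [uIoc_of_le zero_le_one] at hθ
    exact hC (τ, θ) ⟨hτ, Ioc_subset_Icc_self hθ⟩
  · exact intervalIntegrable_const
  · refine Filter.Eventually.of_forall fun θ _ τ hτ => ?_
    exact hasDerivAt_fst_of_contDiffAt (hF τ (hsub τ hτ) θ)

end Families

/-! ### Variations of a wave within the manifold -/

/-- `X` is the variation, at fixed position `x` (not at fixed phase `θ`), of a wave `φ` with frequency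
`k`, mass `M`, momentum `P` and constants `a`, `c`, when these quantities and `E` vary with the rates
`dk`, …; `X₁`, `X₂` are its first two derivatives. The two equations are the variations of the profile
equation and of the quadrature. A change of the frequency makes `X` grow linearly. -/
structure IsVariation (k a c : ℝ) (φ : ℝ → ℝ) (M P dk dM dP da dE dc : ℝ) (X X₁ X₂ : ℝ → ℝ) :
    Prop where
  hasDerivAt : ∀ θ, HasDerivAt X (X₁ θ) θ
  hasDerivAt₁ : ∀ θ, HasDerivAt X₁ (X₂ θ) θ
  profile : ∀ θ, k ^ 2 * X₂ θ =
    X θ - da / (c - φ θ) ^ 2 + 2 * a * (dc - X θ) / (c - φ θ) ^ 3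
  quadrature : ∀ θ, k ^ 2 * deriv φ θ * X₁ θ =
    dE + φ θ * X θ - da / (c - φ θ) + a * (dc - X θ) / (c - φ θ) ^ 2
  shift : ∀ θ, X (θ + 1) = X θ + dk / k * deriv φ θ
  shift₁ : ∀ θ, X₁ (θ + 1) = X₁ θ + dk / k * deriv (deriv φ) θ
  mass : ∫ θ in (0 : ℝ)..1, X θ = dM + dk / k * (φ 0 - M)
  momentum : ∫ θ in (0 : ℝ)..1, (φ θ * X θ + k ^ 2 * deriv φ θ * X₁ θ) =
    dP + dk / k * (1 / 2 * (φ 0 ^ 2 + k ^ 2 * deriv φ 0 ^ 2) - P)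

lemma periodic_deriv {φ : ℝ → ℝ} (h : Function.Periodic φ 1) : Function.Periodic (deriv φ) 1 := by
  intro θ
  rw [← deriv_comp_add_const, show (fun z => φ (z + 1)) = φ from funext h]

lemma IsWaveTrain.profile_deriv {k a E c : ℝ} {φ : ℝ → ℝ} (h : IsWaveTrain k a E c φ) (θ : ℝ) :
    φ θ - k ^ 2 * deriv (deriv φ) θ = a / (c - φ θ) ^ 2 := by
  have := h.profile θ
  rwa [iteratedDeriv_succ, iteratedDeriv_one] at this

lemma IsWaveTrain.quadrature_deriv {k a E c : ℝ} {φ : ℝ → ℝ} (h : IsWaveTrain k a E c φ) (θ : ℝ) :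
    (1 / 2) * (k * deriv φ θ) ^ 2 = E + φ θ ^ 2 / 2 - a / (c - φ θ) := by
  rw [h.quadrature θ, potential]; ring

lemma IsWaveTrain.third_deriv {k a E c : ℝ} {φ : ℝ → ℝ} (h : IsWaveTrain k a E c φ) (θ : ℝ) :
    k ^ 2 * deriv (deriv (deriv φ)) θ = deriv φ θ - 2 * a * deriv φ θ / (c - φ θ) ^ 3 := by
  have hd := AdjointSystem.hasDerivAt_of_contDiff h.smooth θ
  have hd2 := AdjointSystem.hasDerivAt_of_contDiff
    (AdjointSystem.contDiff_deriv (AdjointSystem.contDiff_deriv h.smooth)) θ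
  have hu : c - φ θ ≠ 0 := (sub_pos.2 (h.lt_speed θ)).ne'
  have e1 := hd.sub (hd2.const_mul (k ^ 2))
  have e2 := (hasDerivAt_const θ a).div ((hd.const_sub c).fun_pow 2) (pow_ne_zero 2 hu)
  have e3 : (φ - fun t => k ^ 2 * deriv (deriv φ) t) = (fun _ => a) / fun t => (c - φ t) ^ 2 :=
    funext fun t => h.profile_deriv t
  rw [e3] at e1
  have := e1.unique e2
  simp only [Nat.cast_ofNat, Nat.add_one_sub_one, pow_one, zero_mul, zero_sub] at this
  field_simp at this ⊢
  linear_combination -this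

theorem exists_variation {U : Set Par} {γ : Par → Par} {Φ : Par → ℝ → ℝ}
    (h : IsWaveManifold U γ Φ) {q : Par} (hq : q ∈ U) (e : Par) :
    ∃ X X₁ X₂, IsVariation (q 0) (γ q 0) (γ q 2) (Φ q) (q 1) (q 2) (e 0) (e 1) (e 2)
      (fderiv ℝ γ q e 0) (fderiv ℝ γ q e 1) (fderiv ℝ γ q e 2) X X₁ X₂ := by
  obtain ⟨δ, hδ, hball⟩ : ∃ δ : ℝ, 0 < δ ∧ ∀ τ ∈ Ioo (-δ) δ, q + τ • e ∈ U := by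
    have hc : ContinuousAt (fun τ : ℝ => q + τ • e) 0 := by fun_prop
    have := hc.preimage_mem_nhds (h.isOpen.mem_nhds (by simpa using hq))
    obtain ⟨δ, hδ, hsub⟩ := Metric.mem_nhds_iff.1 this
    refine ⟨δ, hδ, fun τ hτ => hsub ?_⟩
    rw [Real.ball_eq_Ioo]
    simpa using hτ
  have h0 : (0 : ℝ) ∈ Ioo (-δ) δ := ⟨by linarith, hδ⟩
  have hnhds : Ioo (-δ) δ ∈ nhds (0 : ℝ) := isOpen_Ioo.mem_nhds h0
  set F : ℝ × ℝ → ℝ := fun p => Φ (q + p.1 • e) p.2 with hFdef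
  have hF : ∀ τ ∈ Ioo (-δ) δ, ∀ θ, ContDiffAt ℝ ∞ F (τ, θ) := by
    intro τ hτ θ
    have h1 : ContDiffAt ℝ ∞ (fun z : Par × ℝ => Φ z.1 z.2) (q + τ • e, θ) :=
      h.smooth_profile.contDiffAt ((h.isOpen.prod isOpen_univ).mem_nhds ⟨hball τ hτ, mem_univ _⟩)
    exact h1.comp (τ, θ) (f := fun p : ℝ × ℝ => (q + p.1 • e, p.2)) (by fun_prop)
  set G : ℝ × ℝ → ℝ := fun p => fderiv ℝ F p (0, 1) with hGdef
  have hG : ∀ τ ∈ Ioo (-δ) δ, ∀ θ, ContDiffAt ℝ ∞ G (τ, θ) := fun τ hτ θ =>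
    contDiffAt_fderiv_apply (hF τ hτ θ) _
  set H : ℝ × ℝ → ℝ := fun p => fderiv ℝ G p (0, 1) with hHdef
  have hH : ∀ τ ∈ Ioo (-δ) δ, ∀ θ, ContDiffAt ℝ ∞ H (τ, θ) := fun τ hτ θ =>
    contDiffAt_fderiv_apply (hG τ hτ θ) _
  have dF : ∀ τ ∈ Ioo (-δ) δ, deriv (Φ (q + τ • e)) = fun θ => G (τ, θ) := fun τ hτ =>
    funext fun θ => (hasDerivAt_snd_of_contDiffAt (hF τ hτ θ)).deriv
  have dG : ∀ τ ∈ Ioo (-δ) δ, deriv (deriv (Φ (q + τ • e))) = fun θ => H (τ, θ) := fun τ hτ => by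
    rw [dF τ hτ]
    exact funext fun θ => (hasDerivAt_snd_of_contDiffAt (hG τ hτ θ)).deriv
  have hW : ∀ τ ∈ Ioo (-δ) δ, IsWaveTrain (q 0 + τ * e 0) (γ (q + τ • e) 0) (γ (q + τ • e) 1)
      (γ (q + τ • e) 2) (Φ (q + τ • e)) := fun τ hτ => by
    simpa using h.wave _ (hball τ hτ)
  have hW0 := h.wave q hq
  set φ := Φ q with hφ
  set k := q 0 with hk
  have hk0 : 0 < k := hW0.freq_pos
  set a := γ q 0
  set c := γ q 2
  have F0 : ∀ θ, F (0, θ) = φ θ := fun θ => by simp [hFdef, hφ]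
  have G0 : ∀ θ, G (0, θ) = deriv φ θ := fun θ => by
    have := congrFun (dF 0 h0) θ
    simpa using this.symm
  have H0 : ∀ θ, H (0, θ) = deriv (deriv φ) θ := fun θ => by
    have := congrFun (dG 0 h0) θ
    simpa using this.symm
  -- Variations at fixed phase.
  set w₀ : ℝ → ℝ := fun θ => fderiv ℝ F (0, θ) (1, 0) with hw₀
  set w₁ : ℝ → ℝ := fun θ => fderiv ℝ G (0, θ) (1, 0) with hw₁
  set w₂ : ℝ → ℝ := fun θ => fderiv ℝ H (0, θ) (1, 0) with hw₂
  have Fτ : ∀ θ, HasDerivAt (fun τ => F (τ, θ)) (w₀ θ) 0 := fun θ =>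
    hasDerivAt_fst_of_contDiffAt (hF 0 h0 θ)
  have Gτ : ∀ θ, HasDerivAt (fun τ => G (τ, θ)) (w₁ θ) 0 := fun θ =>
    hasDerivAt_fst_of_contDiffAt (hG 0 h0 θ)
  have Hτ : ∀ θ, HasDerivAt (fun τ => H (τ, θ)) (w₂ θ) 0 := fun θ =>
    hasDerivAt_fst_of_contDiffAt (hH 0 h0 θ)
  have dw₀ : ∀ θ, HasDerivAt w₀ (w₁ θ) θ := fun θ => hasDerivAt_snd_fderiv_fst (hF 0 h0 θ)
  have dw₁ : ∀ θ, HasDerivAt w₁ (w₂ θ) θ := fun θ => hasDerivAt_snd_fderiv_fst (hG 0 h0 θ)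
  have hγ : ∀ i, HasDerivAt (fun τ : ℝ => γ (q + τ • e) i) (fderiv ℝ γ q e i) 0 := by
    intro i
    have h1 : HasFDerivAt γ (fderiv ℝ γ q) (q + (0 : ℝ) • e) := by
      rw [zero_smul, add_zero]
      exact ((h.smooth_params.contDiffAt (h.isOpen.mem_nhds hq)).differentiableAt
        (by simp)).hasFDerivAt
    have h2 : HasDerivAt (fun τ : ℝ => q + τ • e) e 0 := by
      simpa using ((hasDerivAt_id (0 : ℝ)).smul_const e).const_add q
    exact hasDerivAt_pi.1 (h1.comp_hasDerivAt (0 : ℝ) h2) i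
  set da := fderiv ℝ γ q e 0
  set dE := fderiv ℝ γ q e 1
  set dc := fderiv ℝ γ q e 2
  have hkτ : HasDerivAt (fun τ : ℝ => k + τ * e 0) (e 0) 0 := by
    simpa using ((hasDerivAt_id (0 : ℝ)).mul_const (e 0)).const_add k
  have hu : ∀ θ, c - φ θ ≠ 0 := fun θ => (sub_pos.2 (hW0.lt_speed θ)).ne'
  have hu0 : ∀ θ, γ (q + (0 : ℝ) • e) 2 - F (0, θ) ≠ 0 := fun θ => by
    rw [F0, zero_smul, add_zero]; exact hu θ
  have γ0 : γ (q + (0 : ℝ) • e) 0 = a := by rw [zero_smul, add_zero]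
  have γ2 : γ (q + (0 : ℝ) • e) 2 = c := by rw [zero_smul, add_zero]
  have hγ0 : HasDerivAt (fun τ : ℝ => γ (q + τ • e) 0) da 0 := hγ 0
  have hγ1 : HasDerivAt (fun τ : ℝ => γ (q + τ • e) 1) dE 0 := hγ 1
  have hγ2 : HasDerivAt (fun τ : ℝ => γ (q + τ • e) 2) dc 0 := hγ 2
  -- Variation of the profile equation.
  have hP : ∀ θ, k ^ 2 * w₂ θ = w₀ θ - 2 * k * e 0 * deriv (deriv φ) θ - da / (c - φ θ) ^ 2
      + 2 * a * (dc - w₀ θ) / (c - φ θ) ^ 3 := by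
    intro θ
    have e1 := (Fτ θ).sub ((hkτ.fun_pow 2).mul (Hτ θ))
    have e2 := hγ0.div ((hγ2.sub (Fτ θ)).pow 2) (pow_ne_zero 2 (hu0 θ))
    have e3 := e2.congr_of_eventuallyEq (f₁ := (fun τ => F (τ, θ)) -
        (fun τ => (k + τ * e 0) ^ 2) * fun τ => H (τ, θ)) (by
      filter_upwards [hnhds] with τ hτ
      have := (hW τ hτ).profile_deriv θ
      rw [dG τ hτ] at this
      exact this)
    have := e1.unique e3
    simp only [Pi.sub_apply, Pi.pow_apply, F0, H0, γ0, γ2, zero_mul, add_zero, Nat.cast_ofNat,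
      Nat.add_one_sub_one, pow_one] at this
    have hne := hu θ
    field_simp at this ⊢
    linear_combination -this
  -- Variation of the quadrature.
  have hQ : ∀ θ, k ^ 2 * deriv φ θ * w₁ θ = dE + φ θ * w₀ θ - da / (c - φ θ)
      + a * (dc - w₀ θ) / (c - φ θ) ^ 2 - k * e 0 * deriv φ θ ^ 2 := by
    intro θ
    have e1 := ((hkτ.mul (Gτ θ)).pow 2).const_mul (1 / 2)
    have e2 := (hγ1.add (((Fτ θ).pow 2).div_const 2)).sub (hγ0.div (hγ2.sub (Fτ θ)) (hu0 θ))
    have e3 := e2.congr_of_eventuallyEq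
      (f₁ := fun τ => 1 / 2 * (((fun τ => k + τ * e 0) * fun τ => G (τ, θ)) ^ 2) τ) (by
        filter_upwards [hnhds] with τ hτ
        have := (hW τ hτ).quadrature_deriv θ
        rw [dF τ hτ] at this
        exact this)
    have := e1.unique e3
    simp only [Pi.sub_apply, Pi.mul_apply, F0, G0, γ0, γ2, zero_mul, add_zero, Nat.cast_ofNat,
      Nat.add_one_sub_one, pow_one] at this
    have hne := hu θ
    field_simp at this ⊢
    linear_combination this
  have hper := hW0.periodic
  have hper1 := periodic_deriv hper
  have hper2 := periodic_deriv hper1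
  have pw₀ : ∀ θ, w₀ (θ + 1) = w₀ θ := by
    intro θ
    refine (Fτ (θ + 1)).unique ((Fτ θ).congr_of_eventuallyEq ?_)
    filter_upwards [hnhds] with τ hτ
    exact (hW τ hτ).periodic θ
  have pw₁ : ∀ θ, w₁ (θ + 1) = w₁ θ := by
    intro θ
    have := (dw₀ (θ + 1)).comp_add_const θ 1
    rw [show (fun x => w₀ (x + 1)) = w₀ from funext pw₀] at this
    exact this.unique (dw₀ θ)
  have cφ := hW0.smooth.continuous
  have sφ1 := AdjointSystem.contDiff_deriv hW0.smooth
  have sφ2 := AdjointSystem.contDiff_deriv sφ1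
  have dφ := AdjointSystem.hasDerivAt_of_contDiff hW0.smooth
  have dφ1 := AdjointSystem.hasDerivAt_of_contDiff sφ1
  have dφ2 := AdjointSystem.hasDerivAt_of_contDiff sφ2
  have cφ1 := sφ1.continuous
  have cφ2 := sφ2.continuous
  have cw₀ : Continuous w₀ := continuous_iff_continuousAt.2 fun θ => (dw₀ θ).continuousAt
  have cw₁ : Continuous w₁ := continuous_iff_continuousAt.2 fun θ => (dw₁ θ).continuousAt
  -- Variation of the mass.
  have hM : ∫ θ in (0 : ℝ)..1, w₀ θ = e 1 := by
    refine (hasDerivAt_integral_family hδ hF).unique ?_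
    have h1 : HasDerivAt (fun τ : ℝ => q 1 + τ * e 1) (e 1) 0 := by
      simpa using ((hasDerivAt_id (0 : ℝ)).mul_const (e 1)).const_add (q 1)
    refine h1.congr_of_eventuallyEq ?_
    filter_upwards [hnhds] with τ hτ
    have := h.mass_eq _ (hball τ hτ)
    simpa [mass] using! this
  -- Variation of the momentum.
  have hPm : ∫ θ in (0 : ℝ)..1, (φ θ * w₀ θ + k * e 0 * deriv φ θ ^ 2 + k ^ 2 * deriv φ θ * w₁ θ)
      = e 2 := by
    set F2 : ℝ × ℝ → ℝ := fun p => F p ^ 2 + (k + p.1 * e 0) ^ 2 * G p ^ 2 with hF2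
    have sF2 : ∀ τ ∈ Ioo (-δ) δ, ∀ θ, ContDiffAt ℝ ∞ F2 (τ, θ) := fun τ hτ θ => by
      have s1 := hF τ hτ θ
      have s2 := hG τ hτ θ
      exact (s1.pow 2).add (ContDiffAt.mul (by fun_prop) (s2.pow 2))
    have e1 := (hasDerivAt_integral_family hδ sF2).const_mul (1 / 2)
    have h1 : HasDerivAt (fun τ : ℝ => q 2 + τ * e 2) (e 2) 0 := by
      simpa using ((hasDerivAt_id (0 : ℝ)).mul_const (e 2)).const_add (q 2)
    have h2 := e1.unique (h1.congr_of_eventuallyEq (by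
      filter_upwards [hnhds] with τ hτ
      have := h.momentum_eq _ (hball τ hτ)
      rw [momentum, dF τ hτ] at this
      simpa using! this))
    rw [← h2, ← intervalIntegral.integral_const_mul]
    apply intervalIntegral.integral_congr
    intro θ _
    have h3 := hasDerivAt_fst_of_contDiffAt (sF2 0 h0 θ)
    have h4 := ((Fτ θ).fun_pow 2).add ((hkτ.fun_pow 2).mul ((Gτ θ).fun_pow 2))
    have h5 := h3.unique h4
    simp only [F0, G0, zero_mul, add_zero, Nat.cast_ofNat] at h5
    simp only [h5]
    ring
  refine ⟨fun θ => w₀ θ + e 0 / k * (θ * deriv φ θ),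
    fun θ => w₁ θ + e 0 / k * (deriv φ θ + θ * deriv (deriv φ) θ),
    fun θ => w₂ θ + e 0 / k * (2 * deriv (deriv φ) θ + θ * deriv (deriv (deriv φ)) θ), ?_⟩
  constructor
  · intro θ
    refine ((dw₀ θ).add (((hasDerivAt_id θ).mul (dφ1 θ)).const_mul (e 0 / k))).congr_deriv ?_
    simp
  · intro θ
    refine ((dw₁ θ).add (((dφ1 θ).add
      ((hasDerivAt_id θ).mul (dφ2 θ))).const_mul (e 0 / k))).congr_deriv ?_
    simp only [id]
    ring
  · intro θ
    have e1 := hP θ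
    have e2 := hW0.third_deriv θ
    have hne := hu θ
    field_simp at e1 e2 ⊢
    linear_combination k * e1 + e 0 * θ * e2
  · intro θ
    have e1 := hQ θ
    have e2 := hW0.profile_deriv θ
    have hne := hu θ
    field_simp at e1 e2 ⊢
    linear_combination k * e1 - e 0 * θ * deriv φ θ * e2
  · intro θ
    simp only [pw₀, hper1 θ]
    ring
  · intro θ
    simp only [pw₁, hper1 θ, hper2 θ]
    ring
  · have hp : ∫ θ in (0 : ℝ)..1, θ * deriv φ θ = φ 0 - q 1 := by
      have h1 := intervalIntegral.integral_eq_sub_of_hasDerivAt (a := 0) (b := 1)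
        (fun θ _ => (hasDerivAt_id θ).mul (dφ θ)) (Continuous.intervalIntegrable (by
          simp only [id]; fun_prop) _ _)
      simp only [id, one_mul] at h1
      rw [intervalIntegral.integral_add (cφ.intervalIntegrable _ _)
        (Continuous.intervalIntegrable (by fun_prop) _ _)] at h1
      have h2 := h.mass_eq q hq
      rw [mass] at h2
      have h3 : φ 1 = φ 0 := by simpa using hper 0
      simp only [Pi.mul_apply, id, one_mul, zero_mul, h3] at h1
      linarith
    rw [intervalIntegral.integral_add (cw₀.intervalIntegrable _ _)
      (Continuous.intervalIntegrable (by fun_prop) _ _), intervalIntegral.integral_const_mul, hp, hM]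
  · set g : ℝ → ℝ := fun θ => 1 / 2 * (φ θ ^ 2 + k ^ 2 * deriv φ θ ^ 2) with hg
    have cg : Continuous g := by fun_prop
    have dg : ∀ θ, HasDerivAt g (φ θ * deriv φ θ + k ^ 2 * deriv φ θ * deriv (deriv φ) θ) θ := by
      intro θ
      refine ((((dφ θ).fun_pow 2).add (((dφ1 θ).fun_pow 2).const_mul (k ^ 2))).const_mul
        (1 / 2)).congr_deriv ?_
      simp only [Nat.cast_ofNat]
      ring
    have hgP : ∫ θ in (0 : ℝ)..1, g θ = q 2 := by
      have h2 := h.momentum_eq q hq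
      rw [momentum, ← intervalIntegral.integral_const_mul] at h2
      exact h2
    have hp : ∫ θ in (0 : ℝ)..1, θ * (φ θ * deriv φ θ + k ^ 2 * deriv φ θ * deriv (deriv φ) θ)
        = g 0 - q 2 := by
      have h1 := intervalIntegral.integral_eq_sub_of_hasDerivAt (a := 0) (b := 1)
        (fun θ _ => (hasDerivAt_id θ).mul (dg θ)) (Continuous.intervalIntegrable (by
          simp only [id]; fun_prop) _ _)
      simp only [id, one_mul] at h1
      rw [intervalIntegral.integral_add (cg.intervalIntegrable _ _)
        (Continuous.intervalIntegrable (by fun_prop) _ _), hgP] at h1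
      have h3 : g 1 = g 0 := by
        have e1 := hper 0
        have e2 := hper1 0
        rw [zero_add] at e1 e2
        simp only [hg, e1, e2]
      simp only [Pi.mul_apply, id, one_mul, zero_mul, h3] at h1
      linarith
    have hsplit : ∀ θ, φ θ * (w₀ θ + e 0 / k * (θ * deriv φ θ)) + k ^ 2 * deriv φ θ *
        (w₁ θ + e 0 / k * (deriv φ θ + θ * deriv (deriv φ) θ)) =
        (φ θ * w₀ θ + k * e 0 * deriv φ θ ^ 2 + k ^ 2 * deriv φ θ * w₁ θ) +
        e 0 / k * (θ * (φ θ * deriv φ θ + k ^ 2 * deriv φ θ * deriv (deriv φ) θ)) := by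
      intro θ
      field_simp
      ring
    simp only [hsplit]
    rw [intervalIntegral.integral_add (Continuous.intervalIntegrable (by fun_prop) _ _)
      (Continuous.intervalIntegrable (by fun_prop) _ _), intervalIntegral.integral_const_mul, hp, hPm]

/-! ### The averaged fluxes and the Whitham matrix -/

section Flux

variable {k a E c : ℝ} {φ : ℝ → ℝ}

lemma IsWaveTrain.integral_deriv_two (h : IsWaveTrain k a E c φ) :
    ∫ θ in (0 : ℝ)..1, deriv (deriv φ) θ = 0 := by
  have s1 := AdjointSystem.contDiff_deriv h.smooth
  rw [intervalIntegral.integral_eq_sub_of_hasDerivAt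
    (fun θ _ => AdjointSystem.hasDerivAt_of_contDiff s1 θ)
    ((AdjointSystem.contDiff_deriv s1).continuous.intervalIntegrable _ _)]
  have := periodic_deriv h.periodic 0
  rw [zero_add] at this
  rw [this, sub_self]

lemma IsWaveTrain.integral_mul_deriv_two (h : IsWaveTrain k a E c φ) :
    ∫ θ in (0 : ℝ)..1, (deriv φ θ * deriv φ θ + φ θ * deriv (deriv φ) θ) = 0 := by
  have s1 := AdjointSystem.contDiff_deriv h.smooth
  have c0 := h.smooth.continuous
  have c1 := s1.continuous
  have c2 := (AdjointSystem.contDiff_deriv s1).continuous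
  rw [intervalIntegral.integral_eq_sub_of_hasDerivAt (fun θ _ =>
    (AdjointSystem.hasDerivAt_of_contDiff h.smooth θ).mul
      (AdjointSystem.hasDerivAt_of_contDiff s1 θ))
    (Continuous.intervalIntegrable (by fun_prop) _ _)]
  have e0 := h.periodic 0
  have e1 := periodic_deriv h.periodic 0
  rw [zero_add] at e0 e1
  simp only [Pi.mul_apply, e0, e1, sub_self]

/-- The profile equation and the quadrature combine to a first integral of second order. -/
lemma IsWaveTrain.energy_eq (h : IsWaveTrain k a E c φ) (θ : ℝ) :
    E = (c - φ θ) * (φ θ - k ^ 2 * deriv (deriv φ) θ) - φ θ ^ 2 / 2 + k ^ 2 * deriv φ θ ^ 2 / 2 := by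
  have e1 := h.profile_deriv θ
  have e2 := h.quadrature_deriv θ
  have hu : c - φ θ ≠ 0 := (sub_pos.2 (h.lt_speed θ)).ne'
  rw [e1]
  field_simp at e2 ⊢
  linear_combination -e2

lemma IsWaveTrain.profile_mul (h : IsWaveTrain k a E c φ) (θ : ℝ) :
    a = (c - φ θ) ^ 2 * (φ θ - k ^ 2 * deriv (deriv φ) θ) := by
  have hu : c - φ θ ≠ 0 := (sub_pos.2 (h.lt_speed θ)).ne'
  rw [h.profile_deriv θ]
  field_simp

theorem IsWaveTrain.integral_flux_mass (h : IsWaveTrain k a E c φ) :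
    ∫ θ in (0 : ℝ)..1, (-(3 / 2) * φ θ ^ 2 - (1 / 2) * k ^ 2 * deriv φ θ ^ 2) = E - c * mass φ := by
  have s1 := AdjointSystem.contDiff_deriv h.smooth
  have c0 := h.smooth.continuous
  have c1 := s1.continuous
  have c2 := (AdjointSystem.contDiff_deriv s1).continuous
  have hpt : ∀ θ, -(3 / 2) * φ θ ^ 2 - (1 / 2) * k ^ 2 * deriv φ θ ^ 2 =
      E + (-c) * φ θ + (c * k ^ 2) * deriv (deriv φ) θ
        + (-k ^ 2) * (deriv φ θ * deriv φ θ + φ θ * deriv (deriv φ) θ) := fun θ => by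
    linear_combination -(h.energy_eq θ)
  simp only [hpt]
  rw [intervalIntegral.integral_add (Continuous.intervalIntegrable (by fun_prop) _ _)
      (Continuous.intervalIntegrable (by fun_prop) _ _),
    intervalIntegral.integral_add (Continuous.intervalIntegrable (by fun_prop) _ _)
      (Continuous.intervalIntegrable (by fun_prop) _ _),
    intervalIntegral.integral_add (Continuous.intervalIntegrable (by fun_prop) _ _)
      (Continuous.intervalIntegrable (by fun_prop) _ _)]
  simp only [intervalIntegral.integral_const_mul, h.integral_deriv_two, h.integral_mul_deriv_two,
    intervalIntegral.integral_const, mass]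
  simp
  ring

theorem IsWaveTrain.integral_flux_momentum (h : IsWaveTrain k a E c φ) :
    ∫ θ in (0 : ℝ)..1, (c * k ^ 2 * deriv φ θ ^ 2 - φ θ ^ 3 + k ^ 2 * φ θ ^ 2 * iteratedDeriv 2 φ θ)
      = c * E - a - c * momentum k φ := by
  have s1 := AdjointSystem.contDiff_deriv h.smooth
  have c0 := h.smooth.continuous
  have c1 := s1.continuous
  have c2 := (AdjointSystem.contDiff_deriv s1).continuous
  have hpt : ∀ θ, c * k ^ 2 * deriv φ θ ^ 2 - φ θ ^ 3 + k ^ 2 * φ θ ^ 2 * iteratedDeriv 2 φ θ =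
      (c * E - a) + (-(c * (1 / 2))) * (φ θ ^ 2 + k ^ 2 * deriv φ θ ^ 2)
        + (c * k ^ 2) * (deriv φ θ * deriv φ θ + φ θ * deriv (deriv φ) θ) := fun θ => by
    rw [iteratedDeriv_succ, iteratedDeriv_one]
    linear_combination h.profile_mul θ - c * h.energy_eq θ
  simp only [hpt]
  rw [intervalIntegral.integral_add (Continuous.intervalIntegrable (by fun_prop) _ _)
      (Continuous.intervalIntegrable (by fun_prop) _ _),
    intervalIntegral.integral_add (Continuous.intervalIntegrable (by fun_prop) _ _)
      (Continuous.intervalIntegrable (by fun_prop) _ _)]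
  simp only [intervalIntegral.integral_const_mul, h.integral_mul_deriv_two,
    intervalIntegral.integral_const, momentum]
  simp
  ring

end Flux

section Whitham

variable {U : Set Par} {γ : Par → Par} {Φ : Par → ℝ → ℝ}

/-- On the manifold of waves the Whitham system reads
`k_T = (-k c)_X`, `M_T = (E - c M)_X`, `P_T = (c E - a - c P)_X`. -/
lemma IsWaveManifold.whithamFlux_eq (h : IsWaveManifold U γ Φ) {q : Par} (hq : q ∈ U) :
    whithamFlux γ Φ q = ![-(q 0 * γ q 2), γ q 1 - γ q 2 * q 1,
      γ q 2 * γ q 1 - γ q 0 - γ q 2 * q 2] := by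
  have hw := h.wave q hq
  rw [whithamFlux, hw.integral_flux_mass, hw.integral_flux_momentum, h.mass_eq q hq,
    h.momentum_eq q hq]

/-- The matrix `𝓦 + c` acts by `e ↦ (-k dc, dE - M dc, E dc + c dE - da - P dc)`, where `da`, `dE` and
`dc` are the rates of change of the constants in the direction `e`. -/
theorem IsWaveManifold.whithamMatrix_add_speed_mulVec (h : IsWaveManifold U γ Φ) {q : Par}
    (hq : q ∈ U) (e : Par) :
    (whithamMatrix γ Φ q + Matrix.scalar (Fin 3) (γ q 2)).mulVec e =
      ![-(q 0 * fderiv ℝ γ q e 2), fderiv ℝ γ q e 1 - q 1 * fderiv ℝ γ q e 2,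
        γ q 1 * fderiv ℝ γ q e 2 + γ q 2 * fderiv ℝ γ q e 1 - fderiv ℝ γ q e 0
          - q 2 * fderiv ℝ γ q e 2] := by
  have hd : HasFDerivAt γ (fderiv ℝ γ q) q :=
    ((h.smooth_params.contDiffAt (h.isOpen.mem_nhds hq)).differentiableAt (by simp)).hasFDerivAt
  have hγ : ∀ i, HasFDerivAt (fun r => γ r i)
      ((ContinuousLinearMap.proj (R := ℝ) (φ := fun _ : Fin 3 => ℝ) i).comp (fderiv ℝ γ q)) q :=
    fun i => (hasFDerivAt_pi'.1 hd) i
  have hr : ∀ i, HasFDerivAt (fun r : Par => r i)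
      (ContinuousLinearMap.proj (R := ℝ) (φ := fun _ : Fin 3 => ℝ) i) q := fun i =>
    (ContinuousLinearMap.proj (R := ℝ) (φ := fun _ : Fin 3 => ℝ) i).hasFDerivAt
  have hev : ∀ᶠ r in nhds q, r ∈ U := h.isOpen.mem_nhds hq
  have hmul : ∀ i, (whithamMatrix γ Φ q).mulVec e i =
      fderiv ℝ (fun r => whithamFlux γ Φ r i) q e := by
    intro i
    conv_rhs => rw [← Finset.univ_sum_single e]
    rw [map_sum, Matrix.mulVec, dotProduct]
    refine Finset.sum_congr rfl fun j _ => ?_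
    rw [whithamMatrix, Matrix.of_apply]
    have : (Pi.single j (e j) : Par) = e j • Pi.single j 1 := by
      rw [← Pi.single_smul, smul_eq_mul, mul_one]
    rw [this, map_smul, smul_eq_mul, mul_comm]
  have f0 := ((hr 0).mul (hγ 2)).neg.congr_of_eventuallyEq
    (f₁ := fun r => whithamFlux γ Φ r 0) (by
      filter_upwards [hev] with r hr
      rw [h.whithamFlux_eq hr]
      simp)
  have f1 := ((hγ 1).sub ((hγ 2).mul (hr 1))).congr_of_eventuallyEq
    (f₁ := fun r => whithamFlux γ Φ r 1) (by
      filter_upwards [hev] with r hr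
      rw [h.whithamFlux_eq hr]
      simp)
  have f2 := ((((hγ 2).mul (hγ 1)).sub (hγ 0)).sub ((hγ 2).mul (hr 2))).congr_of_eventuallyEq
    (f₁ := fun r => whithamFlux γ Φ r 2) (by
      filter_upwards [hev] with r hr
      rw [h.whithamFlux_eq hr]
      simp)
  rw [Matrix.add_mulVec]
  ext i
  rw [Pi.add_apply, hmul]
  fin_cases i
  · change fderiv ℝ (fun r => whithamFlux γ Φ r 0) q e + _ = _
    rw [f0.fderiv]
    simp [Matrix.scalar_apply, Matrix.mulVec_diagonal]
  · change fderiv ℝ (fun r => whithamFlux γ Φ r 1) q e + _ = _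
    rw [f1.fderiv]
    simp [Matrix.scalar_apply, Matrix.mulVec_diagonal]
    ring
  · change fderiv ℝ (fun r => whithamFlux γ Φ r 2) q e + _ = _
    rw [f2.fderiv]
    simp [Matrix.scalar_apply, Matrix.mulVec_diagonal]
    ring

end Whitham

/-! ### Solutions at zero frequency -/

namespace AdjointSystem

section ZeroFrequency

variable {S : AdjointSystem}

lemma isSolution_zero_of_real {y₀ y₁ y₂ : ℝ → ℝ} (h₀ : ∀ θ, HasDerivAt y₀ (y₁ θ) θ)
    (h₁ : ∀ θ, HasDerivAt y₁ (S.ρ θ / S.k ^ 2 * y₂ θ) θ)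
    (h₂ : ∀ θ, HasDerivAt y₂ (S.q θ * y₁ θ) θ) :
    S.IsSolution 0 0 fun θ => ![(y₀ θ : ℂ), (y₁ θ : ℂ), (y₂ θ : ℂ)] := by
  refine isSolution_iff_components.2 fun θ => ⟨?_, ?_, ?_⟩
  · exact (h₀ θ).ofReal_comp
  · refine (h₁ θ).ofReal_comp.congr_deriv ?_
    simp
    ring
  · refine (h₂ θ).ofReal_comp.congr_deriv ?_
    simp

lemma isSolution_zero_const (b : ℂ) : S.IsSolution 0 0 fun _ => ![b, 0, 0] := by
  refine isSolution_iff_components.2 fun θ => ⟨?_, ?_, ?_⟩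
  all_goals
    simp
    exact hasDerivAt_const _ _

end ZeroFrequency

end AdjointSystem

section Waves

variable {k a E c : ℝ} {φ : ℝ → ℝ}

/-- The adjoint system of a wave train. -/
def IsWaveTrain.system (h : IsWaveTrain k a E c φ) : AdjointSystem :=
  waveSystem h.freq_pos h.smooth h.periodic h.lt_speed

lemma IsWaveTrain.system_k (h : IsWaveTrain k a E c φ) : h.system.k = k := rfl

lemma IsWaveTrain.system_ρ (h : IsWaveTrain k a E c φ) (θ : ℝ) :
    h.system.ρ θ = 1 / (k * (c - φ θ)) := rfl

lemma IsWaveTrain.system_q (h : IsWaveTrain k a E c φ) (θ : ℝ) :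
    h.system.q θ = k * (c - 3 * φ θ + k ^ 2 * deriv (deriv φ) θ) := by
  have : deriv (deriv φ) = iteratedDeriv 2 φ := by rw [iteratedDeriv_succ, iteratedDeriv_one]
  rw [this]
  rfl

/-- The profile itself gives a periodic solution at zero frequency; its derivative is in the kernel of
`𝓛`, by translation invariance. -/
lemma IsWaveTrain.isSolution_profile (h : IsWaveTrain k a E c φ) :
    h.system.IsSolution 0 0 fun θ =>
      ![((φ θ : ℝ) : ℂ), ((deriv φ θ : ℝ) : ℂ), ((k ^ 3 * (c - φ θ) * deriv (deriv φ) θ : ℝ) : ℂ)] := by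
  have hk := h.freq_pos.ne'
  have s1 := AdjointSystem.contDiff_deriv h.smooth
  have s2 := AdjointSystem.contDiff_deriv s1
  have d0 := AdjointSystem.hasDerivAt_of_contDiff h.smooth
  refine AdjointSystem.isSolution_zero_of_real d0 (fun θ => ?_) fun θ => ?_
  · have hu : c - φ θ ≠ 0 := (sub_pos.2 (h.lt_speed θ)).ne'
    refine (AdjointSystem.hasDerivAt_of_contDiff s1 θ).congr_deriv ?_
    rw [h.system_ρ, h.system_k]
    field_simp
  · have hu : c - φ θ ≠ 0 := (sub_pos.2 (h.lt_speed θ)).ne'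
    refine ((((d0 θ).const_sub c).const_mul (k ^ 3)).mul
      (AdjointSystem.hasDerivAt_of_contDiff s2 θ)).congr_deriv ?_
    rw [h.system_q]
    have e1 := h.profile_deriv θ
    have e2 := h.third_deriv θ
    field_simp at e1 e2 ⊢
    have e3 : (c - φ θ) ^ 2 * (k ^ 2 * (c - φ θ) * deriv (deriv (deriv φ)) θ
        - deriv φ θ * (c - 3 * φ θ + 2 * k ^ 2 * deriv (deriv φ) θ)) = 0 := by
      linear_combination e2 + 2 * deriv φ θ * e1
    have e4 := (mul_eq_zero.1 e3).resolve_left (pow_ne_zero 2 hu)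
    linear_combination e4

/-- `φ'` and `φ''` do not vanish simultaneously, for otherwise the wave would be constant. -/
lemma IsWaveTrain.deriv_ne_zero (h : IsWaveTrain k a E c φ) :
    deriv φ 0 ≠ 0 ∨ deriv (deriv φ) 0 ≠ 0 := by
  by_contra! hcon
  have h1 := h.isSolution_profile.unique (AdjointSystem.isSolution_zero_const ((φ 0 : ℝ) : ℂ))
    (t₀ := 0) (by simp [hcon.1, hcon.2])
  have h2 : ∀ θ, φ θ = φ 0 := fun θ => by
    have := congrFun (congrFun h1 θ) 0
    simpa using this
  exact h.fundamental (1 / 2) (by norm_num) (by norm_num) fun θ => by rw [h2, h2 θ]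

lemma IsWaveTrain.normSq_pos (h : IsWaveTrain k a E c φ) :
    0 < deriv φ 0 ^ 2 + (k ^ 3 * (c - φ 0) * deriv (deriv φ) 0) ^ 2 := by
  have hk := h.freq_pos
  have hu := sub_pos.2 (h.lt_speed 0)
  rcases h.deriv_ne_zero with h1 | h1 <;> positivity

end Waves

/-! ### Expansion of the monodromy map at low frequency -/

namespace AdjointSystem

section Expansion

variable {S : AdjointSystem}

lemma apply_one_of_hasDerivAt_Icc {z : ℂ} {y : ℝ → Fin 3 → ℂ}
    (hy : ∀ θ ∈ Icc (0 : ℝ) 1, HasDerivAt y ((S.coeff₀ θ + z • S.coeff₁ θ) (y θ)) θ) :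
    y 1 = S.monodromy z (y 0) := by
  obtain ⟨β, h₀, h₁⟩ := S.exists_norm_coeff_le
  have hβ0 : 0 ≤ β := (norm_nonneg _).trans (h₀ 0)
  have hB : ∀ t, ‖S.coeff₀ t + z • S.coeff₁ t‖ ≤ β + ‖z‖ * β := fun t => by
    refine (norm_add_le _ _).trans (add_le_add (h₀ t) ?_)
    rw [norm_smul]
    gcongr
    exact h₁ t
  have hf := S.isSolution_flow z (y 0)
  have hf' : ∀ θ, HasDerivAt (S.flow z (y 0))
      ((S.coeff₀ θ + z • S.coeff₁ θ) (S.flow z (y 0) θ)) θ := fun θ => by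
    simpa using isSolution_iff.1 hf θ
  refine ODE_solution_unique (v := fun t y => (S.coeff₀ t + z • S.coeff₁ t) y)
    (K := ⟨β + ‖z‖ * β, by positivity⟩) (a := 0) (b := 1) (fun t => ?_)
    (fun t ht => (hy t ht).continuousAt.continuousWithinAt)
    (fun t ht => (hy t (Ico_subset_Icc_self ht)).hasDerivWithinAt)
    (fun t _ => (hf' t).continuousAt.continuousWithinAt)
    (fun t _ => (hf' t).hasDerivWithinAt) (by simp) (right_mem_Icc.2 zero_le_one)
  refine LipschitzWith.of_dist_le_mul fun x w => ?_
  rw [dist_eq_norm, dist_eq_norm, ← map_sub]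
  exact ContinuousLinearMap.le_of_opNorm_le _ (hB t) _

/-- A formal solution `Y₀ + z Y₁` of first order in `z` is corrected to a solution by a remainder
`z² E`, which depends smoothly on `z`. -/
lemma exists_second_order_remainder {Y₀ Y₁ : ℝ → Fin 3 → ℂ}
    (h₀ : ∀ θ, HasDerivAt Y₀ (S.coeff₀ θ (Y₀ θ)) θ)
    (h₁ : ∀ θ, HasDerivAt Y₁ (S.coeff₀ θ (Y₁ θ) + S.coeff₁ θ (Y₀ θ)) θ) :
    ∃ E : ℂ → ℝ → Fin 3 → ℂ,
      (∀ z, ‖z‖ < 1 → S.monodromy z (Y₀ 0 + z • Y₁ 0) = Y₀ 1 + z • Y₁ 1 + z ^ 2 • E z 1) ∧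
      (∀ z, ‖z‖ < 1 → ContDiffAt ℂ 1 (fun z => E z 1) z) ∧ E 0 0 = 0 ∧
      ∀ θ ∈ Icc (0 : ℝ) 1, HasDerivAt (E 0) (S.coeff₀ θ (E 0 θ) + S.coeff₁ θ (Y₁ θ)) θ := by
  obtain ⟨β, hβ₀, hβ₁⟩ := S.exists_norm_coeff_le
  have c₁ : Continuous Y₁ := continuous_iff_continuousAt.2 fun θ => (h₁ θ).continuousAt
  have cc := S.continuous_coeff₁
  -- Only `θ ∈ [0, 1]` matters; the forcing is frozen outside to make it bounded.
  set clamp : ℝ → ℝ := fun θ => max 0 (min θ 1) with hclamp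
  have hcl : ∀ θ, clamp θ ∈ Icc (0 : ℝ) 1 := fun θ =>
    ⟨le_max_left _ _, max_le zero_le_one (min_le_right _ _)⟩
  have hcl' : ∀ θ ∈ Icc (0 : ℝ) 1, clamp θ = θ := fun θ hθ => by
    simp only [hclamp, min_eq_left hθ.2, max_eq_right hθ.1]
  have cf : Continuous fun θ => S.coeff₁ θ (Y₁ θ) := cc.clm_apply c₁
  obtain ⟨η, hη⟩ := isCompact_Icc.exists_bound_of_continuousOn (cf.continuousOn (s := Icc 0 1))
  obtain ⟨E, hE, hEs⟩ := exists_linear_ode_solution S.continuous_coeff₀ S.continuous_coeff₁ hβ₀ hβ₁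
    (h := fun θ => S.coeff₁ (clamp θ) (Y₁ (clamp θ))) (cf.comp (by fun_prop))
    (fun θ => hη _ (hcl θ)) 0 1
  refine ⟨E, fun z hz => ?_, fun z hz => hEs 1 z hz, (hE 0 (by simp)).1, fun θ hθ => ?_⟩
  · have h := apply_one_of_hasDerivAt_Icc (S := S) (z := z)
      (y := fun θ => Y₀ θ + z • Y₁ θ + z ^ 2 • E z θ) fun θ hθ => by
        refine (((h₀ θ).add ((h₁ θ).const_smul z)).add
          (((hE z hz).2 θ).const_smul (z ^ 2))).congr_deriv ?_
        simp only [hcl' θ hθ, add_apply, smul_apply, map_add,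
          map_smul, smul_add, smul_smul]
        module
    simpa [(hE z hz).1] using h.symm
  · have := (hE 0 (by simp)).2 θ
    simpa [hcl' θ hθ] using this

lemma hasEigenvalue_iff_det (A : Module.End ℂ (Fin 3 → ℂ)) (μ : ℂ) :
    A.HasEigenvalue μ ↔ (LinearMap.toMatrix' A - μ • (1 : Matrix (Fin 3) (Fin 3) ℂ)).det = 0 := by
  rw [← Matrix.exists_mulVec_eq_zero_iff]
  have key : ∀ v, (LinearMap.toMatrix' A - μ • (1 : Matrix (Fin 3) (Fin 3) ℂ)).mulVec v = 0 ↔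
      A v = μ • v := fun v => by
    rw [Matrix.sub_mulVec, Matrix.smul_mulVec, Matrix.one_mulVec, LinearMap.toMatrix'_mulVec,
      sub_eq_zero]
  constructor
  · intro h
    obtain ⟨v, hv⟩ := h.exists_hasEigenvector
    exact ⟨v, hv.2, (key v).2 hv.apply_eq_smul⟩
  · rintro ⟨v, hv, h⟩
    exact Module.End.hasEigenvalue_of_hasEigenvector
      ⟨Module.End.mem_eigenspace_iff.2 ((key v).1 h), hv⟩

end Expansion

end AdjointSystem

/-! ### Modulations of a wave as approximate solutions -/

section Modulation

variable {k a E c M P dk dM dP da dE dc : ℝ} {φ X X₁ X₂ : ℝ → ℝ}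

/-- A variation of the wave solves `k 𝓛 X = k (dE - dc (φ - k² φ''))`, here in divergence form. -/
lemma IsVariation.hessian_eq (hw : IsWaveTrain k a E c φ)
    (hX : IsVariation k a c φ M P dk dM dP da dE dc X X₁ X₂) (θ : ℝ) :
    k ^ 3 * ((c - φ θ) * X₂ θ - deriv φ θ * X₁ θ) = hw.system.q θ * X θ - k * dE
      + k * dc * (φ θ - k ^ 2 * deriv (deriv φ) θ) := by
  have hu : c - φ θ ≠ 0 := (sub_pos.2 (hw.lt_speed θ)).ne'
  have e1 := hX.profile θ
  have e2 := hX.quadrature θ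
  have e3 := hw.profile_deriv θ
  rw [hw.system_q]
  have e4 : k ^ 2 * ((c - φ θ) * X₂ θ - deriv φ θ * X₁ θ) =
      (c - 2 * φ θ) * X θ + a / (c - φ θ) ^ 2 * (dc - X θ) - dE := by
    have : k ^ 2 * ((c - φ θ) * X₂ θ - deriv φ θ * X₁ θ) =
      (c - φ θ) * (k ^ 2 * X₂ θ) - k ^ 2 * deriv φ θ * X₁ θ := by ring
    rw [this, e1, e2]
    field_simp
    ring
  rw [← e3] at e4
  linear_combination k * e4

lemma IsVariation.continuous (hX : IsVariation k a c φ M P dk dM dP da dE dc X X₁ X₂) :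
    Continuous X :=
  continuous_iff_continuousAt.2 fun θ => (hX.hasDerivAt θ).continuousAt

lemma IsVariation.continuous₁ (hX : IsVariation k a c φ M P dk dM dP da dE dc X X₁ X₂) :
    Continuous X₁ :=
  continuous_iff_continuousAt.2 fun θ => (hX.hasDerivAt₁ θ).continuousAt

lemma IsVariation.hasDerivAt_integral (hX : IsVariation k a c φ M P dk dM dP da dE dc X X₁ X₂)
    (θ : ℝ) : HasDerivAt (fun t => ∫ s in (0 : ℝ)..t, X s) (X θ) θ :=
  (hX.continuous.integral_hasStrictDerivAt 0 θ).hasDerivAt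

/-- Each variation of the wave gives initial data `y₀ + z y₁` on which the monodromy map is the identity
up to `O(z)`. The leading term `z d` is parallel to the tangent `(ζ₁, ζ₂)` of the wave in the last two
components; the transverse component `v 1 * ζ₂ - v 2 * ζ₁` vanishes for `v = d` and is therefore of second
order, with the coefficient given by the remainder `e`. Likewise for `v = y₀`, so that this component of
the initial data is of first order. -/
theorem IsVariation.exists_monodromy_expansion (hw : IsWaveTrain k a E c φ)
    (hX : IsVariation k a c φ M P dk dM dP da dE dc X X₁ X₂) {ζ₁ ζ₂ : ℝ} (hζ₁ : ζ₁ = deriv φ 0)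
    (hζ₂ : ζ₂ = k ^ 3 * (c - φ 0) * deriv (deriv φ) 0) :
    ∃ (y₀ y₁ d : Fin 3 → ℂ) (e : ℂ → Fin 3 → ℂ),
      (∀ z, ‖z‖ < 1 → hw.system.monodromy z (y₀ + z • y₁) = y₀ + z • (y₁ + d) + z ^ 2 • e z) ∧
      (∀ z, ‖z‖ < 1 → ContDiffAt ℂ 1 e z) ∧
      y₀ = ![((k * (dE - dc * φ 0) : ℝ) : ℂ), ((-(k * dc * ζ₁) : ℝ) : ℂ),
        ((-(k * dc * ζ₂) : ℝ) : ℂ)] ∧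
      d = ![((-(dM + dk / k * (φ 0 - M)) : ℝ) : ℂ), ((-(dk / k * ζ₁) : ℝ) : ℂ),
        ((-(dk / k * ζ₂) : ℝ) : ℂ)] ∧
      y₁ 0 = 0 ∧
      y₁ 1 * ζ₂ - y₁ 2 * ζ₁ = ((k * ((c - φ 0) * dE - da
        + dc * (E + φ 0 ^ 2 / 2 + k ^ 2 * ζ₁ ^ 2 / 2)) : ℝ) : ℂ) ∧
      e 0 1 * ζ₂ - e 0 2 * ζ₁ = ((φ 0 * dM - dP
        + dk / k * (φ 0 ^ 2 / 2 + k ^ 2 * ζ₁ ^ 2 / 2 - M * φ 0 + P) : ℝ) : ℂ) := by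
  have hk := hw.freq_pos.ne'
  have hu : ∀ θ, c - φ θ ≠ 0 := fun θ => (sub_pos.2 (hw.lt_speed θ)).ne'
  have s1 := AdjointSystem.contDiff_deriv hw.smooth
  have s2 := AdjointSystem.contDiff_deriv s1
  have d0 := AdjointSystem.hasDerivAt_of_contDiff hw.smooth
  have d1 := AdjointSystem.hasDerivAt_of_contDiff s1
  have cφ := hw.smooth.continuous
  have cφ1 := s1.continuous
  have cX := hX.continuous
  have cX1 := hX.continuous₁
  set I : ℝ → ℝ := fun t => ∫ s in (0 : ℝ)..t, X s with hI
  have dI : ∀ θ, HasDerivAt I (X θ) θ := hX.hasDerivAt_integral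
  set Y₀ : ℝ → Fin 3 → ℂ := fun θ => ![((k * (dE - dc * φ θ) : ℝ) : ℂ),
    ((-(k * dc * deriv φ θ) : ℝ) : ℂ),
    ((-(k * dc * (k ^ 3 * (c - φ θ) * deriv (deriv φ) θ)) : ℝ) : ℂ)] with hY₀
  set Y₁ : ℝ → Fin 3 → ℂ := fun θ => ![((-I θ : ℝ) : ℂ), ((-X θ : ℝ) : ℂ),
    ((-(k ^ 3 * (c - φ θ) * X₁ θ + k ^ 3 * dc * deriv φ θ) : ℝ) : ℂ)] with hY₁
  have h₀ : ∀ θ, HasDerivAt Y₀ (hw.system.coeff₀ θ (Y₀ θ)) θ := by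
    have h1 := (AdjointSystem.isSolution_zero_const (S := hw.system) ((k * dE : ℝ) : ℂ)).add
      (hw.isSolution_profile.const_smul ((-(k * dc) : ℝ) : ℂ))
    intro θ
    have h2 := AdjointSystem.isSolution_iff.1 h1 θ
    have h3 : Y₀ = (fun _ => ![((k * dE : ℝ) : ℂ), 0, 0]) + ((-(k * dc) : ℝ) : ℂ) • fun θ =>
        ![((φ θ : ℝ) : ℂ), ((deriv φ θ : ℝ) : ℂ),
          ((k ^ 3 * (c - φ θ) * deriv (deriv φ) θ : ℝ) : ℂ)] := by
      ext θ i
      fin_cases i <;> simp [hY₀]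
      ring
    rw [h3]
    simpa using h2
  have h₁ : ∀ θ, HasDerivAt Y₁ (hw.system.coeff₀ θ (Y₁ θ) + hw.system.coeff₁ θ (Y₀ θ)) θ := by
    intro θ
    rw [AdjointSystem.coeff₀_apply, AdjointSystem.coeff₁_apply, hasDerivAt_pi]
    intro i
    fin_cases i
    · refine (dI θ).neg.ofReal_comp.congr_deriv ?_
      simp [hY₁]
    · refine (hX.hasDerivAt θ).neg.ofReal_comp.congr_deriv ?_
      have : -X₁ θ = hw.system.ρ θ / hw.system.k ^ 2 *
          -(k ^ 3 * (c - φ θ) * X₁ θ + k ^ 3 * dc * deriv φ θ)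
          + -(hw.system.ρ θ * -(k * dc * deriv φ θ)) := by
        rw [hw.system_ρ, hw.system_k]
        have := hu θ
        field_simp
        ring
      rw [this]
      simp [hY₁, hY₀]
    · refine (((((d0 θ).const_sub c).const_mul (k ^ 3)).mul (hX.hasDerivAt₁ θ)).add
        ((d1 θ).const_mul (k ^ 3 * dc))).neg.ofReal_comp.congr_deriv ?_
      have : -(k ^ 3 * -deriv φ θ * X₁ θ + k ^ 3 * (c - φ θ) * X₂ θ
          + k ^ 3 * dc * deriv (deriv φ) θ) =
          hw.system.q θ * -X θ + k * (dE - dc * φ θ) := by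
        linear_combination -hX.hessian_eq hw θ
      rw [this]
      simp [hY₁, hY₀]
  obtain ⟨R, hR, hRs, hR0, hRd⟩ := AdjointSystem.exists_second_order_remainder h₀ h₁
  have p0 : φ 1 = φ 0 := by simpa using hw.periodic 0
  have p1 : deriv φ 1 = deriv φ 0 := by simpa using periodic_deriv hw.periodic 0
  have p2 : deriv (deriv φ) 1 = deriv (deriv φ) 0 := by
    simpa using periodic_deriv (periodic_deriv hw.periodic) 0
  have hX1 : X 1 = X 0 + dk / k * deriv φ 0 := by simpa using hX.shift 0
  have hX₁1 : X₁ 1 = X₁ 0 + dk / k * deriv (deriv φ) 0 := by simpa using hX.shift₁ 0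
  have hI0 : I 0 = 0 := by simp [hI]
  have hI1 : I 1 = dM + dk / k * (φ 0 - M) := hX.mass
  refine ⟨Y₀ 0, Y₁ 0, Y₁ 1 - Y₁ 0, fun z => R z 1, fun z hz => ?_, hRs, ?_, ?_, ?_, ?_, ?_⟩
  · rw [hR z hz, add_sub_cancel]
    simp [hY₀, p0, p1, p2]
  · simp [hY₀, hζ₁, hζ₂]
  · ext i
    fin_cases i
    · simp [hY₁, hI0, hI1]
    · simp [hY₁, hX1, hζ₁]
    · simp [hY₁, p0, p1, hX₁1, hζ₂]
      ring
  · simp [hY₁, hI0]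
  · have e1 := hX.quadrature 0
    have e2 := hw.profile_deriv 0
    have e3 := hw.quadrature_deriv 0
    have hu0 := hu 0
    have key : -X 0 * ζ₂ - -(k ^ 3 * (c - φ 0) * X₁ 0 + k ^ 3 * dc * deriv φ 0) * ζ₁ =
        k * ((c - φ 0) * dE - da + dc * (E + φ 0 ^ 2 / 2 + k ^ 2 * ζ₁ ^ 2 / 2)) := by
      rw [hζ₁, hζ₂]
      field_simp at e1 e2 e3
      apply mul_left_cancel₀ hu0
      linear_combination k * e1 + k * X 0 * e2 + k * dc * e3 / 2
    rw [← key]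
    simp [hY₁]
  · set Q : ℝ → ℝ := fun t => ∫ s in (0 : ℝ)..t, (φ s * X s + k ^ 2 * deriv φ s * X₁ s) with hQ
    have dQ : ∀ θ, HasDerivAt Q (φ θ * X θ + k ^ 2 * deriv φ θ * X₁ θ) θ := fun θ =>
      (Continuous.integral_hasStrictDerivAt (by fun_prop) 0 θ).hasDerivAt
    have dG : ∀ θ, HasDerivAt (fun θ => I θ * φ θ + k ^ 2 * (X θ * deriv φ θ) - Q θ)
        (I θ * deriv φ θ + k ^ 2 * (X θ * deriv (deriv φ) θ)) θ := fun θ => by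
      refine (((dI θ).mul (d0 θ)).add
        (((hX.hasDerivAt θ).mul (d1 θ)).const_mul (k ^ 2))).sub (dQ θ) |>.congr_deriv ?_
      ring
    have hZ := AdjointSystem.isSolution_iff_components.1 hw.isSolution_profile
    -- The symplectic product of the remainder with the tangent of the wave.
    have dF : ∀ θ ∈ Icc (0 : ℝ) 1, HasDerivAt (fun θ => R 0 θ 1 *
        ((k ^ 3 * (c - φ θ) * deriv (deriv φ) θ : ℝ) : ℂ) - R 0 θ 2 * ((deriv φ θ : ℝ) : ℂ))
        ((I θ * deriv φ θ + k ^ 2 * (X θ * deriv (deriv φ) θ) : ℝ) : ℂ) θ := fun θ hθ => by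
      have r1 := hasDerivAt_pi.1 (hRd θ hθ)
      have r11 := r1 1
      have r12 := r1 2
      obtain ⟨-, z1, z2⟩ := hZ θ
      refine ((r11.mul z2).sub (r12.mul z1)).congr_deriv ?_
      have hρ : (hw.system.ρ θ : ℂ) * ((k ^ 3 * (c - φ θ) * deriv (deriv φ) θ : ℝ) : ℂ) =
          ((k ^ 2 * deriv (deriv φ) θ : ℝ) : ℂ) := by
        rw [← Complex.ofReal_mul, hw.system_ρ]
        congr 1
        have := hu θ
        field_simp
      rw [AdjointSystem.coeff₀_apply, AdjointSystem.coeff₁_apply]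
      simp [hY₁] at hρ ⊢
      linear_combination (X θ : ℂ) * hρ
    have hconst := constant_of_has_deriv_right_zero (a := 0) (b := 1)
      (f := fun θ => (R 0 θ 1 * ((k ^ 3 * (c - φ θ) * deriv (deriv φ) θ : ℝ) : ℂ)
        - R 0 θ 2 * ((deriv φ θ : ℝ) : ℂ))
        - ((I θ * φ θ + k ^ 2 * (X θ * deriv φ θ) - Q θ : ℝ) : ℂ))
      (fun θ hθ => ((dF θ hθ).sub (dG θ).ofReal_comp).continuousAt.continuousWithinAt)
      (fun θ hθ => by
        have := ((dF θ (Ico_subset_Icc_self hθ)).sub (dG θ).ofReal_comp).hasDerivWithinAt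
          (s := Ici θ)
        rwa [sub_self] at this) 1 (right_mem_Icc.2 zero_le_one)
    have hQ0 : Q 0 = 0 := by simp [hQ]
    have hQ1 : Q 1 = dP + dk / k * (1 / 2 * (φ 0 ^ 2 + k ^ 2 * deriv φ 0 ^ 2) - P) := hX.momentum
    rw [hR0, p0, p1, p2, ← hζ₁, ← hζ₂, hQ0, hQ1, hI0, hI1, hX1, ← hζ₁, sub_eq_iff_eq_add] at hconst
    rw [hconst]
    simp
    ring

end Modulation

section

variable {U : Set Par} {γ : Par → Par} {Φ : Par → ℝ → ℝ}

/-- A variation that leaves `a`, `E` and `c` unchanged is a multiple of the tangent `φ'` of the wave. -/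
lemma IsVariation.eq_smul_deriv {k a E c M P dk dM dP : ℝ} {φ X X₁ X₂ : ℝ → ℝ}
    (hw : IsWaveTrain k a E c φ) (hX : IsVariation k a c φ M P dk dM dP 0 0 0 X X₁ X₂) :
    ∃ κ : ℝ, ∀ θ, X θ = κ * deriv φ θ ∧ X₁ θ = κ * deriv (deriv φ) θ := by
  have hk := hw.freq_pos.ne'
  have hu : ∀ θ, c - φ θ ≠ 0 := fun θ => (sub_pos.2 (hw.lt_speed θ)).ne'
  have d0 := AdjointSystem.hasDerivAt_of_contDiff hw.smooth
  have hcross : deriv φ 0 * X₁ 0 = deriv (deriv φ) 0 * X 0 := by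
    have e1 := hX.quadrature 0
    have e2 := hw.profile_deriv 0
    have hu0 := hu 0
    have h2 : k ^ 2 * (deriv φ 0 * X₁ 0 - deriv (deriv φ) 0 * X 0) = 0 := by
      field_simp at e1 e2
      apply mul_left_cancel₀ (pow_ne_zero 2 hu0)
      linear_combination e1 + X 0 * e2
    have := (mul_eq_zero.1 h2).resolve_left (pow_ne_zero 2 hk)
    linarith
  obtain ⟨κ, h0, h1⟩ : ∃ κ : ℝ, X 0 = κ * deriv φ 0 ∧ X₁ 0 = κ * deriv (deriv φ) 0 := by
    rcases hw.deriv_ne_zero with h | h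
    · refine ⟨X 0 / deriv φ 0, by field_simp, ?_⟩
      field_simp
      linarith
    · refine ⟨X₁ 0 / deriv (deriv φ) 0, ?_, by field_simp⟩
      field_simp
      linarith
  -- Both `X` and `φ'` are derivatives of solutions at zero frequency.
  have hs : hw.system.IsSolution 0 0 fun θ => ![((∫ s in (0 : ℝ)..θ, X s : ℝ) : ℂ), ((X θ : ℝ) : ℂ),
      ((k ^ 3 * (c - φ θ) * X₁ θ : ℝ) : ℂ)] := by
    refine AdjointSystem.isSolution_zero_of_real hX.hasDerivAt_integral (fun θ => ?_) fun θ => ?_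
    · refine (hX.hasDerivAt θ).congr_deriv ?_
      have := hu θ
      rw [hw.system_ρ, hw.system_k]
      field_simp
    · refine ((((d0 θ).const_sub c).const_mul (k ^ 3)).mul (hX.hasDerivAt₁ θ)).congr_deriv ?_
      linear_combination hX.hessian_eq hw θ
  have hφ := (hw.isSolution_profile.const_smul (κ : ℂ)).add
    (AdjointSystem.isSolution_zero_const (S := hw.system) (-(κ * φ 0 : ℂ)))
  rw [smul_zero, add_zero] at hφ
  have heq := hs.unique hφ (t₀ := 0) (by
    ext i
    fin_cases i
    · simp
    · simp [h0]
    · simp [h1]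
      ring)
  refine ⟨κ, fun θ => ⟨?_, ?_⟩⟩
  · have h := congrFun (congrFun heq θ) 1
    simp at h
    exact_mod_cast h
  · have h := congrFun (congrFun heq θ) 2
    simp at h
    have h' : k ^ 3 * (c - φ θ) * X₁ θ = κ * (k ^ 3 * (c - φ θ) * deriv (deriv φ) θ) := by
      exact_mod_cast h
    have := hu θ
    apply mul_left_cancel₀ (mul_ne_zero (pow_ne_zero 3 hk) this)
    linear_combination h'

/-- The frequency, the mass and the momentum are local coordinates, so that a wave is determined to first
order by its constants `a`, `E`, `c`. -/
theorem IsWaveManifold.det_whithamMatrix_add_speed_ne_zero (h : IsWaveManifold U γ Φ) {q : Par}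
    (hq : q ∈ U) : (whithamMatrix γ Φ q + Matrix.scalar (Fin 3) (γ q 2)).det ≠ 0 := by
  rw [Ne, ← Matrix.exists_mulVec_eq_zero_iff]
  rintro ⟨e, he0, he⟩
  rw [h.whithamMatrix_add_speed_mulVec hq] at he
  have hw := h.wave q hq
  have hk := hw.freq_pos.ne'
  have i0 := congrFun he 0
  have i1 := congrFun he 1
  have i2 := congrFun he 2
  simp only [Matrix.cons_val, Pi.zero_apply] at i0 i1 i2
  have hc : fderiv ℝ γ q e 2 = 0 := (mul_eq_zero.1 (neg_eq_zero.1 i0)).resolve_left hk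
  rw [hc] at i1 i2
  have hE : fderiv ℝ γ q e 1 = 0 := by linarith
  rw [hE] at i2
  have ha : fderiv ℝ γ q e 0 = 0 := by linarith
  obtain ⟨X, X₁, X₂, hX⟩ := exists_variation h hq e
  rw [ha, hE, hc] at hX
  obtain ⟨κ, hκ⟩ := hX.eq_smul_deriv hw
  have p1 := periodic_deriv hw.periodic
  have p2 := periodic_deriv p1
  have e0 : e 0 = 0 := by
    have s0 := hX.shift 0
    have s1 := hX.shift₁ 0
    rw [(hκ _).1, (hκ _).1, p1] at s0
    rw [(hκ _).2, (hκ _).2, p2] at s1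
    rcases hw.deriv_ne_zero with hne | hne
    · have : e 0 / q 0 * deriv (Φ q) 0 = 0 := by linarith
      simpa [hk, hne] using this
    · have : e 0 / q 0 * deriv (deriv (Φ q)) 0 = 0 := by linarith
      simpa [hk, hne] using this
  have hd1 := AdjointSystem.contDiff_deriv hw.smooth
  have c0 := hw.smooth.continuous
  have c1 := hd1.continuous
  have e1 : e 1 = 0 := by
    have hm := hX.mass
    simp only [fun θ => (hκ θ).1, intervalIntegral.integral_const_mul] at hm
    rw [intervalIntegral.integral_eq_sub_of_hasDerivAt
      (fun θ _ => AdjointSystem.hasDerivAt_of_contDiff hw.smooth θ) (c1.intervalIntegrable _ _),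
      show Φ q 1 = Φ q 0 by simpa using hw.periodic 0, e0, zero_div, zero_mul] at hm
    linarith
  have e2 : e 2 = 0 := by
    have hm := hX.momentum
    have hd : ∀ θ ∈ uIcc (0 : ℝ) 1, HasDerivAt
        (fun θ => κ * ((1 / 2) * (Φ q θ ^ 2 + q 0 ^ 2 * deriv (Φ q) θ ^ 2)))
        (Φ q θ * X θ + q 0 ^ 2 * deriv (Φ q) θ * X₁ θ) θ := fun θ _ => by
      refine ((((AdjointSystem.hasDerivAt_of_contDiff hw.smooth θ).fun_pow 2).add
        (((AdjointSystem.hasDerivAt_of_contDiff hd1 θ).fun_pow 2).const_mul (q 0 ^ 2))).const_mul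
        (1 / 2)).const_mul κ |>.congr_deriv ?_
      rw [(hκ θ).1, (hκ θ).2]
      simp only [Nat.cast_ofNat]
      ring
    have cX := hX.continuous
    have cX₁ := hX.continuous₁
    rw [intervalIntegral.integral_eq_sub_of_hasDerivAt hd
      (Continuous.intervalIntegrable (by fun_prop) _ _),
      show Φ q 1 = Φ q 0 by simpa using hw.periodic 0,
      show deriv (Φ q) 1 = deriv (Φ q) 0 by simpa using p1 0, e0, zero_div, zero_mul] at hm
    linarith
  apply he0
  ext i
  fin_cases i
  · exact e0
  · exact e1
  · exact e2

end

/-! ### The dispersion relation at low frequency -/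

section Dispersion

/-- Row and column operations that split off powers of `z` from a determinant. -/
lemma det_mul_det_eq {A G V R T : Matrix (Fin 3) (Fin 3) ℂ} {z : ℂ} (hz : z ≠ 0)
    (hR : G * (A * V) = Matrix.diagonal ![z, z ^ 2, z] * R)
    (hT : G * V = Matrix.diagonal ![1, z, 1] * T) : A.det * T.det = z ^ 3 * R.det := by
  have h1 := congrArg Matrix.det hR
  have h2 := congrArg Matrix.det hT
  simp only [Matrix.det_mul, Matrix.det_diagonal, Fin.prod_univ_three, Matrix.cons_val] at h1 h2
  apply mul_left_cancel₀ hz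
  linear_combination h1 - A.det * h2

lemma contDiffAt_det {E : Type*} [NormedAddCommGroup E] [NormedSpace ℂ E]
    {B : E → Matrix (Fin 3) (Fin 3) ℂ} {x : E} (hB : ∀ i j, ContDiffAt ℂ 1 (fun y => B y i j) x) :
    ContDiffAt ℂ 1 (fun y => (B y).det) x := by
  simp only [Matrix.det_apply]
  exact ContDiffAt.sum fun σ _ => (contDiffAt_prod fun i _ => hB _ _).const_smul _

variable {U : Set Par} {γ : Par → Par} {Φ : Par → ℝ → ℝ}

/-- The multipliers `1 + z x` that bifurcate from the triple multiplier `1` at `z = 0` are the roots of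
a cubic polynomial in `x` which depends smoothly on `z`. At `z = 0` it is, up to a factor, the
characteristic polynomial of the Whitham matrix: the roots are `x = -1 / (k (μ + c))`, where `μ` is an
eigenvalue of `𝓦`. -/
theorem IsWaveManifold.exists_dispersion_relation (h : IsWaveManifold U γ Φ) {q : Par}
    (hq : q ∈ U) : ∃ (p : ℂ × ℂ → ℂ) (C : ℂ) (r R : ℝ), C ≠ 0 ∧ 0 < r ∧
      (∀ z x, ‖z‖ < r → ContDiffAt ℂ 1 p (z, x)) ∧
      (∀ z x, z ≠ 0 → ‖z‖ < r →
        (((h.wave q hq).system.monodromy z).HasEigenvalue (1 + z * x) ↔ p (z, x) = 0)) ∧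
      (∀ z x, ‖z‖ < r → p (z, x) = 0 → ‖x‖ ≤ R) ∧
      ∀ x, p (0, x) = C * (1 + (x * q 0) •
        (whithamMatrix γ Φ q + Matrix.scalar (Fin 3) (γ q 2)).map Complex.ofReal).det := by
  have hw := h.wave q hq
  have hk := hw.freq_pos.ne'
  set N := whithamMatrix γ Φ q + Matrix.scalar (Fin 3) (γ q 2) with hN
  obtain ⟨ζ₁, hζ₁⟩ : ∃ ζ₁, ζ₁ = deriv (Φ q) 0 := ⟨_, rfl⟩
  obtain ⟨ζ₂, hζ₂⟩ : ∃ ζ₂, ζ₂ = q 0 ^ 3 * (γ q 2 - Φ q 0) * deriv (deriv (Φ q)) 0 := ⟨_, rfl⟩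
  have hζ : 0 < ζ₁ ^ 2 + ζ₂ ^ 2 := by rw [hζ₁, hζ₂]; exact hw.normSq_pos
  choose X X₁ X₂ hX using fun j : Fin 3 => exists_variation h hq (Pi.single j 1)
  choose y₀ y₁ d e hM he hy₀ hd hy₁ hω₁ hωe using fun j =>
    (hX j).exists_monodromy_expansion hw hζ₁ hζ₂
  set L : Matrix (Fin 3) (Fin 3) ℝ := !![(q 1 - Φ q 0) / q 0, -1, 0;
    (Φ q 0 ^ 2 / 2 + q 0 ^ 2 * ζ₁ ^ 2 / 2 - q 1 * Φ q 0 + q 2) / q 0, Φ q 0, -1;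
    -(ζ₁ ^ 2 + ζ₂ ^ 2) / q 0, 0, 0] with hL
  have hLdet : L.det ≠ 0 := by
    rw [hL, Matrix.det_fin_three]
    simp only [Matrix.of_apply, Matrix.cons_val', Matrix.cons_val]
    have : (ζ₁ ^ 2 + ζ₂ ^ 2) / q 0 ≠ 0 := div_ne_zero hζ.ne' hk
    intro h0
    apply this
    linear_combination -h0
  have hNdet : N.det ≠ 0 := h.det_whithamMatrix_add_speed_ne_zero hq
  set G : Matrix (Fin 3) (Fin 3) ℂ := !![1, 0, 0; 0, ζ₂, -ζ₁; 0, ζ₁, ζ₂] with hG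
  set S : ℂ → Matrix (Fin 3) (Fin 3) ℂ := fun z => Matrix.of fun i j =>
    (![d j 0 + z * e j z 0, e j z 1 * ζ₂ - e j z 2 * ζ₁,
      (d j 1 + z * e j z 1) * ζ₁ + (d j 2 + z * e j z 2) * ζ₂] : Fin 3 → ℂ) i with hS
  set T : ℂ → Matrix (Fin 3) (Fin 3) ℂ := fun z => Matrix.of fun i j =>
    (![y₀ j 0, y₁ j 1 * ζ₂ - y₁ j 2 * ζ₁,
      (y₀ j 1 + z * y₁ j 1) * ζ₁ + (y₀ j 2 + z * y₁ j 2) * ζ₂] : Fin 3 → ℂ) i with hT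
  have hecomp : ∀ j i z, ‖z‖ < 1 → ContDiffAt ℂ 1 (fun z => e j z i) z := fun j i z hz =>
    contDiffAt_pi.1 (he j z hz) i
  have hS1 : ∀ z, ‖z‖ < 1 → ∀ i j, ContDiffAt ℂ 1 (fun z => S z i j) z := by
    intro z hz i j
    have c0 := hecomp j 0 z hz
    have c1 := hecomp j 1 z hz
    have c2 := hecomp j 2 z hz
    fin_cases i
    · simp [hS]; fun_prop
    · simp [hS]; fun_prop
    · simp [hS]; fun_prop
  have hT1 : ∀ z, ∀ i j, ContDiffAt ℂ 1 (fun z => T z i j) z := by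
    intro z i j
    fin_cases i
    · simp [hT]; fun_prop
    · simp [hT]; fun_prop
    · simp [hT]; fun_prop
  have hS0 : S 0 = L.map Complex.ofReal := by
    ext i j
    have h1 : L i j = L.mulVec (Pi.single j 1) i := by simp
    rw [Matrix.map_apply, h1, Matrix.mulVec, dotProduct, Fin.sum_univ_three]
    fin_cases i
    · simp [hS, hL, hd]
      ring
    · simp [hS, hL, hωe]
      ring
    · simp [hS, hL, hd]
      ring
  have hT0 : T 0 = (-(q 0) • (L * N)).map Complex.ofReal := by
    ext i j
    have h1 : (-(q 0) • (L * N)) i j = -(q 0) * L.mulVec (N.mulVec (Pi.single j 1)) i := by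
      rw [Matrix.mulVec_mulVec]
      simp
    rw [Matrix.map_apply, h1, h.whithamMatrix_add_speed_mulVec hq, Matrix.mulVec, dotProduct,
      Fin.sum_univ_three]
    have hk' : (q 0 : ℂ) ≠ 0 := by exact_mod_cast hk
    fin_cases i
    · simp [hT, hL, hy₀]
      field_simp
      ring
    · simp [hT, hL, hω₁]
      field_simp
      ring
    · simp [hT, hL, hy₀]
      field_simp
      ring
  have hT0det : (T 0).det ≠ 0 := by
    rw [hT0]
    have : ((-(q 0) • (L * N)).map Complex.ofReal).det = (((-(q 0) • (L * N)).det : ℝ) : ℂ) :=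
      (RingHom.map_det Complex.ofRealHom _).symm
    rw [this, Matrix.det_smul, Matrix.det_mul]
    have h1 : (-(q 0)) ^ Fintype.card (Fin 3) * (L.det * N.det) ≠ 0 :=
      mul_ne_zero (pow_ne_zero _ (neg_ne_zero.2 hk)) (mul_ne_zero hLdet hNdet)
    exact_mod_cast h1
  -- Bound on the roots: reverse the polynomial in `x`.
  obtain ⟨δ, hδ, hδ1, hrev⟩ : ∃ δ : ℝ, 0 < δ ∧ δ < 1 ∧ ∀ z w : ℂ, ‖z‖ < δ → ‖w‖ < δ →
      (w • S z - T z).det ≠ 0 := by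
    have hc : ContinuousAt (fun v : ℂ × ℂ => (v.2 • S v.1 - T v.1).det) (0, 0) := by
      refine (contDiffAt_det fun i j => ?_).continuousAt
      have c1 := (hS1 0 (by simp) i j).comp ((0, 0) : ℂ × ℂ) (f := Prod.fst) contDiffAt_fst
      have c2 := (hT1 0 i j).comp ((0, 0) : ℂ × ℂ) (f := Prod.fst) contDiffAt_fst
      exact (contDiffAt_snd.mul c1).sub c2
    have hne : (((0, 0) : ℂ × ℂ).2 • S ((0, 0) : ℂ × ℂ).1 - T ((0, 0) : ℂ × ℂ).1).det ≠ 0 := by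
      simp only [zero_smul, zero_sub, Matrix.det_neg]
      exact mul_ne_zero (by simp) hT0det
    obtain ⟨δ, hδ, hball⟩ := Metric.eventually_nhds_iff.1 (hc.eventually_ne hne)
    refine ⟨min δ (1 / 2), by positivity, (min_le_right _ _).trans_lt (by norm_num),
      fun z w hz hw => hball (y := (z, w)) ?_⟩
    rw [dist_eq_norm, Prod.norm_def]
    simpa using ⟨hz.trans_le (min_le_left _ _), hw.trans_le (min_le_left _ _)⟩
  have hTdet : ∀ z, ‖z‖ < δ → (T z).det ≠ 0 := fun z hz h0 => by
    have := hrev z 0 hz (by simpa using hδ)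
    rw [zero_smul, zero_sub, Matrix.det_neg, h0, mul_zero] at this
    exact this rfl
  refine ⟨fun v => (S v.1 - v.2 • T v.1).det, (L.det : ℂ), δ, 2 / δ, by exact_mod_cast hLdet, hδ,
    fun z x hz => ?_, fun z x hz0 hz => ?_, fun z x hz hp => ?_, fun x => ?_⟩
  · refine contDiffAt_det fun i j => ?_
    have c1 := (hS1 z (hz.trans hδ1) i j).comp (z, x) (f := Prod.fst) contDiffAt_fst
    have c2 := (hT1 z i j).comp (z, x) (f := Prod.fst) contDiffAt_fst
    exact c1.sub (contDiffAt_snd.mul c2)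
  · set A := LinearMap.toMatrix' (hw.system.monodromy z) - (1 + z * x) •
      (1 : Matrix (Fin 3) (Fin 3) ℂ) with hA
    set V : Matrix (Fin 3) (Fin 3) ℂ := Matrix.of fun i j => y₀ j i + z * y₁ j i with hV
    have hGy₀ : ∀ j, y₀ j 1 * ζ₂ - y₀ j 2 * ζ₁ = 0 := fun j => by
      simp [hy₀]
      ring
    have hGd : ∀ j, d j 1 * ζ₂ - d j 2 * ζ₁ = 0 := fun j => by
      simp [hd]
      ring
    have hAV : ∀ i j, (A * V) i j = z * (d j i + z * e j z i - x * (y₀ j i + z * y₁ j i)) := by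
      intro i j
      have h1 : (A * V) i j = A.mulVec (y₀ j + z • y₁ j) i := rfl
      rw [h1, hA, Matrix.sub_mulVec, LinearMap.toMatrix'_mulVec, hM j z (hz.trans hδ1),
        Matrix.smul_mulVec, Matrix.one_mulVec]
      simp
      ring
    have hdet := det_mul_det_eq (A := A) (G := G) (V := V) (R := S z - x • T z) (T := T z) hz0
      (by
        ext i j
        rw [Matrix.diagonal_mul, Matrix.mul_apply, Fin.sum_univ_three, hAV, hAV, hAV]
        fin_cases i
        · simp [hG, hS, hT, hy₁]
        · simp [hG, hS, hT]
          linear_combination z * hGd j - x * z * hGy₀ j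
        · simp [hG, hS, hT]
          ring)
      (by
        ext i j
        rw [Matrix.diagonal_mul, Matrix.mul_apply, Fin.sum_univ_three]
        fin_cases i
        · simp [hG, hV, hT, hy₁]
        · simp [hG, hV, hT]
          linear_combination hGy₀ j
        · simp [hG, hV, hT]
          ring)
    rw [AdjointSystem.hasEigenvalue_iff_det]
    constructor
    · intro h0
      rw [← hA] at h0
      rw [h0, zero_mul] at hdet
      exact (mul_eq_zero.1 hdet.symm).resolve_left (pow_ne_zero 3 hz0)
    · intro h0
      have h0' : (S z - x • T z).det = 0 := h0
      rw [h0', mul_zero] at hdet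
      exact (mul_eq_zero.1 hdet).resolve_right (hTdet z hz)
  · by_contra! hx
    have hxpos : 0 < ‖x‖ := lt_trans (by positivity) hx
    have hx0 : x ≠ 0 := norm_pos_iff.1 hxpos
    refine hrev z x⁻¹ hz ?_ ?_
    · rw [norm_inv, inv_lt_comm₀ hxpos hδ]
      refine lt_of_le_of_lt ?_ hx
      rw [inv_eq_one_div]
      gcongr
      norm_num
    · have : x⁻¹ • S z - T z = x⁻¹ • (S z - x • T z) := by
        rw [smul_sub, smul_smul, inv_mul_cancel₀ hx0, one_smul]
      rw [this, Matrix.det_smul]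
      have hp' : (S z - x • T z).det = 0 := hp
      rw [hp', mul_zero]
  · have h1 : (L.map Complex.ofReal).det = ((L.det : ℝ) : ℂ) :=
      (RingHom.map_det Complex.ofRealHom _).symm
    simp only [hS0, hT0]
    rw [← h1, ← Matrix.det_mul]
    congr 1
    have h2 : ((-(q 0) • (L * N)).map Complex.ofReal) =
        (-(q 0) : ℂ) • (L.map Complex.ofReal * N.map Complex.ofReal) := by
      have : (L * N).map Complex.ofReal = L.map Complex.ofReal * N.map Complex.ofReal :=
        Matrix.map_mul (f := Complex.ofRealHom)
      rw [← this]
      ext i j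
      simp
    rw [h2, mul_add, mul_one, Matrix.mul_smul, smul_smul, sub_eq_add_neg, ← neg_smul]
    congr 2
    ring

end Dispersion

/-! ### Factorization of the limiting dispersion relation -/

section Factorization

open Polynomial in
lemma det_smul_one_sub_eq_prod {A : Matrix (Fin 3) (Fin 3) ℂ} {μ : Fin 3 → ℂ}
    (hμ : Function.Injective μ) (h : ∀ i, (μ i • (1 : Matrix (Fin 3) (Fin 3) ℂ) - A).det = 0) (t : ℂ) :
    (t • (1 : Matrix (Fin 3) (Fin 3) ℂ) - A).det = ∏ i, (t - μ i) := by
  have heval : ∀ s, A.charpoly.eval s = (s • (1 : Matrix (Fin 3) (Fin 3) ℂ) - A).det := fun s => by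
    rw [Matrix.eval_charpoly, Matrix.scalar_apply, ← Matrix.smul_one_eq_diagonal]
  have hmonic : (∏ i, (X - C (μ i))).Monic := monic_prod_of_monic _ _ fun i _ => monic_X_sub_C _
  have hdeg : (∏ i, (X - C (μ i))).degree = 3 := by
    rw [degree_prod]
    simp
  have hA : A.charpoly.degree = 3 := by simp [Matrix.charpoly_degree_eq_dim]
  have heq : A.charpoly = ∏ i, (X - C (μ i)) := by
    refine eq_of_degree_sub_lt_of_eval_index_eq (s := Finset.univ) (v := μ) hμ.injOn ?_ fun i _ => ?_
    · have := degree_sub_lt_left (p := A.charpoly) (q := ∏ i, (X - C (μ i))) (by rw [hA, hdeg])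
        A.charpoly_monic.ne_zero (by rw [A.charpoly_monic.leadingCoeff, hmonic.leadingCoeff])
      rw [hA] at this
      simpa using this
    · rw [heval, h, eval_prod, eq_comm]
      exact Finset.prod_eq_zero (Finset.mem_univ i) (by simp)
  rw [← heval, heq, eval_prod]
  simp

lemma det_one_add_smul_eq_prod {A : Matrix (Fin 3) (Fin 3) ℂ} {μ : Fin 3 → ℂ} (c : ℂ)
    (h : ∀ t : ℂ, (t • (1 : Matrix (Fin 3) (Fin 3) ℂ) - A).det = ∏ i, (t - μ i)) (s : ℂ) :
    (1 + s • (A + Matrix.scalar (Fin 3) c)).det = ∏ i, (1 + s * (μ i + c)) := by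
  rcases eq_or_ne s 0 with rfl | hs
  · simp
  have h1 : 1 + s • (A + Matrix.scalar (Fin 3) c) =
      (-s) • ((-s⁻¹ - c) • (1 : Matrix (Fin 3) (Fin 3) ℂ) - A) := by
    rw [Matrix.scalar_apply, ← Matrix.smul_one_eq_diagonal, smul_sub, smul_smul, smul_add, smul_smul]
    have : -s * (-s⁻¹ - c) = 1 + s * c := by
      field_simp
      ring
    rw [this]
    module
  rw [h1, Matrix.det_smul, h]
  simp only [Fintype.card_fin, Fin.prod_univ_three]
  field_simp
  ring

lemma hasEigenvalue_toLin'_iff_det {K : Type*} [Field K] (A : Matrix (Fin 3) (Fin 3) K) (μ : K) :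
    Module.End.HasEigenvalue (Matrix.toLin' A) μ ↔
      (μ • (1 : Matrix (Fin 3) (Fin 3) K) - A).det = 0 := by
  rw [← Matrix.exists_mulVec_eq_zero_iff]
  have key : ∀ v, (μ • (1 : Matrix (Fin 3) (Fin 3) K) - A).mulVec v = 0 ↔
      Matrix.toLin' A v = μ • v := fun v => by
    rw [Matrix.sub_mulVec, Matrix.smul_mulVec, Matrix.one_mulVec, Matrix.toLin'_apply, sub_eq_zero,
      eq_comm]
  constructor
  · intro h
    obtain ⟨v, hv⟩ := h.exists_hasEigenvector
    exact ⟨v, hv.2, (key v).2 hv.apply_eq_smul⟩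
  · rintro ⟨v, hv, h⟩
    exact Module.End.hasEigenvalue_of_hasEigenvector
      ⟨Module.End.mem_eigenspace_iff.2 ((key v).1 h), hv⟩

variable {W : Matrix (Fin 3) (Fin 3) ℝ}

lemma det_ofReal_smul_one_sub (t : ℝ) :
    ((t : ℂ) • (1 : Matrix (Fin 3) (Fin 3) ℂ) - W.map Complex.ofReal).det =
      (((t • (1 : Matrix (Fin 3) (Fin 3) ℝ) - W).det : ℝ) : ℂ) := by
  have : (t : ℂ) • (1 : Matrix (Fin 3) (Fin 3) ℂ) - W.map Complex.ofReal =
      (t • (1 : Matrix (Fin 3) (Fin 3) ℝ) - W).map Complex.ofRealHom := by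
    ext i j
    by_cases hij : i = j
    · subst hij; simp
    · simp [hij]
  rw [this]
  exact (RingHom.map_det Complex.ofRealHom _).symm

lemma det_conj_smul_one_sub (t : ℂ) :
    (starRingEnd ℂ t • (1 : Matrix (Fin 3) (Fin 3) ℂ) - W.map Complex.ofReal).det =
      starRingEnd ℂ (t • (1 : Matrix (Fin 3) (Fin 3) ℂ) - W.map Complex.ofReal).det := by
  have : starRingEnd ℂ t • (1 : Matrix (Fin 3) (Fin 3) ℂ) - W.map Complex.ofReal =
      (t • (1 : Matrix (Fin 3) (Fin 3) ℂ) - W.map Complex.ofReal).map (starRingEnd ℂ) := by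
    ext i j
    by_cases hij : i = j
    · subst hij; simp
    · simp [hij]
  rw [this]
  exact (RingHom.map_det (starRingEnd ℂ) _).symm

lemma exists_real_det_eq_zero (W : Matrix (Fin 3) (Fin 3) ℝ) :
    ∃ t : ℝ, (t • (1 : Matrix (Fin 3) (Fin 3) ℝ) - W).det = 0 := by
  have hpos : ∀ A : Matrix (Fin 3) (Fin 3) ℝ,
      ∃ s : ℝ, 0 < (s • (1 : Matrix (Fin 3) (Fin 3) ℝ) - A).det := fun A => by
    have h := A.charpoly.tendsto_atTop_of_leadingCoeff_nonneg
      (by rw [Matrix.charpoly_degree_eq_dim]; simp)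
      (by rw [A.charpoly_monic.leadingCoeff]; exact zero_le_one)
    obtain ⟨s, hs⟩ := (h.eventually_gt_atTop 0).exists
    exact ⟨s, by rwa [Matrix.eval_charpoly, Matrix.scalar_apply, ← Matrix.smul_one_eq_diagonal] at hs⟩
  obtain ⟨s, hs⟩ := hpos (-W)
  obtain ⟨t, ht⟩ := hpos W
  have hcont : Continuous fun t : ℝ => (t • (1 : Matrix (Fin 3) (Fin 3) ℝ) - W).det :=
    Continuous.matrix_det (by fun_prop)
  have hneg : ((-s) • (1 : Matrix (Fin 3) (Fin 3) ℝ) - W).det < 0 := by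
    have : (-s) • (1 : Matrix (Fin 3) (Fin 3) ℝ) - W = -(s • (1 : Matrix (Fin 3) (Fin 3) ℝ) - -W) := by
      module
    rw [this, Matrix.det_neg]
    simpa [pow_succ] using hs
  exact mem_range_of_exists_le_of_exists_ge hcont ⟨-s, hneg.le⟩ ⟨t, ht.le⟩

theorem StrictlyHyperbolic.exists_eigenvalues (h : StrictlyHyperbolic W) :
    ∃ μ : Fin 3 → ℝ, Function.Injective μ ∧
      ∀ t : ℂ, (t • (1 : Matrix (Fin 3) (Fin 3) ℂ) - W.map Complex.ofReal).det = ∏ i, (t - μ i) := by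
  obtain ⟨μ, hμ, h⟩ := h
  refine ⟨μ, hμ, det_smul_one_sub_eq_prod (μ := fun i => (μ i : ℂ))
    (Complex.ofReal_injective.comp hμ) fun i => ?_⟩
  rw [det_ofReal_smul_one_sub, (hasEigenvalue_toLin'_iff_det _ _).1 (h i), Complex.ofReal_zero]

/-- A real cubic polynomial with a nonreal root has three distinct roots. -/
theorem Elliptic.exists_eigenvalues (h : Elliptic W) :
    ∃ μ : Fin 3 → ℂ, Function.Injective μ ∧ 0 < (μ 0).im ∧
      ∀ t : ℂ, (t • (1 : Matrix (Fin 3) (Fin 3) ℂ) - W.map Complex.ofReal).det = ∏ i, (t - μ i) := by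
  obtain ⟨μ, hdet, him⟩ : ∃ μ : ℂ,
      (μ • (1 : Matrix (Fin 3) (Fin 3) ℂ) - W.map Complex.ofReal).det = 0 ∧ 0 < μ.im := by
    obtain ⟨μ, hμ, h⟩ := h
    have h0 := (hasEigenvalue_toLin'_iff_det _ _).1 h
    rcases lt_or_gt_of_ne hμ with hlt | hgt
    · refine ⟨starRingEnd ℂ μ, ?_, by simpa using hlt⟩
      rw [det_conj_smul_one_sub]
      exact (map_eq_zero _).2 h0
    · exact ⟨μ, h0, hgt⟩
  obtain ⟨t, ht⟩ := exists_real_det_eq_zero W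
  have hinj : Function.Injective ![μ, starRingEnd ℂ μ, (t : ℂ)] := by
    intro i j hij
    have := congrArg Complex.im hij
    fin_cases i <;> fin_cases j <;> simp at this ⊢ <;> linarith
  refine ⟨![μ, starRingEnd ℂ μ, (t : ℂ)], hinj, him, det_smul_one_sub_eq_prod hinj fun i => ?_⟩
  fin_cases i
  · exact hdet
  · change (starRingEnd ℂ μ • (1 : Matrix (Fin 3) (Fin 3) ℂ) - W.map Complex.ofReal).det = 0
    rw [det_conj_smul_one_sub, hdet, map_zero]
  · change ((t : ℂ) • (1 : Matrix (Fin 3) (Fin 3) ℂ) - W.map Complex.ofReal).det = 0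
    rw [det_ofReal_smul_one_sub, ht, Complex.ofReal_zero]

/-- The roots of `C ∏ (1 + x κᵢ)` are simple if the `κᵢ` are distinct and nonzero. -/
lemma exists_hasDerivAt_prod {C : ℂ} (hC : C ≠ 0) {κ : Fin 3 → ℂ} (hκ : Function.Injective κ)
    {i : Fin 3} (h0 : κ i ≠ 0) :
    ∃ b, b ≠ 0 ∧ HasDerivAt (fun x => C * ∏ j, (1 + x * κ j)) b (-(κ i)⁻¹) := by
  have hd : ∀ j, HasDerivAt (fun x : ℂ => 1 + x * κ j) (κ j) (-(κ i)⁻¹) := fun j => by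
    simpa using ((hasDerivAt_id (-(κ i)⁻¹)).mul_const (κ j)).const_add 1
  have hp := (HasDerivAt.fun_finsetProd (u := Finset.univ) fun j _ => hd j).const_mul C
  refine ⟨_, ?_, hp⟩
  have hi : 1 + -(κ i)⁻¹ * κ i = 0 := by
    field_simp
    ring
  rw [Finset.sum_eq_single i (fun j _ hj => ?_) (by simp)]
  · refine mul_ne_zero hC (mul_ne_zero (Finset.prod_ne_zero_iff.2 fun j hj => ?_) h0)
    have hne : κ j ≠ κ i := hκ.ne (Finset.ne_of_mem_erase hj)
    intro hz
    apply hne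
    field_simp at hz
    linear_combination -hz
  · rw [Finset.prod_eq_zero (Finset.mem_erase.2 ⟨hj.symm, Finset.mem_univ i⟩) hi, zero_smul]

end Factorization

/-! ### Real roots of the dispersion relation -/

section Hyperbolic

variable {p : ℂ × ℂ → ℂ}

/-- Near a simple root, the root is a Lipschitz function of the parameter. -/
lemma exists_lipschitz_root {x₀ b : ℂ} (hp : ContDiffAt ℂ 1 p (0, x₀)) (hb : b ≠ 0)
    (hd : HasDerivAt (fun x => p (0, x)) b x₀) :
    ∃ K δ : ℝ, 0 < K ∧ 0 < δ ∧ ∀ z z' x x' : ℂ, ‖z‖ < δ → ‖z'‖ < δ → ‖x - x₀‖ < δ → ‖x' - x₀‖ < δ →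
      p (z, x) = 0 → p (z', x') = 0 → ‖x - x'‖ ≤ K * ‖z - z'‖ := by
  have hs := hp.hasStrictFDerivAt one_ne_zero
  set L := fderiv ℂ p (0, x₀)
  have hLb : L (0, 1) = b := by
    have h1 := hs.hasFDerivAt.comp_hasDerivAt (f := fun x : ℂ => ((0 : ℂ), x)) x₀
      ((hasDerivAt_const x₀ (0 : ℂ)).prodMk (hasDerivAt_id x₀))
    exact h1.unique hd
  set α := L (1, 0)
  have hL : ∀ u v : ℂ, L (u, v) = u * α + v * b := fun u v => by
    have : ((u, v) : ℂ × ℂ) = u • (1, 0) + v • (0, 1) := by simp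
    rw [this, map_add, map_smul, map_smul, hLb, smul_eq_mul, smul_eq_mul]
  have hbpos : 0 < ‖b‖ := norm_pos_iff.2 hb
  have hev := hs.isLittleO.bound (half_pos hbpos)
  obtain ⟨δ, hδ, hball⟩ := Metric.eventually_nhds_iff.1 hev
  refine ⟨2 * ‖α‖ / ‖b‖ + 1, δ, by positivity, hδ, fun z z' x x' hz hz' hx hx' h h' => ?_⟩
  have h1 := hball (y := ((z, x), (z', x'))) (by
    rw [dist_eq_norm, Prod.norm_def, Prod.norm_def, Prod.norm_def]
    simpa using ⟨⟨hz, hx⟩, hz', hx'⟩)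
  have h2 : ((z, x) - (z', x') : ℂ × ℂ) = (z - z', x - x') := rfl
  simp only [h, h', sub_self, zero_sub, norm_neg] at h1
  rw [h2, hL, Prod.norm_def] at h1
  have h3 : ‖x - x'‖ * ‖b‖ ≤ ‖(z - z') * α + (x - x') * b‖ + ‖z - z'‖ * ‖α‖ := by
    have := norm_sub_le ((z - z') * α + (x - x') * b) ((z - z') * α)
    rw [add_sub_cancel_left, norm_mul, norm_mul] at this
    exact this
  have h4 : max ‖z - z'‖ ‖x - x'‖ ≤ ‖z - z'‖ + ‖x - x'‖ :=
    max_le (le_add_of_nonneg_right (norm_nonneg _)) (le_add_of_nonneg_left (norm_nonneg _))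
  have h5 : ‖x - x'‖ * ‖b‖ ≤ ‖b‖ / 2 * (‖z - z'‖ + ‖x - x'‖) + ‖z - z'‖ * ‖α‖ :=
    h3.trans (add_le_add_left (h1.trans (mul_le_mul_of_nonneg_left h4 (by positivity))) _)
  have h6 : ‖x - x'‖ * ‖b‖ ≤ ((2 * ‖α‖ / ‖b‖ + 1) * ‖z - z'‖) * ‖b‖ := by
    have : ((2 * ‖α‖ / ‖b‖ + 1) * ‖z - z'‖) * ‖b‖ = 2 * ‖α‖ * ‖z - z'‖ + ‖z - z'‖ * ‖b‖ := by
      field_simp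
    rw [this]
    linarith
  exact le_of_mul_le_mul_right h6 hbpos

/-- Near a simple real root `x₀ ≠ 0`, a multiplier `1 + z x` of modulus one forces `z` to be imaginary: it
is also a multiplier at `-z̄`, with a root that differs from `x` by `O(Re z)`. -/
lemma re_eq_zero_of_root {x₀ : ℝ} (hx₀ : x₀ ≠ 0) {K δ₁ : ℝ} (hK : 0 < K) (hδ₁ : 0 < δ₁)
    (hlip : ∀ z z' x x' : ℂ, ‖z‖ < δ₁ → ‖z'‖ < δ₁ → ‖x - x₀‖ < δ₁ → ‖x' - x₀‖ < δ₁ →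
      p (z, x) = 0 → p (z', x') = 0 → ‖x - x'‖ ≤ K * ‖z - z'‖) :
    ∃ δ > 0, ∀ z x y : ℂ, z ≠ 0 → ‖z‖ < δ → ‖x - x₀‖ < δ → p (z, x) = 0 →
      p (-(starRingEnd ℂ) z, y) = 0 → z * x = -(starRingEnd ℂ) z * y → ‖1 + z * x‖ = 1 → z.re = 0 := by
  set m : ℝ := |x₀| with hm
  have hmpos : 0 < m := abs_pos.2 hx₀
  refine ⟨min (min (δ₁ / 10) (m / 2)) (min (δ₁ / (20 * m ^ 2)) (m / (2 * K))), by positivity,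
    fun z x y hz0 hz hx hp hp' hxy hmod => ?_⟩
  obtain ⟨⟨hz1, hz2⟩, hz3, hz4⟩ : (‖z‖ < δ₁ / 10 ∧ ‖z‖ < m / 2) ∧ ‖z‖ < δ₁ / (20 * m ^ 2) ∧
      ‖z‖ < m / (2 * K) := by
    simpa only [lt_min_iff] using hz
  obtain ⟨⟨hx1, hx2⟩, -⟩ : (‖x - x₀‖ < δ₁ / 10 ∧ ‖x - x₀‖ < m / 2) ∧ _ := by
    simpa only [lt_min_iff] using hx
  have hzpos : 0 < ‖z‖ := norm_pos_iff.2 hz0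
  have hnx₀ : ‖(x₀ : ℂ)‖ = m := by rw [Complex.norm_real, Real.norm_eq_abs]
  have hxu : ‖x‖ ≤ 2 * m := by
    have := norm_sub_norm_le x x₀
    rw [hnx₀] at this
    linarith
  have hxl : m / 2 < ‖x‖ := by
    have := norm_sub_norm_le (x₀ : ℂ) x
    rw [hnx₀, norm_sub_rev] at this
    linarith
  -- `|1 + z x| = 1` makes `Re (z x)` quadratically small.
  have hre : |z.re| * m ≤ ‖z‖ * (2 * m ^ 2 * ‖z‖ + ‖x - x₀‖) := by
    have h1 : 2 * (z * x).re + ‖z * x‖ ^ 2 = 0 := by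
      have h2 : ‖1 + z * x‖ ^ 2 = 1 := by rw [hmod, one_pow]
      rw [← Complex.normSq_eq_norm_sq, Complex.normSq_apply] at h2 ⊢
      simp only [Complex.add_re, Complex.add_im, Complex.one_re, Complex.one_im] at h2
      linear_combination h2
    have h3 : z.re * x₀ = (z * x).re - (z * (x - x₀)).re := by
      rw [mul_sub, Complex.sub_re, Complex.re_mul_ofReal]
      ring
    have h4 : |z.re| * m = |(z * x).re - (z * (x - x₀)).re| := by rw [hm, ← abs_mul, h3]
    rw [h4]
    refine (abs_sub _ _).trans ?_
    have h5 : |(z * x).re| ≤ ‖z‖ * (2 * m ^ 2 * ‖z‖) := by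
      have h6 : (z * x).re = -(‖z * x‖ ^ 2 / 2) := by linarith
      rw [h6, abs_neg, abs_of_nonneg (by positivity), norm_mul]
      have h7 : ‖x‖ ^ 2 ≤ (2 * m) ^ 2 := pow_le_pow_left₀ (norm_nonneg _) hxu 2
      have h8 : (‖z‖ * ‖x‖) ^ 2 ≤ ‖z‖ ^ 2 * (2 * m) ^ 2 := by
        rw [mul_pow]
        gcongr
      nlinarith
    have h9 : |(z * (x - x₀)).re| ≤ ‖z‖ * ‖x - x₀‖ := by
      rw [← norm_mul]
      exact Complex.abs_re_le_norm _
    linarith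
  have hconj : ‖(starRingEnd ℂ) z‖ = ‖z‖ := RCLike.norm_conj z
  have hsum : z - -(starRingEnd ℂ) z = ((2 * z.re : ℝ) : ℂ) := by
    rw [sub_neg_eq_add, Complex.add_conj]
  have hdiff : ((2 * z.re : ℝ) : ℂ) * x = (starRingEnd ℂ) z * (x - y) := by
    rw [← hsum]
    linear_combination hxy
  have hdiffn : 2 * |z.re| * ‖x‖ = ‖z‖ * ‖x - y‖ := by
    have := congrArg norm hdiff
    rwa [norm_mul, norm_mul, hconj, Complex.norm_real, Real.norm_eq_abs, abs_mul, abs_two] at this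
  have hyx : ‖x - y‖ ≤ 8 * m ^ 2 * ‖z‖ + 4 * ‖x - x₀‖ := by
    have h1 : ‖z‖ * ‖x - y‖ ≤ ‖z‖ * (8 * m ^ 2 * ‖z‖ + 4 * ‖x - x₀‖) := by
      rw [← hdiffn]
      have : 2 * |z.re| * ‖x‖ ≤ 2 * |z.re| * (2 * m) := by gcongr
      nlinarith
    exact le_of_mul_le_mul_left h1 hzpos
  have hy : ‖y - x₀‖ < δ₁ := by
    have h1 := norm_add_le (x - x₀) (y - x)
    rw [sub_add_sub_cancel', norm_sub_rev y x] at h1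
    have h2 : 8 * m ^ 2 * ‖z‖ < δ₁ / 2 := by
      rw [lt_div_iff₀ (by positivity)] at hz3
      nlinarith
    linarith
  have h := hlip z (-(starRingEnd ℂ) z) x y (by linarith) (by rw [norm_neg, hconj]; linarith)
    (by linarith) hy hp hp'
  rw [hsum, Complex.norm_real, Real.norm_eq_abs, abs_mul, abs_two] at h
  by_contra hne
  have hrepos : 0 < |z.re| := abs_pos.2 hne
  have h1 : 2 * |z.re| * ‖x‖ ≤ 2 * |z.re| * (K * ‖z‖) := by
    rw [hdiffn]
    nlinarith
  have h2 : ‖x‖ ≤ K * ‖z‖ := le_of_mul_le_mul_left h1 (by positivity)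
  have h3 : K * ‖z‖ < m / 2 := by
    rw [lt_div_iff₀ (by positivity)] at hz4
    linarith
  linarith

/-- For small `z`, the bounded roots of `p (z, ·)` are close to the roots of `p (0, ·)`. -/
lemma exists_near_root {r R δ : ℝ} (hr : 0 < r) (hp : ∀ z x, ‖z‖ < r → ContDiffAt ℂ 1 p (z, x))
    (hR : ∀ z x, ‖z‖ < r → p (z, x) = 0 → ‖x‖ ≤ R) {x₀ : Fin 3 → ℂ}
    (h0 : ∀ x, p (0, x) = 0 → ∃ i, x = x₀ i) (hδ : 0 < δ) :
    ∃ ε > 0, ∀ z x, ‖z‖ < ε → p (z, x) = 0 → ∃ i, ‖x - x₀ i‖ < δ := by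
  set K : Set ℂ := Metric.closedBall 0 R ∩ ⋂ i, {x | δ ≤ ‖x - x₀ i‖} with hKdef
  have hK : IsCompact K := (isCompact_closedBall 0 R).inter_right
    (isClosed_iInter fun i => isClosed_le continuous_const (by fun_prop))
  have hev : ∀ᶠ z : ℂ in nhds 0, ∀ x ∈ K, p (z, x) ≠ 0 := by
    refine hK.eventually_forall_of_forall_eventually fun x hx => ?_
    refine (hp 0 x (by simpa using hr)).continuousAt.eventually_ne fun hpx => ?_
    obtain ⟨i, rfl⟩ := h0 x hpx
    have := mem_iInter.1 hx.2 i
    simp only [mem_ofPred_eq, sub_self, norm_zero] at this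
    linarith
  obtain ⟨ε, hε, hball⟩ := Metric.eventually_nhds_iff.1 hev
  refine ⟨min ε r, lt_min hε hr, fun z x hz hpx => ?_⟩
  by_contra! hfar
  refine hball (y := z) (by simpa using hz.trans_le (min_le_left _ _)) x ⟨?_, ?_⟩ hpx
  · simpa using hR z x (hz.trans_le (min_le_right _ _)) hpx
  · exact mem_iInter.2 fun i => hfar i

end Hyperbolic

/-! ### Complex roots of the dispersion relation -/

section Elliptic

variable {p : ℂ × ℂ → ℂ}

/-- A simple root `x₀` in the upper half-plane gives a `z` with positive real part and a multiplier
`1 + z x = exp (i ξ)` with a small real `ξ`, namely `z ≈ i ξ / x₀`. -/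
lemma exists_unit_multiplier {x₀ b : ℂ} {r : ℝ} (hr : 0 < r) (hp : ContDiffAt ℂ 1 p (0, x₀))
    (hp0 : p (0, x₀) = 0) (hb : b ≠ 0) (hd : HasDerivAt (fun x => p (0, x)) b x₀)
    (him : 0 < x₀.im) :
    ∃ z x : ℂ, ‖z‖ < r ∧ p (z, x) = 0 ∧ ‖1 + z * x‖ = 1 ∧ 0 < z.re := by
  have hs := hp.hasStrictFDerivAt one_ne_zero
  set L := fderiv ℂ p (0, x₀)
  have hLb : L (0, 1) = b := by
    have h1 := hs.hasFDerivAt.comp_hasDerivAt (f := fun x : ℂ => ((0 : ℂ), x)) x₀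
      ((hasDerivAt_const x₀ (0 : ℂ)).prodMk (hasDerivAt_id x₀))
    exact h1.unique hd
  set α := L (1, 0)
  have hL : ∀ u v : ℂ, L (u, v) = u * α + v * b := fun u v => by
    have : ((u, v) : ℂ × ℂ) = u • (1, 0) + v • (0, 1) := by simp
    rw [this, map_add, map_smul, map_smul, hLb, smul_eq_mul, smul_eq_mul]
  have hx₀ : x₀ ≠ 0 := fun h => by simp [h] at him
  have hF : HasStrictFDerivAt (fun v : ℂ × ℂ => (v.1 * v.2, p v))
      (((0 : ℂ) • ContinuousLinearMap.snd ℂ ℂ ℂ + x₀ • ContinuousLinearMap.fst ℂ ℂ ℂ).prod L)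
      (0, x₀) := by
    have h1 : HasStrictFDerivAt (fun v : ℂ × ℂ => v.1) (ContinuousLinearMap.fst ℂ ℂ ℂ) (0, x₀) :=
      hasStrictFDerivAt_fst
    have h2 : HasStrictFDerivAt (fun v : ℂ × ℂ => v.2) (ContinuousLinearMap.snd ℂ ℂ ℂ) (0, x₀) :=
      hasStrictFDerivAt_snd
    exact (h1.fun_mul h2).prodMk hs
  have hsurj : (((0 : ℂ) • ContinuousLinearMap.snd ℂ ℂ ℂ + x₀ • ContinuousLinearMap.fst ℂ ℂ ℂ).prod
      L).range = ⊤ := by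
    rw [LinearMap.range_eq_top]
    rintro ⟨u, v⟩
    refine ⟨(u / x₀, (v - u / x₀ * α) / b), ?_⟩
    simp only [ContinuousLinearMap.coe_coe, ContinuousLinearMap.prod_apply, hL]
    ext
    · simp
      field_simp
    · simp
      field_simp
      ring
  have hmap := hF.map_nhds_eq_of_surj hsurj
  have hV : ∀ᶠ v : ℂ × ℂ in nhds (0, x₀), ‖v.1‖ < r ∧ x₀.im / 2 < v.2.im ∧
      |v.2.re| < |x₀.re| + 1 := by
    refine (ContinuousAt.eventually_lt (by fun_prop) continuousAt_const (by simpa using hr)).and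
      ((ContinuousAt.eventually_lt continuousAt_const
        (Complex.continuous_im.comp continuous_snd).continuousAt ?_).and
      (ContinuousAt.eventually_lt
        (Complex.continuous_re.comp continuous_snd).abs.continuousAt continuousAt_const ?_))
    · simp; linarith
    · simp
  have himage : ∀ᶠ w : ℂ × ℂ in nhds (0, 0), ∃ v : ℂ × ℂ, (‖v.1‖ < r ∧ x₀.im / 2 < v.2.im ∧
      |v.2.re| < |x₀.re| + 1) ∧ (v.1 * v.2, p v) = w := by
    have h1 : Filter.map (fun v : ℂ × ℂ => (v.1 * v.2, p v)) (nhds (0, x₀)) = nhds (0, 0) := by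
      rw [hmap]
      simp [hp0]
    rw [← h1, Filter.eventually_map]
    filter_upwards [hV] with v hv
    exact ⟨v, hv, rfl⟩
  have hcont : Filter.Tendsto (fun ξ : ℝ => (Complex.exp (ξ * Complex.I) - 1, (0 : ℂ))) (nhds 0)
      (nhds (0, 0)) := by
    have : Continuous fun ξ : ℝ => (Complex.exp (ξ * Complex.I) - 1, (0 : ℂ)) := by fun_prop
    simpa using this.tendsto 0
  obtain ⟨δ, hδ, hball⟩ := Metric.eventually_nhds_iff.1 (hcont.eventually himage)
  set ξ : ℝ := min (min (δ / 2) 1) (x₀.im / (4 * (|x₀.re| + 1))) with hξdef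
  have hB : 0 < |x₀.re| + 1 := by positivity
  have hξ : 0 < ξ := by positivity
  have hξ1 : ξ ≤ 1 := (min_le_left _ _).trans (min_le_right _ _)
  have hξδ : ξ ≤ δ / 2 := (min_le_left _ _).trans (min_le_left _ _)
  have hξB : ξ * (4 * (|x₀.re| + 1)) ≤ x₀.im := (le_div_iff₀ (by positivity)).1 (min_le_right _ _)
  obtain ⟨⟨z, x⟩, ⟨hz, hxim, hxre⟩, heq⟩ := hball (y := ξ) (by
    rw [Real.dist_eq, sub_zero, abs_of_pos hξ]
    linarith)
  obtain ⟨hzx, hpz⟩ := Prod.mk.inj heq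
  simp only at hz hxim hxre hzx hpz
  refine ⟨z, x, hz, hpz, ?_, ?_⟩
  · rw [hzx, add_sub_cancel, Complex.norm_exp_ofReal_mul_I]
  · have hxpos : 0 < x.im := by linarith
    have hx0 : x ≠ 0 := fun h => by simp [h] at hxpos
    have hzeq : z = (Complex.exp (ξ * Complex.I) - 1) / x := by
      rw [← hzx]
      field_simp
    have hsin : ξ / 2 < Real.sin ξ := by
      have := Real.sin_gt_sub_cube hξ
      nlinarith [mul_pos hξ hξ, mul_pos (mul_pos hξ hξ) hξ]
    have hcos : 1 - ξ ^ 2 / 2 ≤ Real.cos ξ := Real.one_sub_sq_div_two_le_cos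
    have hcos1 : Real.cos ξ ≤ 1 := Real.cos_le_one ξ
    rw [hzeq, Complex.div_re, ← add_div]
    refine div_pos ?_ (Complex.normSq_pos.2 hx0)
    rw [Complex.sub_re, Complex.sub_im, Complex.exp_ofReal_mul_I_re, Complex.exp_ofReal_mul_I_im,
      Complex.one_re, Complex.one_im, sub_zero]
    have h1 : (1 - Real.cos ξ) * |x.re| ≤ ξ ^ 2 / 2 * (|x₀.re| + 1) := by
      gcongr
      linarith
    have h2 : -((1 - Real.cos ξ) * |x.re|) ≤ (Real.cos ξ - 1) * x.re := by
      have := le_abs_self x.re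
      nlinarith
    have h3 : ξ / 2 * (x₀.im / 2) < Real.sin ξ * x.im := by
      apply mul_lt_mul hsin hxim.le (by positivity) (by linarith)
    nlinarith

end Elliptic

end CamassaHolm

end

open CamassaHolm in
theorem theorem1p1 (U : Set Par) (γ : Par → Par) (Φ : Par → ℝ → ℝ)
    (hmanifold : IsWaveManifold U γ Φ) (q₀ : Par) (hq₀ : q₀ ∈ U)
    (hinvert : (fderiv ℝ freqMassMomentum (γ q₀)).det ≠ 0)
    (hperiod : periodDerivA (γ q₀) ≠ 0)
    (hnondeg : (fderiv ℝ (fun q => γ q 2) q₀ (Pi.single 1 1)) ^ 2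
      + (fderiv ℝ (fun q => γ q 2) q₀ (Pi.single 2 1)) ^ 2 ≠ 0) :
    (StrictlyHyperbolic (whithamMatrix γ Φ q₀) →
      SpectrallyModulationallyStable (q₀ 0) (γ q₀ 2) (Φ q₀)) ∧
    (Elliptic (whithamMatrix γ Φ q₀) →
      SpectrallyUnstable (q₀ 0) (γ q₀ 2) (Φ q₀)) := by
  have hw := hmanifold.wave q₀ hq₀
  have hk : (q₀ 0 : ℂ) ≠ 0 := by exact_mod_cast hw.freq_pos.ne'
  obtain ⟨p, C, r, R, hC, hr, hp, heig, hR, hp0⟩ := hmanifold.exists_dispersion_relation hq₀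
  have hspec := AdjointSystem.mem_linearizationSpectrum_iff hw.freq_pos hw.smooth hw.periodic
    hw.lt_speed
  have hmap : (whithamMatrix γ Φ q₀ + Matrix.scalar (Fin 3) (γ q₀ 2)).map Complex.ofReal =
      (whithamMatrix γ Φ q₀).map Complex.ofReal + Matrix.scalar (Fin 3) (γ q₀ 2 : ℂ) := by
    ext i j
    by_cases hij : i = j
    · subst hij; simp
    · simp [hij]
  -- The roots of the limiting dispersion relation are `-1 / (k (μ + c))` and finite.
  have hprod : ∀ μ : Fin 3 → ℂ, (∀ t : ℂ, (t • (1 : Matrix (Fin 3) (Fin 3) ℂ)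
      - (whithamMatrix γ Φ q₀).map Complex.ofReal).det = ∏ i, (t - μ i)) →
      (∀ i, q₀ 0 * (μ i + γ q₀ 2) ≠ 0) ∧
      ∀ x, p (0, x) = C * ∏ i, (1 + x * (q₀ 0 * (μ i + γ q₀ 2))) := by
    intro μ hμ
    refine ⟨fun i => mul_ne_zero hk fun h0 => ?_, fun x => ?_⟩
    · have h1 := hμ (-(γ q₀ 2 : ℂ))
      rw [Finset.prod_eq_zero (Finset.mem_univ i) (by linear_combination -h0)] at h1
      have h2 := hmanifold.det_whithamMatrix_add_speed_ne_zero hq₀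
      have h3 : (((whithamMatrix γ Φ q₀ + Matrix.scalar (Fin 3) (γ q₀ 2)).map Complex.ofReal).det : ℂ)
          = (((whithamMatrix γ Φ q₀ + Matrix.scalar (Fin 3) (γ q₀ 2)).det : ℝ) : ℂ) :=
        (RingHom.map_det Complex.ofRealHom _).symm
      have h4 : -(γ q₀ 2 : ℂ) • (1 : Matrix (Fin 3) (Fin 3) ℂ)
          - (whithamMatrix γ Φ q₀).map Complex.ofReal =
          -(whithamMatrix γ Φ q₀ + Matrix.scalar (Fin 3) (γ q₀ 2)).map Complex.ofReal := by
        rw [hmap, Matrix.scalar_apply, ← Matrix.smul_one_eq_diagonal]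
        module
      rw [h4, Matrix.det_neg, h3] at h1
      have h5 := (mul_eq_zero.1 h1).resolve_left (by simp)
      exact h2 (by exact_mod_cast h5)
    · rw [hp0, hmap, det_one_add_smul_eq_prod _ hμ]
      simp only [mul_assoc]
  refine ⟨fun hhyp => ?_, fun hell => ?_⟩
  · obtain ⟨μ, hμ, hfac⟩ := hhyp.exists_eigenvalues
    obtain ⟨hne, hpp⟩ := hprod (fun i => (μ i : ℂ)) hfac
    set κ : Fin 3 → ℝ := fun i => q₀ 0 * (μ i + γ q₀ 2) with hκ
    have hκc : ∀ i, (q₀ 0 * (μ i + γ q₀ 2) : ℂ) = (κ i : ℂ) := fun i => by simp [hκ]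
    simp only [hκc] at hne hpp
    have hκ0 : ∀ i, κ i ≠ 0 := fun i => by exact_mod_cast hne i
    have hκinj : Function.Injective fun i => (κ i : ℂ) := by
      refine Complex.ofReal_injective.comp fun i j hij => hμ ?_
      have := mul_left_cancel₀ hw.freq_pos.ne' hij
      linarith
    have hroot : ∀ i, ∃ δ > 0, ∀ z x y : ℂ, z ≠ 0 → ‖z‖ < δ → ‖x - ((-(κ i)⁻¹ : ℝ) : ℂ)‖ < δ →
        p (z, x) = 0 → p (-(starRingEnd ℂ) z, y) = 0 → z * x = -(starRingEnd ℂ) z * y →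
        ‖1 + z * x‖ = 1 → z.re = 0 := fun i => by
      obtain ⟨b, hb, hd⟩ := exists_hasDerivAt_prod hC hκinj (i := i) (hne i)
      have hcast : (-(κ i : ℂ)⁻¹) = ((-(κ i)⁻¹ : ℝ) : ℂ) := by simp
      rw [hcast] at hd
      obtain ⟨K, δ, hK, hδ, hlip⟩ := exists_lipschitz_root (hp 0 ((-(κ i)⁻¹ : ℝ) : ℂ) (by simpa))
        hb (by simpa only [hpp] using hd)
      exact re_eq_zero_of_root (neg_ne_zero.2 (inv_ne_zero (hκ0 i))) hK hδ hlip
    choose δ hδ hroot using hroot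
    have hδm : 0 < min (min (δ 0) (δ 1)) (δ 2) := lt_min (lt_min (hδ 0) (hδ 1)) (hδ 2)
    have hδle : ∀ i, min (min (δ 0) (δ 1)) (δ 2) ≤ δ i := by
      intro i
      fin_cases i <;> simp
    obtain ⟨ε, hε, hnear⟩ := exists_near_root hr hp hR (x₀ := fun i => ((-(κ i)⁻¹ : ℝ) : ℂ))
      (fun x hx => by
        rw [hpp] at hx
        obtain ⟨i, -, hi⟩ := Finset.prod_eq_zero_iff.1 ((mul_eq_zero.1 hx).resolve_left hC)
        refine ⟨i, ?_⟩
        have := hne i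
        push_cast
        field_simp
        linear_combination hi) hδm
    refine ⟨min ε (min r (min (min (δ 0) (δ 1)) (δ 2))), by positivity, fun z hz hzε => ?_⟩
    simp only [lt_min_iff] at hzε
    obtain ⟨h1, h2, h3⟩ := hzε
    rcases eq_or_ne z 0 with rfl | hz0
    · simp
    obtain ⟨ν, hν, hνe⟩ := (hspec z).1 hz
    have hz0' : -(starRingEnd ℂ) z ≠ 0 := by simpa using hz0
    have hνe' := AdjointSystem.hasEigenvalue_monodromy_neg_conj hz0 hν hνe
    have hx : 1 + z * ((ν - 1) / z) = ν := by
      field_simp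
      ring
    have hy : 1 + -(starRingEnd ℂ) z * ((ν - 1) / -(starRingEnd ℂ) z) = ν := by
      rw [mul_div_cancel₀ _ hz0']
      ring
    have hpx := (heig z ((ν - 1) / z) hz0 h2).1 (by rw [hx]; exact hνe)
    have hpy := (heig (-(starRingEnd ℂ) z) ((ν - 1) / -(starRingEnd ℂ) z) hz0'
      (by rw [norm_neg, RCLike.norm_conj]; exact h2)).1 (by rw [hy]; exact hνe')
    obtain ⟨i, hi⟩ := hnear z _ h1 hpx
    refine hroot i z _ _ hz0 ?_ (hi.trans_le (hδle i)) hpx hpy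
      (add_left_cancel (hx.trans hy.symm)) (by rw [hx]; exact hν)
    exact (lt_min (lt_min h3.1.1 h3.1.2) h3.2).trans_le (hδle i)
  · obtain ⟨μ, hμ, him, hfac⟩ := hell.exists_eigenvalues
    obtain ⟨hne, hpp⟩ := hprod μ hfac
    have hinj : Function.Injective fun i => (q₀ 0 * (μ i + γ q₀ 2) : ℂ) := fun i j hij => hμ (by
      have := mul_left_cancel₀ hk hij
      exact add_right_cancel this)
    obtain ⟨b, hb, hd⟩ := exists_hasDerivAt_prod hC hinj (i := 0) (hne 0)
    have hroot : p (0, -(q₀ 0 * (μ 0 + γ q₀ 2) : ℂ)⁻¹) = 0 := by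
      rw [hpp, Finset.prod_eq_zero (Finset.mem_univ 0), mul_zero]
      rw [neg_mul, inv_mul_cancel₀ (hne 0), add_neg_cancel]
    have him' : 0 < (-(q₀ 0 * (μ 0 + γ q₀ 2) : ℂ)⁻¹).im := by
      rw [Complex.neg_im, Complex.inv_im]
      have h1 : (q₀ 0 * (μ 0 + γ q₀ 2) : ℂ).im = q₀ 0 * (μ 0).im := by simp
      rw [h1, neg_div, neg_neg]
      exact div_pos (mul_pos hw.freq_pos him) (Complex.normSq_pos.2 (hne 0))
    obtain ⟨z, x, hz, hpz, hmod, hre⟩ := exists_unit_multiplier hr (hp 0 _ (by simpa)) hroot hb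
      (by simpa only [hpp] using hd) him'
    have hz0 : z ≠ 0 := fun h0 => by simp [h0] at hre
    exact ⟨z, (hspec z).2 ⟨1 + z * x, hmod, (heig z x hz0 hz).2 hpz⟩, hre⟩
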